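/- Let $\tau\in\mathbb C$ with $\operatorname{Im}\tau>0$, let $n\ge 1$ be an integer, put $r=\sqrt{2\pi/\operatorname{Im}\tau}$ and $\mathcal L=r(\mathbb Z+\tau\mathbb Z)$, and identify $\mathbb R^2$ with $\mathbb C$ through $(x_1,x_2)\mapsto x_1+ix_2$. Let $\Omega$ be the elementary cell of $\mathcal L$ spanned by $r$ and $r\tau$ (so $|\Omega|=2\pi$), $J(x_1,x_2)=(-x_2,x_1)$, and $a^n(x)=\frac n2 Jx$. Let $(c_t)_{t\in\mathcal L}$ be real numbers with $c_{s+t}-c_s-c_t-\frac n2\,s\wedge t\in 2\pi\mathbb Z$ for all $s,t\in\mathcal L$, where $s\wedge t=s_1t_2-s_2t_1$. Let $L^2_n$ be the Hilbert space of measurable functions $\psi:\mathbb R^2\to\mathbb C$ (modulo equality a.e.) that are square integrable on $\Omega$ and gauge-periodic, that is, for every $t\in\mathcal L$, $$\psi(x+t)=e^{i\left(\frac n2 x\cdot Jt+c_t\right)}\psi(x)\quad\text{for a.e. }x,$$ with the inner product of $L^2(\Omega)$. Consider on $L^2_n$ the operator $-\Delta_{a^n}=-\sum_{j=1}^2(\partial_{x_j}-ia^n_j)^2$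 whose domain is the set of all $\psi\in L^2_n$ in $H^2_{\mathrm{loc}}(\mathbb R^2)$. Then: 1. $-\Delta_{a^n}$ is a well-defined self-adjoint operator in $L^2_n$. 2. Its spectrum is $\sigma(-\Delta_{a^n})=\{(2m+1)n : m=0,1,2,\dots\}$, and each of these numbers is an eigenvalue of multiplicity $n$. 3. Let $V_n$ be the space of $n$-theta functions, that is, of the functions $\theta:\mathbb C\to\mathbb C$ of the form $$\theta(z)=\sum_{m\in\mathbb Z}b_m e^{2\pi i m z},\qquad b_{m+n}=e^{i\pi n\tau}e^{2\pi i m\tau}b_m\quad(m\in\mathbb Z),$$ with a series of complex coefficients that converges absolutely for every $z\in\mathbb C$. Each $\theta\in V_n$ is determined by the coefficients $b_0,\dots,b_{n-1}$, which can be prescribed arbitrarily; the map $\theta\mapsto(b_0,\dots,b_{n-1})$ is a linear isomorphism $V_n\to\mathbb C^n$, and $\dim_{\mathbb C}V_n=n$. 4. If $c_t=0$ for the two basis vectors $t=r$ and $t=r\tau$ of $\mathcal L$, then $$\operatorname{Null}(-\Delta_{a^n}-n)=e^{\frac{in}{2}x_2(x_1+ix_2)}V_n,$$ that is, the null space consists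 exactly of the functions $x\mapsto e^{\frac{in}{2}x_2(x_1+ix_2)}\,\theta\big((x_1+ix_2)/r\big)$ with $\theta\in V_n$. -/

import Mathlib

open MeasureTheory
open scoped ContDiff ComplexConjugate UpperHalfPlane

noncomputable section

namespace Landau

/-! The plane `ℝ²` is identified with `ℂ` through `(x₁, x₂) ↦ x₁ + i x₂`, so that `x.re` and `x.im`
are the coordinates of `x`; Lebesgue measure on `ℂ` is `volume`. -/

/-! ### Plane geometry and the normalized lattice -/

/-- The dot product of `ℝ²`. -/
def dot (x y : ℂ) : ℝ := x.re * y.re + x.im * y.im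

/-- `J x = x^⊥ = (-x₂, x₁)`. -/
def perp (x : ℂ) : ℂ := ⟨-x.im, x.re⟩

/-- `s ∧ t = s₁ t₂ - s₂ t₁`. -/
def wedge (s t : ℂ) : ℝ := s.re * t.im - s.im * t.re

/-- The scale `√(2π / Im τ)`, which makes the cell of the lattice have area `2π`. -/
def scale (τ : ℍ) : ℝ := √(2 * Real.pi / τ.im)

/-- The point `√(2π / Im τ) (p + q τ)`. -/
def pt (τ : ℍ) (p q : ℝ) : ℂ := (scale τ : ℂ) * ((p : ℂ) + (q : ℂ) * (τ : ℂ))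

lemma pt_add (τ : ℍ) (p q p' q' : ℝ) : pt τ (p + p') (q + q') = pt τ p q + pt τ p' q' := by
  simp only [pt]; push_cast; ring

lemma pt_neg (τ : ℍ) (p q : ℝ) : pt τ (-p) (-q) = -pt τ p q := by
  simp only [pt]; push_cast; ring

/-- The normalized lattice `√(2π / Im τ) (ℤ + τ ℤ)`. -/
def lattice (τ : ℍ) : AddSubgroup ℂ where
  carrier := {t | ∃ p q : ℤ, t = pt τ p q}
  zero_mem' := ⟨0, 0, by simp [pt]⟩
  add_mem' := by
    rintro _ _ ⟨p, q, rfl⟩ ⟨p', q', rfl⟩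
    exact ⟨p + p', q + q', by push_cast; rw [pt_add]⟩
  neg_mem' := by
    rintro _ ⟨p, q, rfl⟩
    exact ⟨-p, -q, by push_cast; rw [pt_neg]⟩

/-- The lattice vector `√(2π / Im τ) (p + q τ)`. -/
def latticePt (τ : ℍ) (p q : ℤ) : lattice τ := ⟨pt τ p q, p, q, rfl⟩

/-- The elementary cell of the lattice spanned by its two basis vectors. -/
def cell (τ : ℍ) : Set ℂ :=
  {x | ∃ p ∈ Set.Ico (0 : ℝ) 1, ∃ q ∈ Set.Ico (0 : ℝ) 1, x = pt τ p q}

/-! ### Gauge-periodic functions -/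

/-- The constants `c_t`, `t` in the lattice, that enter the gauge-periodic boundary condition with
`n` flux quanta per cell; they satisfy `c_{s+t} - c_s - c_t - ½ n s ∧ t ∈ 2πℤ`. -/
structure GaugePhase (τ : ℍ) (n : ℕ) where
  /-- The constants. -/
  c : lattice τ → ℝ
  /-- The compatibility condition. -/
  cocycle : ∀ s t : lattice τ, ∃ k : ℤ,
    c (s + t) - c s - c t - (n : ℝ) / 2 * wedge s t = 2 * Real.pi * k

variable {τ : ℍ} {n : ℕ}

/-- The factor `exp (i ((n/2) x · J t + c_t))`. -/
def gaugeFactor (γ : GaugePhase τ n) (t : lattice τ) (x : ℂ) : ℂ :=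
  Complex.exp (Complex.I * (((n : ℝ) / 2 * dot x (perp t) + γ.c t : ℝ) : ℂ))

/-- The gauge-periodic boundary condition
`ψ (x + t) = exp (i ((n/2) x · J t + c_t)) ψ x`, for every lattice vector `t` and almost every `x`. -/
def IsGaugePeriodic (γ : GaugePhase τ n) (ψ : ℂ → ℂ) : Prop :=
  ∀ t : lattice τ, ∀ᵐ x, ψ (x + (t : ℂ)) = gaugeFactor γ t x * ψ x

/-- The space of (classes of) gauge-periodic functions on the plane that are square integrable on
the elementary cell. -/
def gaugeL2Submodule (γ : GaugePhase τ n) : Submodule ℂ (ℂ →ₘ[(volume : Measure ℂ)] ℂ) where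
  carrier := {ψ | IsGaugePeriodic γ ψ ∧ MemLp ψ 2 (volume.restrict (cell τ))}
  zero_mem' := by
    have h0 : ((0 : ℂ →ₘ[(volume : Measure ℂ)] ℂ) : ℂ → ℂ) =ᵐ[volume] 0 := AEEqFun.coeFn_zero
    refine ⟨fun t => ?_, ?_⟩
    · have h1 := (measurePreserving_add_right (volume : Measure ℂ) (t : ℂ)).quasiMeasurePreserving.ae
        h0
      filter_upwards [h0, h1] with x hx hx1
      simp [hx, hx1]
    · exact (memLp_congr_ae (ae_restrict_of_ae h0)).2 MemLp.zero
  add_mem' := by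
    rintro a b ⟨ha, ha'⟩ ⟨hb, hb'⟩
    have h0 := AEEqFun.coeFn_add a b
    refine ⟨fun t => ?_, ?_⟩
    · have h1 := (measurePreserving_add_right (volume : Measure ℂ) (t : ℂ)).quasiMeasurePreserving.ae
        h0
      filter_upwards [h0, h1, ha t, hb t] with x hx hx1 hxa hxb
      simp [hx, hx1, hxa, hxb, mul_add]
    · exact (memLp_congr_ae (ae_restrict_of_ae h0)).2 (ha'.add hb')
  smul_mem' := by
    rintro z a ⟨ha, ha'⟩
    have h0 := AEEqFun.coeFn_smul z a
    refine ⟨fun t => ?_, ?_⟩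
    · have h1 := (measurePreserving_add_right (volume : Measure ℂ) (t : ℂ)).quasiMeasurePreserving.ae
        h0
      filter_upwards [h0, h1, ha t] with x hx hx1 hxa
      simp only [hx, hx1, Pi.smul_apply, smul_eq_mul, hxa]
      ring
    · exact (memLp_congr_ae (ae_restrict_of_ae h0)).2 (ha'.const_smul z)

/-- The Hilbert space of gauge-periodic functions. -/
abbrev GaugeL2 (γ : GaugePhase τ n) : Type := gaugeL2Submodule γ

/-- Restriction of a gauge-periodic function to the elementary cell. -/
def restrictCell (γ : GaugePhase τ n) :
    GaugeL2 γ →ₗ[ℂ] Lp ℂ 2 ((volume : Measure ℂ).restrict (cell τ)) where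
  toFun ψ := ψ.2.2.toLp _
  map_add' a b := by
    rw [← MemLp.toLp_add a.2.2 b.2.2]
    exact MemLp.toLp_congr _ _ (ae_restrict_of_ae (AEEqFun.coeFn_add _ _))
  map_smul' z a := by
    rw [RingHom.id_apply, ← MemLp.toLp_const_smul z a.2.2]
    exact MemLp.toLp_congr _ _ (ae_restrict_of_ae (AEEqFun.coeFn_smul _ _))

/-! The restriction to the cell is a bijection: this makes the space a Hilbert space. -/

lemma scale_pos (τ : ℍ) : 0 < scale τ := Real.sqrt_pos.2 (by have := τ.im_pos; positivity)

lemma scale_sq (τ : ℍ) : scale τ ^ 2 * τ.im = 2 * Real.pi := by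
  have := τ.im_pos
  rw [scale, Real.sq_sqrt (by positivity)]
  field_simp

lemma pt_re (τ : ℍ) (p q : ℝ) : (pt τ p q).re = scale τ * (p + q * τ.re) := by
  simp [pt]

lemma pt_im (τ : ℍ) (p q : ℝ) : (pt τ p q).im = scale τ * (q * τ.im) := by
  simp [pt]

/-- The second coordinate of a point in the basis of the lattice. -/
def coordQ (τ : ℍ) (x : ℂ) : ℝ := x.im / (scale τ * τ.im)

/-- The first coordinate of a point in the basis of the lattice. -/
def coordP (τ : ℍ) (x : ℂ) : ℝ := x.re / scale τ - coordQ τ x * τ.re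

lemma pt_coord (τ : ℍ) (x : ℂ) : pt τ (coordP τ x) (coordQ τ x) = x := by
  have h1 := (scale_pos τ).ne'
  have h2 := τ.im_pos.ne'
  apply Complex.ext
  · rw [pt_re, coordP, coordQ]; field_simp; ring
  · rw [pt_im, coordQ]; field_simp

lemma coordQ_pt (τ : ℍ) (p q : ℝ) : coordQ τ (pt τ p q) = q := by
  have h1 := (scale_pos τ).ne'
  have h2 := τ.im_pos.ne'
  simp [pt, coordQ]; field_simp

lemma coordP_pt (τ : ℍ) (p q : ℝ) : coordP τ (pt τ p q) = p := by
  have h1 := (scale_pos τ).ne'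
  rw [coordP, coordQ_pt]
  simp [pt]; field_simp; ring

lemma mem_cell_iff (τ : ℍ) (x : ℂ) :
    x ∈ cell τ ↔ coordP τ x ∈ Set.Ico (0 : ℝ) 1 ∧ coordQ τ x ∈ Set.Ico (0 : ℝ) 1 := by
  constructor
  · rintro ⟨p, hp, q, hq, rfl⟩
    rw [coordP_pt, coordQ_pt]
    exact ⟨hp, hq⟩
  · rintro ⟨hp, hq⟩
    exact ⟨_, hp, _, hq, (pt_coord τ x).symm⟩

lemma measurable_coordQ (τ : ℍ) : Measurable (coordQ τ) := by
  unfold coordQ; fun_prop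

lemma measurable_coordP (τ : ℍ) : Measurable (coordP τ) := by
  have := measurable_coordQ τ
  unfold coordP; fun_prop

lemma measurableSet_cell (τ : ℍ) : MeasurableSet (cell τ) := by
  have : cell τ = coordP τ ⁻¹' Set.Ico (0 : ℝ) 1 ∩ coordQ τ ⁻¹' Set.Ico (0 : ℝ) 1 := by
    ext x; exact mem_cell_iff τ x
  rw [this]
  exact (measurable_coordP τ measurableSet_Ico).inter (measurable_coordQ τ measurableSet_Ico)

/-- The lattice vector whose translate of the cell contains `x`. -/
def latticeFloor (τ : ℍ) (x : ℂ) : lattice τ := latticePt τ ⌊coordP τ x⌋ ⌊coordQ τ x⌋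

lemma coord_add_lattice (τ : ℍ) (x : ℂ) (p q : ℤ) :
    coordP τ (x + latticePt τ p q) = coordP τ x + p ∧
      coordQ τ (x + latticePt τ p q) = coordQ τ x + q := by
  have h : x + (latticePt τ p q : ℂ) = pt τ (coordP τ x + p) (coordQ τ x + q) := by
    rw [pt_add, pt_coord]; rfl
  rw [h, coordP_pt, coordQ_pt]
  exact ⟨rfl, rfl⟩

lemma sub_latticeFloor_mem (τ : ℍ) (x : ℂ) : x - latticeFloor τ x ∈ cell τ := by
  refine ⟨Int.fract (coordP τ x), ⟨Int.fract_nonneg _, Int.fract_lt_one _⟩,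
    Int.fract (coordQ τ x), ⟨Int.fract_nonneg _, Int.fract_lt_one _⟩, ?_⟩
  rw [sub_eq_iff_eq_add]
  change x = _ + pt τ _ _
  rw [← pt_add, Int.fract_add_floor, Int.fract_add_floor, pt_coord]

lemma latticeFloor_add (τ : ℍ) (x : ℂ) (t : lattice τ) :
    latticeFloor τ (x + t) = latticeFloor τ x + t := by
  obtain ⟨_, p, q, rfl⟩ := t
  obtain ⟨h1, h2⟩ := coord_add_lattice τ x p q
  apply Subtype.ext
  change pt τ (⌊coordP τ (x + latticePt τ p q)⌋ : ℤ) (⌊coordQ τ (x + latticePt τ p q)⌋ : ℤ) =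
    pt τ (⌊coordP τ x⌋ : ℤ) (⌊coordQ τ x⌋ : ℤ) + pt τ p q
  rw [h1, h2, Int.floor_add_intCast, Int.floor_add_intCast, ← pt_add]
  push_cast
  rfl

lemma latticeFloor_of_mem {x : ℂ} (hx : x ∈ cell τ) : latticeFloor τ x = 0 := by
  obtain ⟨h1, h2⟩ := (mem_cell_iff τ x).1 hx
  apply Subtype.ext
  simp [latticeFloor, latticePt, Int.floor_eq_zero_iff.2 h1, Int.floor_eq_zero_iff.2 h2, pt]

instance instCountableLattice (τ : ℍ) : Countable (lattice τ) := by
  have : Function.Surjective (fun pq : ℤ × ℤ => latticePt τ pq.1 pq.2) := by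
    rintro ⟨_, p, q, rfl⟩
    exact ⟨(p, q), rfl⟩
  exact this.countable

lemma wedge_lattice (s t : lattice τ) : ∃ k : ℤ, wedge s t = 2 * Real.pi * k := by
  obtain ⟨_, p, q, rfl⟩ := s
  obtain ⟨_, p', q', rfl⟩ := t
  refine ⟨p * q' - q * p', ?_⟩
  rw [← scale_sq τ]
  simp [wedge, pt]
  ring

lemma gaugeFactor_ne_zero (γ : GaugePhase τ n) (t : lattice τ) (x : ℂ) : gaugeFactor γ t x ≠ 0 :=
  Complex.exp_ne_zero _

lemma gaugeFactor_zero (γ : GaugePhase τ n) (x : ℂ) : gaugeFactor γ 0 x = 1 := by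
  obtain ⟨k, hk⟩ := γ.cocycle 0 0
  rw [gaugeFactor, Complex.exp_eq_one_iff]
  refine ⟨-k, ?_⟩
  have : γ.c 0 = -(2 * Real.pi * k) := by
    simp [wedge] at hk; linarith
  simp [dot, perp, this]
  ring

lemma gaugeFactor_add (γ : GaugePhase τ n) (s t : lattice τ) (x : ℂ) :
    gaugeFactor γ (s + t) x = gaugeFactor γ t (x + s) * gaugeFactor γ s x := by
  obtain ⟨k, hk⟩ := γ.cocycle s t
  obtain ⟨l, hl⟩ := wedge_lattice s t
  rw [gaugeFactor, gaugeFactor, gaugeFactor, ← Complex.exp_add, Complex.exp_eq_exp_iff_exists_int]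
  refine ⟨k + n * l, ?_⟩
  have : (n : ℝ) / 2 * dot x (perp ((s + t : lattice τ) : ℂ)) + γ.c (s + t) =
      ((n : ℝ) / 2 * dot (x + s) (perp t) + γ.c t) + ((n : ℝ) / 2 * dot x (perp s) + γ.c s)
        + 2 * Real.pi * (k + n * l) := by
    have e : γ.c (s + t) = γ.c s + γ.c t + (n : ℝ) / 2 * wedge s t + 2 * Real.pi * k := by
      linarith
    have e2 : 2 * Real.pi * ((k : ℝ) + n * l) = 2 * Real.pi * k + n * wedge s t := by
      rw [hl]; ring
    rw [e, e2]
    simp [dot, perp, wedge]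
    ring
  rw [this]
  push_cast
  ring

lemma measurable_gaugeFactor (γ : GaugePhase τ n) (t : lattice τ) :
    Measurable (gaugeFactor γ t) := by
  unfold gaugeFactor dot; fun_prop

/-- The gauge-periodic extension to the plane of a function on the cell. -/
def gaugeExtend (γ : GaugePhase τ n) (u : ℂ → ℂ) (x : ℂ) : ℂ :=
  gaugeFactor γ (latticeFloor τ x) (x - latticeFloor τ x) * u (x - latticeFloor τ x)

lemma gaugeExtend_add (γ : GaugePhase τ n) (u : ℂ → ℂ) (x : ℂ) (t : lattice τ) :
    gaugeExtend γ u (x + t) = gaugeFactor γ t x * gaugeExtend γ u x := by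
  have h : x + (t : ℂ) - (latticeFloor τ (x + t) : ℂ) = x - latticeFloor τ x := by
    rw [latticeFloor_add]; push_cast; ring
  rw [gaugeExtend, h, latticeFloor_add, gaugeFactor_add, gaugeExtend, sub_add_cancel, mul_assoc]

lemma gaugeExtend_of_mem (γ : GaugePhase τ n) (u : ℂ → ℂ) {x : ℂ} (hx : x ∈ cell τ) :
    gaugeExtend γ u x = u x := by
  rw [gaugeExtend, latticeFloor_of_mem hx, gaugeFactor_zero]; simp

lemma measurable_gaugeExtend (γ : GaugePhase τ n) {u : ℂ → ℂ} (hu : Measurable u) :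
    Measurable (gaugeExtend γ u) := by
  have hF : Measurable (fun x : ℂ => (⌊coordP τ x⌋, ⌊coordQ τ x⌋)) :=
    (measurable_coordP τ).floor.prodMk (measurable_coordQ τ).floor
  have h : Measurable (Function.uncurry fun (x : ℂ) (pq : ℤ × ℤ) =>
      gaugeFactor γ (latticePt τ pq.1 pq.2) (x - latticePt τ pq.1 pq.2) *
        u (x - latticePt τ pq.1 pq.2)) := by
    refine measurable_from_prod_countable_left fun pq => ?_
    have hs : Measurable fun x : ℂ => x - (latticePt τ pq.1 pq.2 : ℂ) :=
      measurable_id.sub measurable_const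
    have h1 := (measurable_gaugeFactor γ (latticePt τ pq.1 pq.2)).comp hs
    have h2 := hu.comp hs
    exact h1.mul h2
  have e : gaugeExtend γ u = fun x => (Function.uncurry fun (x : ℂ) (pq : ℤ × ℤ) =>
      gaugeFactor γ (latticePt τ pq.1 pq.2) (x - latticePt τ pq.1 pq.2) *
        u (x - latticePt τ pq.1 pq.2)) (x, (⌊coordP τ x⌋, ⌊coordQ τ x⌋)) := by
    funext x
    simp only [gaugeExtend, latticeFloor, Function.uncurry_apply_pair]
  rw [e]
  exact h.comp (measurable_id.prodMk hF)

lemma eq_zero_of_cell {γ : GaugePhase τ n} {ψ : ℂ → ℂ} (hψ : IsGaugePeriodic γ ψ)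
    (h : ψ =ᵐ[volume.restrict (cell τ)] 0) : ψ =ᵐ[volume] 0 := by
  have h1 : ∀ᵐ x, x ∈ cell τ → ψ x = 0 := (ae_restrict_iff' (measurableSet_cell τ)).1 h
  have h2 : ∀ᵐ x : ℂ, ∀ t : lattice τ, x + (t : ℂ) ∈ cell τ → ψ (x + t) = 0 :=
    ae_all_iff.2 fun t =>
      (measurePreserving_add_right (volume : Measure ℂ) (t : ℂ)).quasiMeasurePreserving.ae h1
  filter_upwards [h2, ae_all_iff.2 hψ] with x hx hx'
  have h3 := hx (-latticeFloor τ x) (by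
    have := sub_latticeFloor_mem τ x
    simpa [sub_eq_add_neg] using this)
  rw [hx'] at h3
  exact (mul_eq_zero.1 h3).resolve_left (gaugeFactor_ne_zero _ _ _)

lemma restrictCell_injective (γ : GaugePhase τ n) : Function.Injective (restrictCell γ) := by
  rw [injective_iff_map_eq_zero]
  intro ψ h
  have h1 : ((ψ : ℂ →ₘ[(volume : Measure ℂ)] ℂ) : ℂ → ℂ) =ᵐ[volume.restrict (cell τ)] 0 :=
    (MemLp.coeFn_toLp ψ.2.2).symm.trans (Lp.eq_zero_iff_ae_eq_zero.1 h)
  have h2 := eq_zero_of_cell ψ.2.1 h1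
  exact Subtype.ext (AEEqFun.ext (h2.trans AEEqFun.coeFn_zero.symm))

lemma restrictCell_surjective (γ : GaugePhase τ n) : Function.Surjective (restrictCell γ) := by
  intro u
  have hm := measurable_gaugeExtend γ (Lp.stronglyMeasurable u).measurable
  set e := gaugeExtend γ u
  have hc : e =ᵐ[volume.restrict (cell τ)] u := by
    filter_upwards [ae_restrict_mem (measurableSet_cell τ)] with x hx
    exact gaugeExtend_of_mem γ _ hx
  have h0 := AEEqFun.coeFn_mk e hm.aestronglyMeasurable (μ := (volume : Measure ℂ))
  have hL : MemLp (AEEqFun.mk e hm.aestronglyMeasurable : ℂ →ₘ[(volume : Measure ℂ)] ℂ) 2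
      (volume.restrict (cell τ)) :=
    (memLp_congr_ae (Filter.EventuallyEq.trans (ae_restrict_of_ae h0) hc)).2 (Lp.memLp u)
  refine ⟨⟨AEEqFun.mk e hm.aestronglyMeasurable, fun t => ?_, hL⟩, ?_⟩
  · have h1 := (measurePreserving_add_right (volume : Measure ℂ) (t : ℂ)).quasiMeasurePreserving.ae
      h0
    filter_upwards [h0, h1] with x hx hx1
    rw [hx, hx1]
    exact gaugeExtend_add γ _ x t
  · refine Lp.ext ?_
    exact (MemLp.coeFn_toLp hL).trans (Filter.EventuallyEq.trans (ae_restrict_of_ae h0) hc)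

instance instNormedAddCommGroup (γ : GaugePhase τ n) : NormedAddCommGroup (GaugeL2 γ) :=
  NormedAddCommGroup.induced _ _ (restrictCell γ) (restrictCell_injective γ)

/-- The inner product of `L²` of the cell. -/
instance instInnerProductSpace (γ : GaugePhase τ n) : InnerProductSpace ℂ (GaugeL2 γ) :=
  InnerProductSpace.induced (restrictCell γ)

lemma inner_eq_integral (γ : GaugePhase τ n) (φ ψ : GaugeL2 γ) :
    inner ℂ φ ψ = ∫ x in cell τ, conj ((φ : ℂ →ₘ[(volume : Measure ℂ)] ℂ) x) *
      (ψ : ℂ →ₘ[(volume : Measure ℂ)] ℂ) x := by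
  change inner ℂ (restrictCell γ φ) (restrictCell γ ψ) = _
  rw [L2.inner_def]
  refine integral_congr_ae ?_
  filter_upwards [MemLp.coeFn_toLp φ.2.2, MemLp.coeFn_toLp ψ.2.2] with x h1 h2
  have h1' : restrictCell γ φ x = (φ : ℂ →ₘ[(volume : Measure ℂ)] ℂ) x := h1
  have h2' : restrictCell γ ψ x = (ψ : ℂ →ₘ[(volume : Measure ℂ)] ℂ) x := h2
  rw [h1', h2', RCLike.inner_apply']

instance instCompleteSpace (γ : GaugePhase τ n) : CompleteSpace (GaugeL2 γ) := by
  have hi : Isometry (restrictCell γ) := AddMonoidHomClass.isometry_of_norm _ fun _ => rfl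
  exact (IsometryEquiv.mk' (restrictCell γ) (Function.surjInv (restrictCell_surjective γ))
    (Function.surjInv_eq (restrictCell_surjective γ)) hi).completeSpace

/-! ### Weak derivatives -/

/-- The coordinate vectors of the plane. -/
def basisVec : Fin 2 → ℂ := ![1, Complex.I]

/-- `g` is the weak partial derivative `∂f/∂x_j` on the plane. -/
def HasWeakPartial (j : Fin 2) (f g : ℂ → ℂ) : Prop :=
  LocallyIntegrable f ∧ LocallyIntegrable g ∧
    ∀ φ : ℂ → ℝ, ContDiff ℝ ∞ φ → HasCompactSupport φ →
      ∫ x, fderiv ℝ φ x (basisVec j) • f x = -∫ x, φ x • g x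

/-- `f ∈ L²_loc(ℝ²)`. -/
def MemL2Loc (f : ℂ → ℂ) : Prop :=
  ∀ K : Set ℂ, IsCompact K → MemLp f 2 (volume.restrict K)

/-- `f ∈ H²_loc(ℝ²)`: all weak partial derivatives of order at most two are in `L²_loc`. -/
def MemH2Loc (f : ℂ → ℂ) : Prop :=
  MemL2Loc f ∧ ∃ (g : Fin 2 → ℂ → ℂ) (h : Fin 2 → Fin 2 → ℂ → ℂ),
    (∀ j, MemL2Loc (g j) ∧ HasWeakPartial j f (g j)) ∧
      ∀ j k, MemL2Loc (h j k) ∧ HasWeakPartial k (g j) (h j k)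

lemma HasWeakPartial.congr {j : Fin 2} {f f' g g' : ℂ → ℂ} (h : HasWeakPartial j f g)
    (hf : f =ᵐ[volume] f') (hg : g =ᵐ[volume] g') : HasWeakPartial j f' g' := by
  refine ⟨h.1.congr hf, h.2.1.congr hg, fun φ h1 h2 => ?_⟩
  rw [← integral_congr_ae (hf.mono fun x hx => congrArg (fderiv ℝ φ x (basisVec j) • ·) hx),
    ← integral_congr_ae (hg.mono fun x hx => congrArg (φ x • ·) hx)]
  exact h.2.2 φ h1 h2

lemma integrable_test {f : ℂ → ℂ} (hf : LocallyIntegrable f) {φ : ℂ → ℝ} (h1 : Continuous φ)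
    (h2 : HasCompactSupport φ) : Integrable (fun x => φ x • f x) :=
  hf.integrable_smul_left_of_hasCompactSupport h1 h2

lemma integrable_test_deriv (j : Fin 2) {f : ℂ → ℂ} (hf : LocallyIntegrable f) {φ : ℂ → ℝ}
    (h1 : ContDiff ℝ ∞ φ) (h2 : HasCompactSupport φ) :
    Integrable (fun x => fderiv ℝ φ x (basisVec j) • f x) :=
  integrable_test hf ((h1.continuous_fderiv (by simp)).clm_apply continuous_const)
    (h2.fderiv_apply ℝ _)

lemma HasWeakPartial.add {j : Fin 2} {f f' g g' : ℂ → ℂ} (h : HasWeakPartial j f g)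
    (h' : HasWeakPartial j f' g') : HasWeakPartial j (f + f') (g + g') := by
  refine ⟨h.1.add h'.1, h.2.1.add h'.2.1, fun φ h1 h2 => ?_⟩
  simp only [Pi.add_apply, smul_add]
  rw [integral_add (integrable_test_deriv j h.1 h1 h2) (integrable_test_deriv j h'.1 h1 h2),
    integral_add (integrable_test h.2.1 h1.continuous h2) (integrable_test h'.2.1 h1.continuous h2),
    h.2.2 φ h1 h2, h'.2.2 φ h1 h2]
  ring

lemma HasWeakPartial.smul {j : Fin 2} {f g : ℂ → ℂ} (z : ℂ) (h : HasWeakPartial j f g) :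
    HasWeakPartial j (z • f) (z • g) := by
  refine ⟨h.1.smul z, h.2.1.smul z, fun φ h1 h2 => ?_⟩
  simp only [Pi.smul_apply, smul_comm _ z]
  rw [integral_smul, integral_smul, h.2.2 φ h1 h2, smul_neg]

lemma HasWeakPartial.eq_zero {j : Fin 2} {f g : ℂ → ℂ} (h : HasWeakPartial j f g)
    (hf : f =ᵐ[volume] 0) : g =ᵐ[volume] 0 := by
  have h' := h.congr hf Filter.EventuallyEq.rfl
  refine ae_eq_zero_of_integral_contDiff_smul_eq_zero h.2.1 fun φ h1 h2 => ?_
  have := h'.2.2 φ h1 h2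
  simpa using this.symm

lemma HasWeakPartial.zero (j : Fin 2) : HasWeakPartial j 0 0 :=
  ⟨locallyIntegrable_zero, locallyIntegrable_zero, fun φ _ _ => by simp⟩

lemma MemL2Loc.zero : MemL2Loc 0 := fun _ _ => MemLp.zero

lemma MemL2Loc.add {f g : ℂ → ℂ} (hf : MemL2Loc f) (hg : MemL2Loc g) : MemL2Loc (f + g) :=
  fun K hK => (hf K hK).add (hg K hK)

lemma MemL2Loc.smul {f : ℂ → ℂ} (z : ℂ) (hf : MemL2Loc f) : MemL2Loc (z • f) :=
  fun K hK => (hf K hK).const_smul z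

lemma MemL2Loc.congr {f g : ℂ → ℂ} (hf : MemL2Loc f) (h : f =ᵐ[volume] g) : MemL2Loc g :=
  fun K hK => (memLp_congr_ae (ae_restrict_of_ae h)).1 (hf K hK)

lemma MemH2Loc.zero : MemH2Loc 0 :=
  ⟨.zero, 0, 0, fun j => ⟨.zero, .zero j⟩, fun _ k => ⟨.zero, .zero k⟩⟩

lemma MemH2Loc.add {f f' : ℂ → ℂ} (h : MemH2Loc f) (h' : MemH2Loc f') : MemH2Loc (f + f') := by
  obtain ⟨h0, a, b, ha, hb⟩ := h
  obtain ⟨h0', a', b', ha', hb'⟩ := h'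
  exact ⟨h0.add h0', a + a', b + b', fun j => ⟨(ha j).1.add (ha' j).1, (ha j).2.add (ha' j).2⟩,
    fun j k => ⟨(hb j k).1.add (hb' j k).1, (hb j k).2.add (hb' j k).2⟩⟩

lemma MemH2Loc.smul {f : ℂ → ℂ} (z : ℂ) (h : MemH2Loc f) : MemH2Loc (z • f) := by
  obtain ⟨h0, a, b, ha, hb⟩ := h
  exact ⟨h0.smul z, z • a, z • b, fun j => ⟨(ha j).1.smul z, (ha j).2.smul z⟩,
    fun j k => ⟨(hb j k).1.smul z, (hb j k).2.smul z⟩⟩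

lemma MemH2Loc.congr {f f' : ℂ → ℂ} (h : MemH2Loc f) (hf : f =ᵐ[volume] f') : MemH2Loc f' := by
  obtain ⟨h0, a, b, ha, hb⟩ := h
  exact ⟨h0.congr hf, a, b, fun j => ⟨(ha j).1, (ha j).2.congr hf .rfl⟩, hb⟩

/-! ### The magnetic Laplacian -/

/-- The components of the magnetic potential `aⁿ(x) = (n/2) J x`. -/
def potential (n : ℕ) (j : Fin 2) (x : ℂ) : ℝ := (n : ℝ) / 2 * dot (perp x) (basisVec j)

/-- `g = (∂_j - i aⁿ_j) f` in the weak sense. -/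
def HasWeakCovDeriv (n : ℕ) (j : Fin 2) (f g : ℂ → ℂ) : Prop :=
  HasWeakPartial j f fun x => g x + Complex.I * (potential n j x : ℂ) * f x

/-- `g = -Δ_{aⁿ} f`, where `Δ_{aⁿ} = ∑_j (∂_j - i aⁿ_j)²`, in the weak sense. -/
def IsNegMagneticLaplacian (n : ℕ) (f g : ℂ → ℂ) : Prop :=
  ∃ d e : Fin 2 → ℂ → ℂ, (∀ j, HasWeakCovDeriv n j f (d j)) ∧
    (∀ j, HasWeakCovDeriv n j (d j) (e j)) ∧ g =ᵐ[volume] -∑ j, e j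

lemma HasWeakCovDeriv.congr {j : Fin 2} {f f' g g' : ℂ → ℂ} (h : HasWeakCovDeriv n j f g)
    (hf : f =ᵐ[volume] f') (hg : g =ᵐ[volume] g') : HasWeakCovDeriv n j f' g' := by
  refine HasWeakPartial.congr h hf ?_
  filter_upwards [hf, hg] with x h1 h2
  rw [h1, h2]

lemma HasWeakCovDeriv.add {j : Fin 2} {f f' g g' : ℂ → ℂ} (h : HasWeakCovDeriv n j f g)
    (h' : HasWeakCovDeriv n j f' g') : HasWeakCovDeriv n j (f + f') (g + g') := by
  refine (HasWeakPartial.add h h').congr .rfl (.of_forall fun x => ?_)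
  simp only [Pi.add_apply]; ring

lemma HasWeakCovDeriv.smul {j : Fin 2} {f g : ℂ → ℂ} (z : ℂ) (h : HasWeakCovDeriv n j f g) :
    HasWeakCovDeriv n j (z • f) (z • g) := by
  refine (HasWeakPartial.smul z h).congr .rfl (.of_forall fun x => ?_)
  simp only [Pi.smul_apply, smul_eq_mul]; ring

lemma HasWeakCovDeriv.eq_zero {j : Fin 2} {f g : ℂ → ℂ} (h : HasWeakCovDeriv n j f g)
    (hf : f =ᵐ[volume] 0) : g =ᵐ[volume] 0 := by
  filter_upwards [HasWeakPartial.eq_zero h hf, hf] with x h1 h2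
  simpa [h2] using h1

lemma IsNegMagneticLaplacian.congr {f f' g g' : ℂ → ℂ} (h : IsNegMagneticLaplacian n f g)
    (hf : f =ᵐ[volume] f') (hg : g =ᵐ[volume] g') : IsNegMagneticLaplacian n f' g' := by
  obtain ⟨d, e, hd, he, hge⟩ := h
  exact ⟨d, e, fun j => (hd j).congr hf .rfl, he, hg.symm.trans hge⟩

lemma IsNegMagneticLaplacian.eq_zero {f g : ℂ → ℂ} (h : IsNegMagneticLaplacian n f g)
    (hf : f =ᵐ[volume] 0) : g =ᵐ[volume] 0 := by
  obtain ⟨d, e, hd, he, hge⟩ := h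
  have h1 := ae_all_iff.2 fun j => (he j).eq_zero ((hd j).eq_zero hf)
  filter_upwards [hge, h1] with x hx hx'
  simp [hx, hx']

/-- The graph of `-Δ_{aⁿ}` on gauge-periodic functions of class `H²_loc`. -/
def magneticGraph (γ : GaugePhase τ n) : Submodule ℂ (GaugeL2 γ × GaugeL2 γ) where
  carrier := {p | MemH2Loc p.1.1 ∧ IsNegMagneticLaplacian n p.1.1 p.2.1}
  zero_mem' := by
    have h0 : ((0 : ℂ →ₘ[(volume : Measure ℂ)] ℂ) : ℂ → ℂ) =ᵐ[volume] 0 := AEEqFun.coeFn_zero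
    refine ⟨MemH2Loc.zero.congr h0.symm, 0, 0, fun j => ?_, fun j => ?_, ?_⟩
    · refine HasWeakCovDeriv.congr (f := 0) ?_ h0.symm .rfl
      exact (HasWeakPartial.zero j).congr .rfl (.of_forall fun x => by simp)
    · exact (HasWeakPartial.zero j).congr .rfl (.of_forall fun x => by simp)
    · refine h0.trans (.of_forall fun x => by simp)
  add_mem' := by
    rintro p p' ⟨h, d, e, hd, he, hv⟩ ⟨h', d', e', hd', he', hv'⟩
    have h0 := AEEqFun.coeFn_add p.1.1 p'.1.1
    refine ⟨(h.add h').congr h0.symm, d + d', e + e',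
      fun j => ((hd j).add (hd' j)).congr h0.symm .rfl, fun j => (he j).add (he' j), ?_⟩
    refine (AEEqFun.coeFn_add p.2.1 p'.2.1).trans ?_
    filter_upwards [hv, hv'] with x hx hx'
    simp [hx, hx']; ring
  smul_mem' := by
    rintro z p ⟨h, d, e, hd, he, hv⟩
    have h0 := AEEqFun.coeFn_smul z p.1.1
    refine ⟨(h.smul z).congr h0.symm, z • d, z • e,
      fun j => ((hd j).smul z).congr h0.symm .rfl, fun j => (he j).smul z, ?_⟩
    refine (AEEqFun.coeFn_smul z p.2.1).trans ?_
    filter_upwards [hv] with x hx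
    simp [hx]; ring

/-- The operator `-Δ_{aⁿ}` on the Hilbert space of gauge-periodic functions. -/
def magneticLaplacian (γ : GaugePhase τ n) : GaugeL2 γ →ₗ.[ℂ] GaugeL2 γ :=
  (magneticGraph γ).toLinearPMap

/-- The graph above is single-valued, hence it is the graph of the operator. -/
lemma magneticLaplacian_graph (γ : GaugePhase τ n) :
    (magneticLaplacian γ).graph = magneticGraph γ := by
  refine Submodule.toLinearPMap_graph_eq _ ?_
  rintro ⟨u, v⟩ ⟨_, h⟩ hu
  have hu' : u = 0 := hu
  subst hu'
  have := h.eq_zero (AEEqFun.coeFn_zero (μ := (volume : Measure ℂ)))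
  exact Subtype.ext (AEEqFun.ext (this.trans AEEqFun.coeFn_zero.symm))

/-! ### Spectrum and eigenspaces of unbounded operators -/

/-- The spectrum of an unbounded operator `A`: the complement of the set of all `z` for which
`A - z` is a bijection from the domain of `A` onto the space with bounded inverse. -/
def unboundedSpectrum {H : Type*} [NormedAddCommGroup H] [NormedSpace ℂ H] (A : H →ₗ.[ℂ] H) :
    Set ℂ :=
  {z | ¬ ∃ R : H →L[ℂ] H, (∀ u : A.domain, R (A u - z • (u : H)) = u) ∧
    ∀ f : H, ∃ u : A.domain, (u : H) = R f ∧ A u - z • (u : H) = f}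

/-- The null space of `A - z`. -/
def eigenspace {H : Type*} [AddCommGroup H] [Module ℂ H] (A : H →ₗ.[ℂ] H) (z : ℂ) :
    Submodule ℂ H :=
  (LinearMap.ker (A.toFun - z • A.domain.subtype)).map A.domain.subtype

/-! ### Theta functions -/

/-- `θ` has the everywhere convergent expansion `θ(z) = ∑_{m ∈ ℤ} c_m e^{2πimz}`, with
`c_{m+n} = e^{iπnτ} e^{2πimτ} c_m`. -/
def IsThetaExpansion (τ : ℍ) (n : ℕ) (c : ℤ → ℂ) (θ : ℂ → ℂ) : Prop :=
  (∀ m : ℤ, c (m + n) = Complex.exp (Complex.I * Real.pi * n * τ) *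
    Complex.exp (2 * Complex.I * m * Real.pi * τ) * c m) ∧
  ∀ z : ℂ, HasSum (fun m : ℤ => c m * Complex.exp (2 * Real.pi * Complex.I * m * z)) (θ z)

/-- The space `V_n` of `n`-theta functions. -/
def thetaSpace (τ : ℍ) (n : ℕ) : Submodule ℂ (ℂ → ℂ) where
  carrier := {θ | ∃ c, IsThetaExpansion τ n c θ}
  zero_mem' := ⟨0, fun m => by simp, fun z => by simp⟩
  add_mem' := by
    rintro θ θ' ⟨c, h1, h2⟩ ⟨c', h1', h2'⟩
    refine ⟨c + c', fun m => ?_, fun z => ?_⟩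
    · simp only [Pi.add_apply, h1, h1']; ring
    · simpa [add_mul] using (h2 z).add (h2' z)
  smul_mem' := by
    rintro w θ ⟨c, h1, h2⟩
    refine ⟨w • c, fun m => ?_, fun z => ?_⟩
    · simp only [Pi.smul_apply, smul_eq_mul, h1]; ring
    · simpa [mul_assoc] using (h2 z).mul_left w

/-- The factor `e^{(in/2) x₂ (x₁ + i x₂)}`. -/
def thetaFactor (n : ℕ) (x : ℂ) : ℂ :=
  Complex.exp (Complex.I * n / 2 * x.im * (x.re + Complex.I * x.im))

end Landau

end

noncomputable section

namespace Landau

/-! ### Operators that are diagonal in a Hilbert basis -/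

section Diagonal

variable {H : Type*} [NormedAddCommGroup H] [InnerProductSpace ℂ H]
  {ι : Type*} (b : HilbertBasis ι ℂ H)

/-! The proof is the ladder argument for the harmonic oscillator, made rigorous by an explicit
orthonormal basis; elliptic regularity and compactness of the resolvent are not used.

On smooth gauge-periodic functions the two covariant derivatives are skew-symmetric for the inner
product of the cell, and their commutator is the constant flux (`covariantPair_smooth`). Hence
`lowering` and `raising` are formal adjoints, they commute up to 2n, and the Laplacian is raising
times lowering plus n. Starting from functions killed by `lowering`, powers of `raising` give
mutually orthogonal levels with eigenvalues (2k+1)n (`exists_ladder_basis`).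

The vacuum functions are written down explicitly. A `mode` is a plane wave in x₁ times a polynomial
times a Gaussian in x₂. Translation by r multiplies it by the gauge factor, and translation by rτ
moves index m to m + n, so sums of modes with weights periodic mod n are gauge-periodic. Covariant
derivatives act on the polynomial alone. The polynomial 1 gives an n-dimensional space killed by
`lowering`, and multiplication by X is a multiple of a covariant derivative, so all modes lie in the
span of the ladders (`smoothMode_mem_ladderSpan`).

Totality is the analytic core (`eq_zero_of_inner_smoothMode`). If u is orthogonal to all sums of
modes, unfolding turns an integral over the cell into an integral of one mode over an infinite
strip. Letting the polynomial vary makes all moments in q of an exponentially decaying function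
vanish, so on almost every line q = const all Fourier coefficients of u, up to a unimodular factor,
are zero.

It remains to see that the operator on the H²_loc domain is the maximal diagonal operator in this
basis (`mem_graph_iff_of_basis`). One direction is integration by parts. The other approximates by
partial sums and uses that the Laplacian controls all second covariant derivatives
(`norm_cov_cov_le`). Self-adjointness, spectrum and multiplicities are then statements about
diagonal operators. The lowest eigenspace consists of the vacuum functions, and completing the
square turns these into theta functions when the two basis phases vanish (`modeSum_one_eq_theta`).
-/

lemma hilbertBasis_ext {u v : H} (h : ∀ i, inner ℂ (b i) u = inner ℂ (b i) v) : u = v := by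
  apply b.repr.injective
  ext i
  simpa [b.repr_apply_apply] using h i

/-- The bounded operator which is diagonal in a Hilbert basis, with given bounded diagonal. -/
lemma exists_diagonal (μ : ι → ℂ) {C : ℝ} (hC : 0 ≤ C) (hμ : ∀ i, ‖μ i‖ ≤ C) :
    ∃ R : H →L[ℂ] H, ∀ f i, inner ℂ (b i) (R f) = μ i * inner ℂ (b i) f := by
  have hpt : ∀ (f : lp (fun _ : ι => ℂ) 2) i, ‖μ i * f i‖ ≤ ‖(C : ℂ) * f i‖ := by
    intro f i
    rw [norm_mul, norm_mul, Complex.norm_real, Real.norm_of_nonneg hC]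
    exact mul_le_mul_of_nonneg_right (hμ i) (norm_nonneg _)
  have hmem : ∀ f : lp (fun _ : ι => ℂ) 2, Memℓp (fun i => μ i * f i) 2 := fun f =>
    (lp.memℓp ((C : ℂ) • f)).mono' (fun i => hpt f i)
  let M : lp (fun _ : ι => ℂ) 2 →ₗ[ℂ] lp (fun _ : ι => ℂ) 2 :=
    { toFun := fun f => ⟨fun i => μ i * f i, hmem f⟩
      map_add' := fun f g => by ext i; exact mul_add _ _ _
      map_smul' := fun c f => by ext i; simp; ring }
  have hM : ∀ f, ‖M f‖ ≤ C * ‖f‖ := by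
    intro f
    have h1 : ‖M f‖ ≤ ‖(C : ℂ) • f‖ := lp.norm_mono (by simp) fun i => hpt f i
    rwa [norm_smul, Complex.norm_real, Real.norm_of_nonneg hC] at h1
  let M' := M.mkContinuous C hM
  refine ⟨(b.repr.symm.toContinuousLinearEquiv : _ →L[ℂ] H) ∘L M' ∘L
    (b.repr.toContinuousLinearEquiv : H →L[ℂ] _), fun f i => ?_⟩
  rw [← b.repr_apply_apply, ← b.repr_apply_apply]
  simp [M', M]

variable {b} {l : ι → ℝ} {T : H →ₗ.[ℂ] H}

lemma diagonal_apply
    (hT : ∀ u f, (u, f) ∈ T.graph ↔ ∀ i, inner ℂ (b i) f = (l i : ℂ) * inner ℂ (b i) u)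
    (u : T.domain) (i : ι) :
    inner ℂ (b i) (T u) = (l i : ℂ) * inner ℂ (b i) (u : H) :=
  (hT _ _).1 (T.mem_graph u) i

lemma basis_mem_graph
    (hT : ∀ u f, (u, f) ∈ T.graph ↔ ∀ i, inner ℂ (b i) f = (l i : ℂ) * inner ℂ (b i) u)
    (i : ι) : (b i, (l i : ℂ) • b i) ∈ T.graph := by
  classical
  refine (hT _ _).2 fun j => ?_
  rw [inner_smul_right, orthonormal_iff_ite.1 b.orthonormal j i]
  split_ifs with h
  · rw [h]
  · simp

lemma dense_domain_of_diagonal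
    (hT : ∀ u f, (u, f) ∈ T.graph ↔ ∀ i, inner ℂ (b i) f = (l i : ℂ) * inner ℂ (b i) u) :
    Dense (T.domain : Set H) := by
  have h1 : (⊤ : Submodule ℂ H) ≤ T.domain.topologicalClosure := by
    rw [← b.dense_span]
    refine Submodule.topologicalClosure_mono (Submodule.span_le.2 ?_)
    rintro _ ⟨i, rfl⟩
    exact T.mem_domain_of_mem_graph (basis_mem_graph hT i)
  exact Submodule.dense_iff_topologicalClosure_eq_top.2 (top_le_iff.1 h1)

/-- Testing an element of the adjoint graph against the pairs (b i, l i • b i) yields the coordinate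
condition, because l i is real. Conversely, that condition gives the adjoint identity by Parseval.
So the adjoint has the same graph; this uses that the graph contains every pair allowed by its
coordinates. -/
lemma isSelfAdjoint_of_diagonal
    (hT : ∀ u f, (u, f) ∈ T.graph ↔ ∀ i, inner ℂ (b i) f = (l i : ℂ) * inner ℂ (b i) u)
    [CompleteSpace H] : IsSelfAdjoint T := by
  rw [LinearPMap.isSelfAdjoint_def]
  apply LinearPMap.eq_of_eq_graph
  rw [LinearPMap.adjoint_graph_eq_graph_adjoint (dense_domain_of_diagonal hT)]
  ext ⟨v, w⟩
  rw [Submodule.mem_adjoint_iff, hT]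
  constructor
  · intro h i
    have h1 := h _ _ (basis_mem_graph hT i)
    rw [inner_smul_left, sub_eq_zero] at h1
    simpa using h1.symm
  · intro h a f haf
    rw [hT] at haf
    have e1 := b.hasSum_inner_mul_inner f v
    have e2 := b.hasSum_inner_mul_inner a w
    refine sub_eq_zero.2 (e1.unique (e2.congr_fun fun i => ?_))
    rw [h i, ← inner_conj_symm f, haf i, ← inner_conj_symm a]
    simp; ring

lemma mem_eigenspace_iff_of_diagonal
    (hT : ∀ u f, (u, f) ∈ T.graph ↔ ∀ i, inner ℂ (b i) f = (l i : ℂ) * inner ℂ (b i) u)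
    (z : ℂ) (u : H) :
    u ∈ eigenspace T z ↔ ∀ i, (l i : ℂ) ≠ z → inner ℂ (b i) u = 0 := by
  have key : u ∈ eigenspace T z ↔ (u, z • u) ∈ T.graph := by
    rw [LinearPMap.mem_graph_iff, eigenspace, Submodule.mem_map]
    constructor
    · rintro ⟨y, hy, rfl⟩
      refine ⟨y, rfl, ?_⟩
      have := LinearMap.mem_ker.1 hy
      simpa [sub_eq_zero] using this
    · rintro ⟨y, rfl, h⟩
      refine ⟨y, LinearMap.mem_ker.2 ?_, rfl⟩
      have h' : T.toFun y = z • (y : H) := h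
      simp [h']
  rw [key, hT]
  refine forall_congr' fun i => ?_
  rw [inner_smul_right, mul_eq_mul_right_iff]
  constructor
  · rintro (h | h) h'
    exacts [absurd h.symm h', h]
  · intro h
    by_cases h' : (l i : ℂ) = z
    exacts [Or.inl h'.symm, Or.inr (h h')]

/-- Off the diagonal values the resolvent is diagonal with entries 1/(l i - z), bounded by 1/δ. The
gap hypothesis says that the set of diagonal values is closed, without which the spectrum would be
its closure. -/
lemma unboundedSpectrum_of_diagonal
    (hT : ∀ u f, (u, f) ∈ T.graph ↔ ∀ i, inner ℂ (b i) f = (l i : ℂ) * inner ℂ (b i) u)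
    (hl : ∀ z : ℂ, z ∉ Set.range (fun i => (l i : ℂ)) → ∃ δ > 0, ∀ i, δ ≤ ‖(l i : ℂ) - z‖) :
    unboundedSpectrum T = Set.range (fun i => (l i : ℂ)) := by
  ext z
  constructor
  · intro hz
    by_contra hz'
    apply hz
    obtain ⟨δ, hδ, h⟩ := hl z hz'
    have hne : ∀ i, (l i : ℂ) - z ≠ 0 := fun i hi => by
      have := h i
      rw [hi, norm_zero] at this
      linarith
    obtain ⟨R, hR⟩ := exists_diagonal b (fun i => ((l i : ℂ) - z)⁻¹) (C := δ⁻¹) (by positivity)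
      (fun i => by rw [norm_inv]; exact inv_anti₀ hδ (h i))
    refine ⟨R, fun u => hilbertBasis_ext b fun i => ?_, fun f => ?_⟩
    · rw [hR, inner_sub_right, inner_smul_right, diagonal_apply hT, ← sub_mul, ← mul_assoc,
        inv_mul_cancel₀ (hne i), one_mul]
    -- Maximality of the graph puts `R f` in the domain: the pair has the right coordinates since
    -- l/(l - z) = 1 + z/(l - z).
    · have hg : (R f, f + z • R f) ∈ T.graph := by
        refine (hT _ _).2 fun i => ?_
        rw [inner_add_right, inner_smul_right, hR]
        have := hne i
        field_simp
        ring
      obtain ⟨y, hy, hy'⟩ := LinearPMap.mem_graph_iff _ |>.1 hg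
      exact ⟨y, hy, by rw [hy', hy]; simp⟩
  · rintro ⟨i, rfl⟩ ⟨R, hR, -⟩
    obtain ⟨y, hy, hy'⟩ := LinearPMap.mem_graph_iff _ |>.1 (basis_mem_graph hT i)
    have h1 := hR y
    rw [hy', hy] at h1
    simp only [sub_self, map_zero] at h1
    exact b.orthonormal.ne_zero i h1.symm

end Diagonal

/-! ### Ladder operators -/

section Ladder

variable {H : Type*} [NormedAddCommGroup H] [InnerProductSpace ℂ H]
  {E : Type*} [AddCommGroup E] [Module ℂ E]

/-- A pair of covariant derivatives on a space `E` which is mapped to a Hilbert space: they are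
skew-symmetric and their commutator is the constant `-iν`. -/
structure CovariantPair (j : E →ₗ[ℂ] H) (D : Fin 2 → E →ₗ[ℂ] E) (ν : ℝ) : Prop where
  skew : ∀ k x y, inner ℂ (j x) (j (D k y)) = -inner ℂ (j (D k x)) (j y)
  comm : ∀ x, D 1 (D 0 x) = D 0 (D 1 x) + (Complex.I * ν) • x

/-- The annihilation operator `D₁ + i D₂`. -/
def lowering (D : Fin 2 → E →ₗ[ℂ] E) : E →ₗ[ℂ] E := D 0 + Complex.I • D 1

/-- The creation operator `-(D₁ - i D₂)`. -/
def raising (D : Fin 2 → E →ₗ[ℂ] E) : E →ₗ[ℂ] E := -(D 0 - Complex.I • D 1)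

/-- The operator `-(D₁² + D₂²)`. -/
def negLaplacian (D : Fin 2 → E →ₗ[ℂ] E) : E →ₗ[ℂ] E := -∑ k, D k ∘ₗ D k

lemma lowering_apply (D : Fin 2 → E →ₗ[ℂ] E) (x : E) :
    lowering D x = D 0 x + Complex.I • D 1 x := rfl

lemma raising_apply (D : Fin 2 → E →ₗ[ℂ] E) (x : E) :
    raising D x = -(D 0 x - Complex.I • D 1 x) := rfl

lemma negLaplacian_apply (D : Fin 2 → E →ₗ[ℂ] E) (x : E) :
    negLaplacian D x = -(D 0 (D 0 x) + D 1 (D 1 x)) := by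
  simp [negLaplacian]

lemma zero_eq_half_ladder (D : Fin 2 → E →ₗ[ℂ] E) (x : E) :
    D 0 x = (1 / 2 : ℂ) • (lowering D x - raising D x) := by
  rw [lowering_apply, raising_apply]; module

variable {j : E →ₗ[ℂ] H} {D : Fin 2 → E →ₗ[ℂ] E} {ν : ℝ}

lemma inner_raising (hD : CovariantPair j D ν) (x y : E) :
    inner ℂ (j (raising D x)) (j y) = inner ℂ (j x) (j (lowering D y)) := by
  rw [raising_apply, lowering_apply]
  simp only [map_neg, map_sub, map_smul, map_add, inner_neg_left, inner_sub_left, inner_smul_left,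
    inner_add_right, inner_smul_right, hD.skew, Complex.conj_I]
  ring

/-- The squares cancel in the commutator, leaving -2i[D₁, D₀] (indices 0 and 1), which is 2ν by
`comm`. -/
lemma lowering_raising (hD : CovariantPair j D ν) (x : E) :
    lowering D (raising D x) = raising D (lowering D x) + (2 * ν : ℂ) • x := by
  simp only [raising_apply, lowering_apply, map_neg, map_sub, map_smul, map_add, hD.comm]
  match_scalars <;> ring_nf; simp
  ring

/-- Expanding the product gives -(D₀² + D₁²) plus -i times the commutator of D₀ and D₁. This
constant is the zero-point energy ν. -/
lemma negLaplacian_eq (hD : CovariantPair j D ν) (x : E) :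
    negLaplacian D x = raising D (lowering D x) + (ν : ℂ) • x := by
  simp only [raising_apply, lowering_apply, negLaplacian_apply, map_smul, map_add, hD.comm]
  match_scalars <;> ring_nf <;> simp

/-- Each exchange of `lowering` with a factor `raising` contributes 2ν, and the last term kills the
vacuum vector. -/
lemma lowering_raising_pow (hD : CovariantPair j D ν) {v : E} (hv : lowering D v = 0) (k : ℕ) :
    lowering D ((raising D ^ (k + 1)) v) = (2 * ν * (k + 1) : ℂ) • (raising D ^ k) v := by
  induction k with
  | zero => simp [lowering_raising hD, hv]
  | succ k ih =>
    rw [pow_succ', Module.End.mul_apply, lowering_raising hD, ih, map_smul,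
      ← Module.End.mul_apply, ← pow_succ', ← add_smul]
    push_cast
    ring_nf

lemma negLaplacian_raising_pow (hD : CovariantPair j D ν) {v : E} (hv : lowering D v = 0) (k : ℕ) :
    negLaplacian D ((raising D ^ k) v) = ((2 * k + 1) * ν : ℂ) • (raising D ^ k) v := by
  rw [negLaplacian_eq hD]
  cases k with
  | zero => simp [hv]
  | succ k =>
    rw [lowering_raising_pow hD hv, map_smul, ← Module.End.mul_apply, ← pow_succ', ← add_smul]
    push_cast
    ring_nf

/-- Moving one `raising` across as `lowering` reduces both levels by one. Unequal levels end with
`lowering` on a vacuum vector, while equal levels collect the factors 2ν·k. -/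
lemma inner_raising_pow (hD : CovariantPair j D ν) {v w : E} (hv : lowering D v = 0) (hw : lowering D w = 0) (k l : ℕ) :
    inner ℂ (j ((raising D ^ k) v)) (j ((raising D ^ l) w)) =
      if k = l then ((2 * ν) ^ k * k.factorial : ℂ) * inner ℂ (j v) (j w) else 0 := by
  induction k generalizing l with
  | zero =>
    cases l with
    | zero => simp
    | succ l =>
      rw [pow_succ' _ l, Module.End.mul_apply, ← inner_conj_symm, inner_raising hD]
      simp [hv]
  | succ k ih =>
    rw [pow_succ' _ k, Module.End.mul_apply, inner_raising hD]
    cases l with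
    | zero => simp [hw]
    | succ l =>
      rw [lowering_raising_pow hD hw, map_smul, inner_smul_right, ih]
      by_cases h : k = l
      · subst h
        simp [Nat.factorial_succ]
        ring
      · simp [h]

lemma inner_negLaplacian_self (hD : CovariantPair j D ν) (x : E) : inner ℂ (j x) (j (negLaplacian D x)) =
    ((‖j (D 0 x)‖ ^ 2 + ‖j (D 1 x)‖ ^ 2 : ℝ) : ℂ) := by
  rw [negLaplacian_apply, map_neg, map_add, inner_neg_right, inner_add_right, hD.skew 0 x (D 0 x),
    hD.skew 1 x (D 1 x), inner_self_eq_norm_sq_to_K, inner_self_eq_norm_sq_to_K]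
  simp
  ring

lemma norm_sq_cov_add (hD : CovariantPair j D ν) (x : E) :
    ‖j (D 0 x)‖ ^ 2 + ‖j (D 1 x)‖ ^ 2 ≤ ‖j x‖ * ‖j (negLaplacian D x)‖ := by
  have h := inner_negLaplacian_self hD x
  have h2 := norm_inner_le_norm (𝕜 := ℂ) (j x) (j (negLaplacian D x))
  rw [h, Complex.norm_real] at h2
  exact (Real.le_norm_self _).trans h2

lemma norm_cov_le (hD : CovariantPair j D ν) (k : Fin 2) (x : E) :
    ‖j (D k x)‖ ≤ ‖j x‖ + ‖j (negLaplacian D x)‖ := by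
  have h := norm_sq_cov_add hD x
  have h0 := norm_nonneg (j x)
  have h1 := norm_nonneg (j (negLaplacian D x))
  refine abs_le_of_sq_le_sq' ?_ (by positivity) |>.2
  fin_cases k
  · have := sq_nonneg ‖j (D 1 x)‖
    simp only [Fin.zero_eta]
    nlinarith
  · have := sq_nonneg ‖j (D 0 x)‖
    simp only [Fin.mk_one]
    nlinarith

/-- The a priori estimate of second order. The squared norms of all four second derivatives add up
to that of the Laplacian plus a commutator term of first order, because D commutes with the
Laplacian up to 2νi times the other D. The energy bound `norm_sq_cov_add` controls this term, and
with a, h the norms of x and its Laplacian, h² + 4νah ≤ (1 + 2ν)²(a + h)². -/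
lemma norm_cov_cov_le (hD : CovariantPair j D ν) (hν : 0 ≤ ν) (k l : Fin 2) (x : E) :
    ‖j (D k (D l x))‖ ≤ (1 + 2 * ν) * (‖j x‖ + ‖j (negLaplacian D x)‖) := by
  set h := negLaplacian D x with hh
  have h0 := norm_nonneg (j x)
  have h1 := norm_nonneg (j h)
  have key : ((‖j (D 0 (D 0 x))‖ ^ 2 + ‖j (D 1 (D 0 x))‖ ^ 2 + ‖j (D 0 (D 1 x))‖ ^ 2 +
      ‖j (D 1 (D 1 x))‖ ^ 2 : ℝ) : ℂ) = inner ℂ (j h) (j h) +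
        (2 * ν * Complex.I) * (inner ℂ (j (D 1 x)) (j (D 0 x)) -
          inner ℂ (j (D 0 x)) (j (D 1 x))) := by
    have e0 : D 0 h = negLaplacian D (D 0 x) + (2 * ν * Complex.I) • D 1 x := by
      rw [hh]
      simp only [negLaplacian_apply, map_neg, map_add, hD.comm, map_smul]
      module
    have e1 : D 1 h = negLaplacian D (D 1 x) - (2 * ν * Complex.I) • D 0 x := by
      rw [hh]
      simp only [negLaplacian_apply, map_neg, map_add, hD.comm, map_smul]
      module
    have f := inner_negLaplacian_self hD
    -- One derivative of the left factor is moved back to the right, so that the energy identity can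
    -- be applied to D₀x and D₁x.
    have g : inner ℂ (j h) (j h) =
        inner ℂ (j (D 0 x)) (j (D 0 h)) + inner ℂ (j (D 1 x)) (j (D 1 h)) := by
      have g' : j h = -(j (D 0 (D 0 x)) + j (D 1 (D 1 x))) := by
        rw [hh, negLaplacian_apply, map_neg, map_add]
      rw [hD.skew 0 (D 0 x) h, hD.skew 1 (D 1 x) h]
      nth_rw 1 [g']
      rw [inner_neg_left, inner_add_left]
      ring
    rw [g, e0, e1]
    simp only [map_add, map_sub, map_smul, inner_add_right, inner_sub_right, inner_smul_right, f]
    push_cast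
    ring
  have h2 : ‖j (D 0 x)‖ * ‖j (D 1 x)‖ ≤ ‖j x‖ * ‖j h‖ := by
    have := norm_sq_cov_add hD x
    nlinarith [sq_nonneg (‖j (D 0 x)‖ - ‖j (D 1 x)‖), sq_nonneg ‖j (D 0 x)‖,
      sq_nonneg ‖j (D 1 x)‖]
  have h3 : ‖j (D 0 (D 0 x))‖ ^ 2 + ‖j (D 1 (D 0 x))‖ ^ 2 + ‖j (D 0 (D 1 x))‖ ^ 2 +
      ‖j (D 1 (D 1 x))‖ ^ 2 ≤ ‖j h‖ ^ 2 + 2 * ν * (2 * (‖j x‖ * ‖j h‖)) := by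
    have h4 := congrArg norm key
    rw [Complex.norm_real] at h4
    refine (Real.le_norm_self _).trans (h4.le.trans ((norm_add_le _ _).trans ?_))
    rw [norm_mul]
    have n1 : ‖(2 * ν * Complex.I : ℂ)‖ = 2 * ν := by
      simp [abs_of_nonneg hν]
    rw [n1, inner_self_eq_norm_sq_to_K]
    refine add_le_add (by simp) (mul_le_mul_of_nonneg_left ?_ (by positivity))
    refine (norm_sub_le _ _).trans ?_
    have a1 := norm_inner_le_norm (𝕜 := ℂ) (j (D 1 x)) (j (D 0 x))
    have a2 := norm_inner_le_norm (𝕜 := ℂ) (j (D 0 x)) (j (D 1 x))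
    linarith
  have h5 : ‖j (D k (D l x))‖ ^ 2 ≤ ‖j (D 0 (D 0 x))‖ ^ 2 + ‖j (D 1 (D 0 x))‖ ^ 2 +
      ‖j (D 0 (D 1 x))‖ ^ 2 + ‖j (D 1 (D 1 x))‖ ^ 2 := by
    have p1 := sq_nonneg ‖j (D 0 (D 0 x))‖
    have p2 := sq_nonneg ‖j (D 1 (D 0 x))‖
    have p3 := sq_nonneg ‖j (D 0 (D 1 x))‖
    have p4 := sq_nonneg ‖j (D 1 (D 1 x))‖
    fin_cases k <;> fin_cases l <;> simp only [Fin.zero_eta, Fin.mk_one] <;> linarith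
  refine abs_le_of_sq_le_sq' (h5.trans (h3.trans ?_)) (by positivity) |>.2
  have q1 := mul_nonneg h0 h1
  have q2 := mul_nonneg hν q1
  have q3 := mul_nonneg hν (sq_nonneg (‖j x‖ + ‖j h‖))
  have q4 := sq_nonneg (ν * (‖j x‖ + ‖j h‖))
  have q5 := mul_nonneg hν (sq_nonneg ‖j x‖)
  have q6 := mul_nonneg hν (sq_nonneg ‖j h‖)
  nlinarith [sq_nonneg ‖j x‖]

lemma cauchySeq_of_norm_le {X Y : Type*} [NormedAddCommGroup X] [NormedAddCommGroup Y]
    {x y : ℕ → X} {z : ℕ → Y} {K : ℝ} (hx : CauchySeq x) (hy : CauchySeq y)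
    (h : ∀ p q, ‖z p - z q‖ ≤ K * (‖x p - x q‖ + ‖y p - y q‖)) : CauchySeq z := by
  rw [cauchySeq_iff_tendsto_dist_atTop_0] at hx hy ⊢
  refine squeeze_zero (fun _ => dist_nonneg) (fun p => ?_) (by simpa using (hx.add hy).const_mul K)
  simp only [dist_eq_norm]
  exact h _ _

/-- The operator `-(D₁² + D₂²)` controls all derivatives of order at most two. -/
lemma exists_tendsto_of_closure (hD : CovariantPair j D ν) [CompleteSpace H] (hν : 0 ≤ ν) {u f : H}
    (h : (u, f) ∈ closure (Set.range fun x => (j x, j (negLaplacian D x)))) :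
    ∃ (x : ℕ → E) (d : Fin 2 → H) (e : Fin 2 → Fin 2 → H),
      Filter.Tendsto (fun N => j (x N)) Filter.atTop (nhds u) ∧
      (∀ k, Filter.Tendsto (fun N => j (D k (x N))) Filter.atTop (nhds (d k))) ∧
      (∀ k l, Filter.Tendsto (fun N => j (D l (D k (x N)))) Filter.atTop (nhds (e k l))) ∧
      f = -∑ k, e k k := by
  obtain ⟨y, hy, hy'⟩ := mem_closure_iff_seq_limit.1 h
  choose x hx using hy
  have h1 : Filter.Tendsto (fun N => j (x N)) Filter.atTop (nhds u) := by
    refine ((continuous_fst.tendsto _).comp hy').congr fun N => ?_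
    simp [← hx]
  have h2 : Filter.Tendsto (fun N => j (negLaplacian D (x N))) Filter.atTop (nhds f) := by
    refine ((continuous_snd.tendsto _).comp hy').congr fun N => ?_
    simp [← hx]
  have c1 := h1.cauchySeq
  have c2 := h2.cauchySeq
  have c3 : ∀ k, CauchySeq fun N => j (D k (x N)) := fun k =>
    cauchySeq_of_norm_le (K := 1) c1 c2 fun p q => by
      simp only [← map_sub, one_mul]
      exact norm_cov_le hD k _
  have c4 : ∀ k l, CauchySeq fun N => j (D l (D k (x N))) := fun k l =>
    cauchySeq_of_norm_le c1 c2 fun p q => by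
      simp only [← map_sub]
      exact norm_cov_cov_le hD hν l k _
  choose d hd using fun k => cauchySeq_tendsto_of_complete (c3 k)
  choose e he using fun k l => cauchySeq_tendsto_of_complete (c4 k l)
  refine ⟨x, d, e, h1, hd, he, tendsto_nhds_unique h2 ?_⟩
  have := (tendsto_finsetSum Finset.univ fun k _ => he k k).neg
  refine this.congr fun N => ?_
  simp [negLaplacian]

/-- A complete family of ladders over a space of vacuum vectors yields a Hilbert basis of
eigenvectors. -/
lemma exists_ladder_basis (hD : CovariantPair j D ν) [CompleteSpace H] (hν : 0 < ν) {m : ℕ} {V : Submodule ℂ E}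
    (hV : ∀ v ∈ V, lowering D v = 0) (hinj : ∀ v ∈ V, j v = 0 → v = 0) [FiniteDimensional ℂ V]
    (hm : Module.finrank ℂ V = m)
    (htot : ∀ u : H, (∀ k, ∀ v ∈ V, inner ℂ (j ((raising D ^ k) v)) u = 0) → u = 0) :
    ∃ (b : HilbertBasis (ℕ × Fin m) ℂ H) (e : ℕ × Fin m → E), (∀ i, b i = j (e i)) ∧
      (∀ i, negLaplacian D (e i) = ((2 * i.1 + 1) * ν : ℂ) • e i) ∧ ∀ l, e (0, l) ∈ V := by
  classical
  have hfin : Module.finrank ℂ (V.map j) = m := by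
    rw [← hm]
    have : Function.Injective (j.domRestrict V) := by
      rw [injective_iff_map_eq_zero]
      exact fun v hv => Subtype.ext (hinj v v.2 hv)
    rw [← LinearMap.range_domRestrict]
    exact LinearMap.finrank_range_of_inj this
  -- Orthonormality makes sense only in the Hilbert space, so the basis is chosen in the image of V
  -- and lifted back to V.
  let o := (stdOrthonormalBasis ℂ (V.map j)).reindex (finCongr hfin)
  have ho : ∀ l, ∃ v ∈ V, j v = o l := fun l => (o l).2
  choose v hv hvo using ho
  have hon : ∀ l l', inner ℂ (j (v l)) (j (v l')) = if l = l' then (1 : ℂ) else 0 := by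
    intro l l'
    rw [hvo, hvo, ← Submodule.coe_inner]
    exact orthonormal_iff_ite.1 o.orthonormal l l'
  have hspan : ∀ w ∈ V, w ∈ Submodule.span ℂ (Set.range v) := by
    intro w hw
    have h1 := o.sum_repr ⟨j w, Submodule.mem_map_of_mem hw⟩
    have h2 : w = ∑ l, o.repr ⟨j w, Submodule.mem_map_of_mem hw⟩ l • v l := by
      refine sub_eq_zero.1 (hinj _ (V.sub_mem hw (V.sum_mem fun l _ => V.smul_mem _ (hv l))) ?_)
      have h3 := congrArg Subtype.val h1
      rw [map_sub, map_sum, sub_eq_zero]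
      simpa [hvo] using h3.symm
    rw [h2]
    exact Submodule.sum_mem _ fun l _ =>
      Submodule.smul_mem _ _ (Submodule.subset_span (Set.mem_range_self l))
  -- The norm of `raising ^ k` on a unit vacuum vector, from `inner_raising_pow`.
  let c : ℕ → ℝ := fun k => √((2 * ν) ^ k * k.factorial)
  have hc0 : ∀ k : ℕ, 0 < (2 * ν) ^ k * k.factorial := fun k => by
    have := k.factorial_pos
    positivity
  have hc : ∀ k, (c k : ℂ) ≠ 0 := fun k =>
    Complex.ofReal_ne_zero.2 (Real.sqrt_pos.2 (hc0 k)).ne'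
  have hcc : ∀ k : ℕ, (c k : ℂ) * c k = (2 * ν) ^ k * k.factorial := fun k => by
    rw [← Complex.ofReal_mul, Real.mul_self_sqrt (hc0 k).le]
    push_cast
    ring
  let e : ℕ × Fin m → E := fun i => (c i.1 : ℂ)⁻¹ • (raising D ^ i.1) (v i.2)
  have hlow := fun l => hV _ (hv l)
  have hbon : Orthonormal ℂ fun i => j (e i) := by
    rw [orthonormal_iff_ite]
    rintro ⟨k, l⟩ ⟨k', l'⟩
    simp only [e, map_smul, inner_smul_left, inner_smul_right,
      inner_raising_pow hD (hlow _) (hlow _), hon, Prod.mk.injEq]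
    by_cases hk : k = k'
    · subst hk
      by_cases hl : l = l'
      · subst hl
        have h1 := hc k
        simp only [and_self, if_true, map_inv₀, Complex.conj_ofReal, ← hcc]
        field_simp
      · simp [hl]
    · simp [hk]
  have hbtot : (Submodule.span ℂ (Set.range fun i => j (e i)))ᗮ = ⊥ := by
    rw [Submodule.eq_bot_iff]
    intro u hu
    refine htot u fun k w hw => ?_
    have h1 : ∀ l, inner ℂ (j ((raising D ^ k) (v l))) u = 0 := by
      intro l
      have h2 := (Submodule.mem_orthogonal _ _).1 hu _
        (Submodule.subset_span (Set.mem_range_self (k, l)))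
      simp only [e, map_smul, inner_smul_left] at h2
      exact (mul_eq_zero.1 h2).resolve_left (by simpa using hc k)
    have hw' := hspan w hw
    clear hw
    induction hw' using Submodule.span_induction with
    | mem x hx => obtain ⟨l, rfl⟩ := hx; exact h1 l
    | zero => simp
    | add x y _ _ hx hy => simp [hx, hy]
    | smul a x _ hx => simp [hx]
  refine ⟨HilbertBasis.mkOfOrthogonalEqBot hbon hbtot, e, fun i => by simp, fun i => ?_,
    fun l => V.smul_mem _ (by simpa using hv l)⟩
  simp only [e, map_smul]
  rw [negLaplacian_raising_pow hD (hlow _), smul_comm]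

end Ladder

/-! ### Calculus of weak derivatives -/

section Weak

lemma locallyIntegrable_mul {f a : ℂ → ℂ} (hf : LocallyIntegrable f) (ha : Continuous a) :
    LocallyIntegrable fun x => a x * f x := by
  rw [locallyIntegrable_iff]
  intro K hK
  exact (hf.integrableOn_isCompact hK).continuousOn_mul ha.continuousOn hK

lemma integrable_mul_of_hasCompactSupport {f φ : ℂ → ℂ} (hf : LocallyIntegrable f)
    (h1 : Continuous φ) (h2 : HasCompactSupport φ) : Integrable fun x => φ x * f x := by
  simpa only [smul_eq_mul] using hf.integrable_smul_left_of_hasCompactSupport h1 h2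

lemma continuous_fderiv_apply_const {F : Type*} [NormedAddCommGroup F] [NormedSpace ℝ F]
    {φ : ℂ → F} (h : ContDiff ℝ ∞ φ) (v : ℂ) : Continuous fun x => fderiv ℝ φ x v :=
  (h.continuous_fderiv (by simp)).clm_apply continuous_const

lemma contDiff_fderiv_apply_const {F : Type*} [NormedAddCommGroup F] [NormedSpace ℝ F]
    {φ : ℂ → F} (h : ContDiff ℝ ∞ φ) (v : ℂ) : ContDiff ℝ ∞ fun x => fderiv ℝ φ x v :=
  (h.fderiv_right (m := ∞) (by simp)).clm_apply contDiff_const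

/-- Complex-valued test functions are admissible. -/
lemma HasWeakPartial.integral_mul {j : Fin 2} {f g : ℂ → ℂ} (h : HasWeakPartial j f g)
    {φ : ℂ → ℂ} (h1 : ContDiff ℝ ∞ φ) (h2 : HasCompactSupport φ) :
    ∫ x, fderiv ℝ φ x (basisVec j) * f x = -∫ x, φ x * g x := by
  have hre : ContDiff ℝ ∞ fun x => (φ x).re := Complex.reCLM.contDiff.comp h1
  have him : ContDiff ℝ ∞ fun x => (φ x).im := Complex.imCLM.contDiff.comp h1
  have hre' : HasCompactSupport fun x => (φ x).re := h2.comp_left (g := Complex.re) rfl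
  have him' : HasCompactSupport fun x => (φ x).im := h2.comp_left (g := Complex.im) rfl
  have hd : ∀ x, DifferentiableAt ℝ φ x := fun x => (h1.differentiable (by simp)) x
  have dre : ∀ x v, fderiv ℝ (fun x => (φ x).re) x v = (fderiv ℝ φ x v).re := fun x v => by
    have : HasFDerivAt (fun x => (φ x).re) (Complex.reCLM ∘L fderiv ℝ φ x) x :=
      (Complex.reCLM.hasFDerivAt).comp x (hd x).hasFDerivAt
    rw [this.fderiv]
    rfl
  have dim : ∀ x v, fderiv ℝ (fun x => (φ x).im) x v = (fderiv ℝ φ x v).im := fun x v => by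
    have : HasFDerivAt (fun x => (φ x).im) (Complex.imCLM ∘L fderiv ℝ φ x) x :=
      (Complex.imCLM.hasFDerivAt).comp x (hd x).hasFDerivAt
    rw [this.fderiv]
    rfl
  have split : ∀ w z : ℂ, w * z = w.re • z + Complex.I * (w.im • z) := fun w z => by
    conv_lhs => rw [← Complex.re_add_im w]
    simp only [Complex.real_smul]
    ring
  have e1 : ∫ x, fderiv ℝ φ x (basisVec j) * f x =
      ∫ x, (fderiv ℝ (fun x => (φ x).re) x (basisVec j) • f x +
        Complex.I * (fderiv ℝ (fun x => (φ x).im) x (basisVec j) • f x)) :=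
    integral_congr_ae (.of_forall fun x => by simp only [dre, dim]; exact split _ _)
  have e2 : ∫ x, φ x * g x = ∫ x, ((φ x).re • g x + Complex.I * ((φ x).im • g x)) :=
    integral_congr_ae (.of_forall fun x => split _ _)
  rw [e1, e2, integral_add (integrable_test_deriv j h.1 hre hre')
    ((integrable_test_deriv j h.1 him him').const_mul _),
    integral_add (integrable_test h.2.1 hre.continuous hre')
    ((integrable_test h.2.1 him.continuous him').const_mul _), integral_const_mul,
    integral_const_mul, h.2.2 _ hre hre', h.2.2 _ him him']
  ring

lemma HasWeakPartial.of_contDiff (j : Fin 2) {f : ℂ → ℂ} (hf : ContDiff ℝ ∞ f) :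
    HasWeakPartial j f fun x => fderiv ℝ f x (basisVec j) := by
  have hc := continuous_fderiv_apply_const hf (basisVec j)
  refine ⟨hf.continuous.locallyIntegrable, hc.locallyIntegrable, fun φ h1 h2 => ?_⟩
  have h := integral_bilinear_fderiv_right_eq_neg_left_of_integrable (μ := (volume : Measure ℂ))
    (f := φ) (g := f) (v := basisVec j) (B := ContinuousLinearMap.lsmul ℝ ℝ)
    (integrable_test_deriv j hf.continuous.locallyIntegrable h1 h2)
    (integrable_test hc.locallyIntegrable h1.continuous h2)
    (integrable_test hf.continuous.locallyIntegrable h1.continuous h2)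
    (fun x _ => h1.differentiable (by simp) x) (fun x _ => hf.differentiable (by simp) x)
  simp only [ContinuousLinearMap.lsmul_apply] at h
  rw [h, neg_neg]

/-- The Leibniz rule follows by testing f with φ·a. Since a is complex-valued, this needs
`HasWeakPartial.integral_mul`. -/
lemma HasWeakPartial.mul {j : Fin 2} {f g a : ℂ → ℂ} (h : HasWeakPartial j f g)
    (ha : ContDiff ℝ ∞ a) :
    HasWeakPartial j (fun x => a x * f x)
      fun x => fderiv ℝ a x (basisVec j) * f x + a x * g x := by
  have hc := continuous_fderiv_apply_const ha (basisVec j)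
  refine ⟨locallyIntegrable_mul h.1 ha.continuous,
    (locallyIntegrable_mul h.1 hc).add (locallyIntegrable_mul h.2.1 ha.continuous),
    fun φ h1 h2 => ?_⟩
  have hφ : ContDiff ℝ ∞ fun x => φ x • a x := h1.smul ha
  have hφ' : HasCompactSupport fun x => φ x • a x := h2.smul_right
  have key := h.integral_mul hφ hφ'
  have e : ∀ x, fderiv ℝ (fun x => φ x • a x) x (basisVec j) =
      φ x • fderiv ℝ a x (basisVec j) + fderiv ℝ φ x (basisVec j) • a x := fun x => by
    rw [fderiv_fun_smul (h1.differentiable (by simp) x) (ha.differentiable (by simp) x)]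
    rfl
  have i1 : Integrable fun x => φ x • (fderiv ℝ a x (basisVec j) * f x) :=
    integrable_test (locallyIntegrable_mul h.1 hc) h1.continuous h2
  have i2 : Integrable fun x => fderiv ℝ φ x (basisVec j) • (a x * f x) :=
    integrable_test_deriv j (locallyIntegrable_mul h.1 ha.continuous) h1 h2
  have i3 : Integrable fun x => φ x • (a x * g x) :=
    integrable_test (locallyIntegrable_mul h.2.1 ha.continuous) h1.continuous h2
  have e1 : ∫ x, fderiv ℝ (fun x => φ x • a x) x (basisVec j) * f x =
      ∫ x, (φ x • (fderiv ℝ a x (basisVec j) * f x) +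
        fderiv ℝ φ x (basisVec j) • (a x * f x)) :=
    integral_congr_ae (.of_forall fun x => by
      beta_reduce; rw [e]; simp only [Complex.real_smul]; ring)
  have e2 : ∫ x, φ x • a x * g x = ∫ x, φ x • (a x * g x) :=
    integral_congr_ae (.of_forall fun x => by simp only [Complex.real_smul]; ring)
  rw [e1, e2, integral_add i1 i2] at key
  simp only [smul_add]
  rw [integral_add i1 i3]
  linear_combination key

lemma HasWeakPartial.comp_add {j : Fin 2} {f g : ℂ → ℂ} (h : HasWeakPartial j f g) (t : ℂ) :
    HasWeakPartial j (fun x => f (x + t)) fun x => g (x + t) := by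
  have hL : ∀ {u : ℂ → ℂ}, LocallyIntegrable u → LocallyIntegrable fun x => u (x + t) := by
    intro u hu
    rw [locallyIntegrable_iff] at hu ⊢
    intro K hK
    have h1 := hu _ (hK.image (continuous_add_const t))
    have h2 := (measurePreserving_add_right (volume : Measure ℂ) t).integrableOn_image
      (Homeomorph.addRight t).measurableEmbedding (f := u) (s := K)
    exact h2.1 h1
  refine ⟨hL h.1, hL h.2.1, fun φ h1 h2 => ?_⟩
  have h1' : ContDiff ℝ ∞ fun x => φ (x - t) := h1.comp (contDiff_id.sub contDiff_const)
  have h2' : HasCompactSupport fun x => φ (x - t) := by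
    simpa [sub_eq_add_neg, Function.comp_def] using
      h2.comp_homeomorph (Homeomorph.addRight (-t))
  have key := h.2.2 _ h1' h2'
  rw [← integral_add_right_eq_self _ t] at key
  rw [← integral_add_right_eq_self (fun x => φ (x - t) • g x) t] at key
  simpa [fderiv_comp_sub] using key

lemma HasWeakPartial.unique {j : Fin 2} {f g g' : ℂ → ℂ} (h : HasWeakPartial j f g)
    (h' : HasWeakPartial j f g') : g =ᵐ[volume] g' := by
  have h0 := (h.add (h'.smul (-1))).eq_zero (.of_forall fun x => by simp)
  filter_upwards [h0] with x hx
  simpa [← sub_eq_add_neg, sub_eq_zero] using hx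

lemma MemL2Loc.locallyIntegrable {f : ℂ → ℂ} (hf : MemL2Loc f) : LocallyIntegrable f := by
  rw [locallyIntegrable_iff]
  intro K hK
  have : IsFiniteMeasure ((volume : Measure ℂ).restrict K) := ⟨by simpa using hK.measure_lt_top⟩
  exact (hf K hK).integrable (by norm_num)

lemma MemL2Loc.mul {f a : ℂ → ℂ} (hf : MemL2Loc f) (ha : Continuous a) :
    MemL2Loc fun x => a x * f x := by
  intro K hK
  obtain ⟨C, hC⟩ := hK.exists_bound_of_continuousOn ha.continuousOn
  refine (hf K hK).of_le_mul (c := C) (ha.aestronglyMeasurable.mul (hf K hK).1) ?_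
  filter_upwards [ae_restrict_mem hK.measurableSet] with x hx
  rw [norm_mul]
  exact mul_le_mul_of_nonneg_right (hC x hx) (norm_nonneg _)

end Weak

/-! ### Periodicity and integration over the cell -/

section Cell

open scoped ENNReal

variable {τ : ℍ} {n : ℕ}

lemma isAddFundamentalDomain_cell (τ : ℍ) :
    IsAddFundamentalDomain (lattice τ) (cell τ) (volume : Measure ℂ) := by
  refine IsAddFundamentalDomain.mk' (measurableSet_cell τ).nullMeasurableSet fun x => ?_
  refine ⟨-latticeFloor τ x, ?_, fun t ht => ?_⟩
  · have := sub_latticeFloor_mem τ x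
    rw [sub_eq_add_neg, add_comm] at this
    exact this
  · have h1 : x + (t : ℂ) ∈ cell τ := by
      have : (t : ℂ) + x ∈ cell τ := ht
      rwa [add_comm] at this
    have h2 := latticeFloor_of_mem h1
    rw [latticeFloor_add] at h2
    exact (neg_eq_of_add_eq_zero_right h2).symm

lemma continuous_coordQ (τ : ℍ) : Continuous (coordQ τ) := by
  unfold coordQ; fun_prop

lemma continuous_coordP (τ : ℍ) : Continuous (coordP τ) := by
  have := continuous_coordQ τ
  unfold coordP; fun_prop

/-- Coordinates of a cell point lie in [0, 1), so a shift that stays within [-M, M] has indices in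
(-M - 1, M]. This explains the asymmetric interval. -/
lemma pt_mem_of_bounds {τ : ℍ} {x : ℂ} (hx : x ∈ cell τ) {p q : ℤ} {M : ℝ}
    (hP : |coordP τ (x + latticePt τ p q)| ≤ M) (hQ : |coordQ τ (x + latticePt τ p q)| ≤ M) :
    p ∈ Finset.Icc (-⌈M⌉ - 1) ⌈M⌉ ∧ q ∈ Finset.Icc (-⌈M⌉ - 1) ⌈M⌉ := by
  obtain ⟨h1, h2⟩ := coord_add_lattice τ x p q
  obtain ⟨⟨a1, a2⟩, b1, b2⟩ := (mem_cell_iff τ x).1 hx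
  rw [h1] at hP
  rw [h2] at hQ
  obtain ⟨c1, c2⟩ := abs_le.1 hP
  obtain ⟨d1, d2⟩ := abs_le.1 hQ
  have hM := Int.le_ceil M
  simp only [Finset.mem_Icc]
  refine ⟨⟨?_, ?_⟩, ?_, ?_⟩
  · have : (-⌈M⌉ - 1 : ℝ) ≤ p := by linarith
    exact_mod_cast this
  · have : (p : ℝ) ≤ ⌈M⌉ := by linarith
    exact_mod_cast this
  · have : (-⌈M⌉ - 1 : ℝ) ≤ q := by linarith
    exact_mod_cast this
  · have : (q : ℝ) ≤ ⌈M⌉ := by linarith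
    exact_mod_cast this

lemma exists_finset_cover (τ : ℍ) {K : Set ℂ} (hK : IsCompact K) :
    ∃ F : Finset (lattice τ), ∀ x ∈ cell τ, ∀ t : lattice τ, x + (t : ℂ) ∈ K → t ∈ F := by
  classical
  obtain ⟨M1, h1⟩ := hK.exists_bound_of_continuousOn (continuous_coordP τ).continuousOn
  obtain ⟨M2, h2⟩ := hK.exists_bound_of_continuousOn (continuous_coordQ τ).continuousOn
  set M := max M1 M2
  refine ⟨(Finset.Icc (-⌈M⌉ - 1) ⌈M⌉ ×ˢ Finset.Icc (-⌈M⌉ - 1) ⌈M⌉).image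
    fun pq => latticePt τ pq.1 pq.2, fun x hx t ht => ?_⟩
  obtain ⟨_, p, q, rfl⟩ := t
  obtain ⟨hp, hq⟩ := pt_mem_of_bounds hx (p := p) (q := q) (M := M)
    ((h1 _ ht).trans (le_max_left _ _)) ((h2 _ ht).trans (le_max_right _ _))
  exact Finset.mem_image.2 ⟨(p, q), Finset.mem_product.2 ⟨hp, hq⟩, rfl⟩

/-- Finitely many translates of the cell cover K, and a periodic function has the same integral over
each. This turns square integrability on the cell into membership in L²_loc, with a constant
depending only on K. -/
lemma lintegral_compact_le (τ : ℍ) {K : Set ℂ} (hK : IsCompact K) :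
    ∃ N : ℕ, ∀ w : ℂ → ℝ≥0∞, (∀ t : lattice τ, ∀ᵐ x, w (x + (t : ℂ)) = w x) →
      ∫⁻ x in K, w x ≤ N * ∫⁻ x in cell τ, w x := by
  obtain ⟨F, hF⟩ := exists_finset_cover τ hK
  refine ⟨F.card, fun w hw => ?_⟩
  rw [← lintegral_indicator hK.measurableSet,
    (isAddFundamentalDomain_cell τ).lintegral_eq_tsum'']
  have hle : ∀ t : lattice τ, ∫⁻ x in cell τ, K.indicator w (t +ᵥ x) ≤ ∫⁻ x in cell τ, w x := by
    intro t
    refine lintegral_mono_ae (ae_restrict_of_ae ?_)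
    filter_upwards [hw t] with x hx
    refine (Set.indicator_le_self _ _ _).trans ?_
    rw [← hx, add_comm]
    rfl
  rw [tsum_eq_sum (s := F)]
  · refine (Finset.sum_le_sum fun t _ => hle t).trans ?_
    simp
  · intro t ht
    refine (setLIntegral_congr_fun (measurableSet_cell τ) fun x hx => ?_).trans lintegral_zero
    refine Set.indicator_of_notMem (fun h => ht (hF x hx t ?_)) _
    rwa [add_comm]

lemma exists_compact_cell (τ : ℍ) : ∃ K : Set ℂ, IsCompact K ∧ cell τ ⊆ K := by
  refine ⟨(fun z : ℝ × ℝ => pt τ z.1 z.2) '' (Set.Icc 0 1 ×ˢ Set.Icc 0 1), ?_, ?_⟩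
  · refine (isCompact_Icc.prod isCompact_Icc).image ?_
    unfold pt
    fun_prop
  · rintro _ ⟨p, hp, q, hq, rfl⟩
    exact ⟨(p, q), ⟨Set.Ico_subset_Icc_self hp, Set.Ico_subset_Icc_self hq⟩, rfl⟩

lemma volume_cell_lt_top (τ : ℍ) : (volume : Measure ℂ) (cell τ) < ⊤ := by
  obtain ⟨K, hK, hcK⟩ := exists_compact_cell τ
  exact (measure_mono hcK).trans_lt hK.measure_lt_top

instance isFiniteMeasure_cell (τ : ℍ) : IsFiniteMeasure ((volume : Measure ℂ).restrict (cell τ)) :=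
  ⟨by simpa using volume_cell_lt_top τ⟩

lemma norm_gaugeFactor (γ : GaugePhase τ n) (t : lattice τ) (x : ℂ) : ‖gaugeFactor γ t x‖ = 1 := by
  rw [gaugeFactor, mul_comm, Complex.norm_exp_ofReal_mul_I]

lemma IsGaugePeriodic.enorm {γ : GaugePhase τ n} {f : ℂ → ℂ} (h : IsGaugePeriodic γ f)
    (t : lattice τ) : ∀ᵐ x, ‖f (x + (t : ℂ))‖ₑ = ‖f x‖ₑ := by
  filter_upwards [h t] with x hx
  rw [hx, enorm_mul]
  have : ‖gaugeFactor γ t x‖ₑ = 1 := by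
    rw [← ofReal_norm, norm_gaugeFactor, ENNReal.ofReal_one]
  rw [this, one_mul]

lemma IsGaugePeriodic.congr {γ : GaugePhase τ n} {f g : ℂ → ℂ} (h : IsGaugePeriodic γ f)
    (hfg : f =ᵐ[volume] g) : IsGaugePeriodic γ g := by
  intro t
  have h1 := (measurePreserving_add_right (volume : Measure ℂ) (t : ℂ)).quasiMeasurePreserving.ae
    hfg
  filter_upwards [h t, hfg, h1] with x hx hx1 hx2
  rw [← hx1, ← hx2, hx]

lemma memL2Loc_coe {γ : GaugePhase τ n} (u : GaugeL2 γ) : MemL2Loc u.1 := by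
  intro K hK
  refine ⟨u.1.aestronglyMeasurable.restrict, ?_⟩
  obtain ⟨N, hN⟩ := lintegral_compact_le τ hK
  have h1 := hN (fun x => ‖u.1 x‖ₑ ^ (2 : ℝ)) fun t => by
    filter_upwards [u.2.1.enorm t] with x hx
    rw [hx]
  have h2 := (eLpNorm_lt_top_iff_lintegral_rpow_enorm_lt_top (by norm_num) (by norm_num)).1 u.2.2.2
  rw [eLpNorm_lt_top_iff_lintegral_rpow_enorm_lt_top (by norm_num) (by norm_num)]
  simp only [ENNReal.toReal_ofNat] at h2 ⊢
  exact h1.trans_lt (ENNReal.mul_lt_top (by simp) h2)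

/-- A gauge-periodic function in `L²_loc` defines an element of the Hilbert space. -/
lemma exists_gaugeL2 {γ : GaugePhase τ n} {f : ℂ → ℂ} (h : IsGaugePeriodic γ f)
    (h2 : MemL2Loc f) : ∃ u : GaugeL2 γ, u.1 =ᵐ[volume] f := by
  have hm : AEStronglyMeasurable f volume := h2.locallyIntegrable.aestronglyMeasurable
  have he := AEEqFun.coeFn_mk f hm
  obtain ⟨K, hK, hcK⟩ := exists_compact_cell τ
  refine ⟨⟨AEEqFun.mk f hm, h.congr he.symm, ?_⟩, he⟩
  exact (memLp_congr_ae (ae_restrict_of_ae he)).2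
    ((h2 K hK).mono_measure (Measure.restrict_mono_set _ hcK))

lemma norm_gaugeL2 {γ : GaugePhase τ n} (u : GaugeL2 γ) :
    ‖u‖ = (eLpNorm u.1 2 (volume.restrict (cell τ))).toReal :=
  Lp.norm_toLp _ u.2.2

/-- Pairing with a test function on the whole plane is continuous in the norm of the cell. This is
what lets weak identities pass to limits in the Hilbert space. -/
lemma norm_integral_mul_le (γ : GaugePhase τ n) {φ : ℂ → ℂ} (h1 : Continuous φ)
    (h2 : HasCompactSupport φ) : ∃ C : ℝ, ∀ u : GaugeL2 γ, ‖∫ x, φ x * u.1 x‖ ≤ C * ‖u‖ := by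
  obtain ⟨N, hN⟩ := lintegral_compact_le τ h2.isCompact
  obtain ⟨B, hB⟩ := h1.bounded_above_of_compact_support h2
  have hB0 : 0 ≤ B := (norm_nonneg _).trans (hB 0)
  -- The square root of the area of the cell: the Cauchy–Schwarz constant from L² to L¹.
  set A := (volume.restrict (cell τ) Set.univ : ℝ≥0∞) ^ (1 / (1 : ℝ≥0∞).toReal - 1 / (2 : ℝ≥0∞).toReal)
    with hA
  have hAfin : A < ⊤ := by
    rw [hA]
    exact ENNReal.rpow_lt_top_of_nonneg (by norm_num) (measure_ne_top _ _)
  refine ⟨B * N * A.toReal, fun u => ?_⟩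
  have e1 : ∫⁻ x, ‖φ x * u.1 x‖ₑ ≤ ENNReal.ofReal B * (N * (eLpNorm u.1 2 (volume.restrict (cell τ)) * A)) := by
    calc ∫⁻ x, ‖φ x * u.1 x‖ₑ = ∫⁻ x in tsupport φ, ‖φ x * u.1 x‖ₑ := by
          rw [← lintegral_indicator (isClosed_tsupport φ).measurableSet]
          refine lintegral_congr fun x => ?_
          by_cases hx : x ∈ tsupport φ
          · rw [Set.indicator_of_mem hx]
          · rw [Set.indicator_of_notMem hx, image_eq_zero_of_notMem_tsupport hx]
            simp
      _ ≤ ∫⁻ x in tsupport φ, ENNReal.ofReal B * ‖u.1 x‖ₑ := by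
          refine lintegral_mono fun x => ?_
          rw [enorm_mul]
          gcongr
          rw [← ofReal_norm]
          exact ENNReal.ofReal_le_ofReal (hB x)
      _ = ENNReal.ofReal B * ∫⁻ x in tsupport φ, ‖u.1 x‖ₑ := by
          rw [lintegral_const_mul' _ _ ENNReal.ofReal_ne_top]
      _ ≤ _ := by
          gcongr
          refine (hN _ fun t => u.2.1.enorm t).trans ?_
          gcongr
          rw [← eLpNorm_one_eq_lintegral_enorm]
          exact eLpNorm_le_eLpNorm_mul_rpow_measure_univ (by norm_num) u.2.2.1
  refine (norm_integral_le_lintegral_norm _).trans ?_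
  have hfin : eLpNorm u.1 2 (volume.restrict (cell τ)) ≠ ⊤ := u.2.2.2.ne
  have e2 := ENNReal.toReal_mono (by
    exact ENNReal.mul_ne_top ENNReal.ofReal_ne_top (ENNReal.mul_ne_top (by simp)
      (ENNReal.mul_ne_top hfin hAfin.ne))) e1
  simp only [ofReal_norm]
  refine e2.trans (le_of_eq ?_)
  rw [norm_gaugeL2]
  simp only [ENNReal.toReal_mul, ENNReal.toReal_ofReal hB0, ENNReal.toReal_natCast]
  ring

lemma tendsto_integral_mul {γ : GaugePhase τ n} {φ : ℂ → ℂ} (h1 : Continuous φ)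
    (h2 : HasCompactSupport φ) {u : ℕ → GaugeL2 γ} {v : GaugeL2 γ}
    (h : Filter.Tendsto u Filter.atTop (nhds v)) :
    Filter.Tendsto (fun N => ∫ x, φ x * (u N).1 x) Filter.atTop (nhds (∫ x, φ x * v.1 x)) := by
  obtain ⟨C, hC⟩ := norm_integral_mul_le γ h1 h2
  rw [tendsto_iff_norm_sub_tendsto_zero] at h ⊢
  refine squeeze_zero (fun _ => norm_nonneg _) (fun N => ?_) (by simpa using h.const_mul C)
  refine le_trans (le_of_eq ?_) (hC (u N - v))
  congr 1
  rw [← integral_sub (integrable_mul_of_hasCompactSupport (memL2Loc_coe _).locallyIntegrable h1 h2)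
    (integrable_mul_of_hasCompactSupport (memL2Loc_coe _).locallyIntegrable h1 h2)]
  refine integral_congr_ae ?_
  filter_upwards [AEEqFun.coeFn_sub (u N).1 v.1] with x hx
  have : (u N - v).1 x = (u N).1 x - v.1 x := hx
  rw [this]
  ring

lemma contDiff_potential (n : ℕ) (j : Fin 2) : ContDiff ℝ ∞ (potential n j) := by
  have h1 : ContDiff ℝ ∞ Complex.re := Complex.reCLM.contDiff
  have h2 : ContDiff ℝ ∞ Complex.im := Complex.imCLM.contDiff
  unfold potential dot perp
  fun_prop

lemma contDiff_potential_mul_I (n : ℕ) (j : Fin 2) :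
    ContDiff ℝ ∞ fun x => Complex.I * (potential n j x : ℂ) :=
  contDiff_const.mul (Complex.ofRealCLM.contDiff.comp (contDiff_potential n j))

/-- Weak covariant derivatives are closed under limits in the Hilbert space. -/
lemma hasWeakCovDeriv_of_tendsto {γ : GaugePhase τ n} {j : Fin 2} {u d : ℕ → GaugeL2 γ}
    {v e : GaugeL2 γ} (hu : Filter.Tendsto u Filter.atTop (nhds v))
    (hd : Filter.Tendsto d Filter.atTop (nhds e))
    (h : ∀ N, HasWeakCovDeriv n j (u N).1 (d N).1) : HasWeakCovDeriv n j v.1 e.1 := by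
  have hL : ∀ w : GaugeL2 γ, LocallyIntegrable w.1 := fun w => (memL2Loc_coe w).locallyIntegrable
  have ha := (contDiff_potential_mul_I n j).continuous
  refine ⟨hL v, (hL e).add (locallyIntegrable_mul (hL v) ha), fun φ h1 h2 => ?_⟩
  have k1 : Continuous fun x => ((fderiv ℝ φ x (basisVec j) : ℝ) : ℂ) :=
    Complex.continuous_ofReal.comp (continuous_fderiv_apply_const h1 _)
  have k2 : HasCompactSupport fun x => ((fderiv ℝ φ x (basisVec j) : ℝ) : ℂ) :=
    (h2.fderiv_apply ℝ _).comp_left (g := ((↑) : ℝ → ℂ)) rfl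
  have k3 : Continuous fun x => ((φ x : ℝ) : ℂ) := Complex.continuous_ofReal.comp h1.continuous
  have k4 : HasCompactSupport fun x => ((φ x : ℝ) : ℂ) :=
    h2.comp_left (g := ((↑) : ℝ → ℂ)) rfl
  have k5 : Continuous fun x => ((φ x : ℝ) : ℂ) * (Complex.I * (potential n j x : ℂ)) := k3.mul ha
  have k6 : HasCompactSupport fun x => ((φ x : ℝ) : ℂ) * (Complex.I * (potential n j x : ℂ)) :=
    k4.mul_right
  have split : ∀ w y : GaugeL2 γ, ∫ x, φ x • (w.1 x + Complex.I * (potential n j x : ℂ) * y.1 x) =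
      (∫ x, ((φ x : ℝ) : ℂ) * w.1 x) + ∫ x, (((φ x : ℝ) : ℂ) *
        (Complex.I * (potential n j x : ℂ))) * y.1 x := fun w y => by
    rw [← integral_add (integrable_mul_of_hasCompactSupport (hL w) k3 k4)
      (integrable_mul_of_hasCompactSupport (hL y) k5 k6)]
    refine integral_congr_ae (.of_forall fun x => ?_)
    simp only [Complex.real_smul]
    ring
  have t1 := tendsto_integral_mul k1 k2 hu
  have t2 := ((tendsto_integral_mul k3 k4 hd).add (tendsto_integral_mul k5 k6 hu)).neg
  have := tendsto_nhds_unique t1 (t2.congr fun N => ?_)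
  · rw [split]
    simpa only [Complex.real_smul] using this
  · rw [← split, ← (h N).2.2 φ h1 h2]
    simp only [Complex.real_smul]

end Cell

section PartitionOfUnity

variable {τ : ℍ} {n : ℕ}

/-! ### A partition of unity by lattice translates -/

/-- A smooth bump on the line whose integer translates sum up to one. -/
def lineBump (s : ℝ) : ℝ := Real.smoothTransition (s + 1) - Real.smoothTransition s

/-- A smooth bump on the plane whose lattice translates sum up to one. -/
def latticeBump (τ : ℍ) (x : ℂ) : ℝ := lineBump (coordP τ x) * lineBump (coordQ τ x)

lemma lineBump_eq_zero {s : ℝ} (hs : 1 < |s|) : lineBump s = 0 := by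
  rcases lt_abs.1 hs with h | h
  · rw [lineBump, Real.smoothTransition.one_of_one_le (by linarith),
      Real.smoothTransition.one_of_one_le h.le, sub_self]
  · rw [lineBump, Real.smoothTransition.zero_of_nonpos (by linarith),
      Real.smoothTransition.zero_of_nonpos (by linarith), sub_self]

/-- The sum telescopes to the transition at s + 2 minus that at s - 2, that is 1 - 0. The window
[-1, 2] is larger than [0, 1], so the identity holds near every point of the cell and can be
differentiated there. -/
lemma sum_lineBump {s : ℝ} (h1 : -1 ≤ s) (h2 : s ≤ 2) :
    ∑ p ∈ Finset.Icc (-2 : ℤ) 1, lineBump (s + p) = 1 := by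
  have : Finset.Icc (-2 : ℤ) 1 = {-2, -1, 0, 1} := by decide
  rw [this]
  simp only [lineBump, Finset.mem_insert, Finset.mem_singleton, reduceCtorEq, Int.reduceNeg,
    Int.reduceEq, or_self, not_false_eq_true, Finset.sum_insert, Finset.sum_singleton]
  push_cast
  have e1 : Real.smoothTransition (s + 1 + 1) = 1 :=
    Real.smoothTransition.one_of_one_le (by linarith)
  have e2 : Real.smoothTransition (s + -2) = 0 :=
    Real.smoothTransition.zero_of_nonpos (by linarith)
  have e3 : s + -2 + 1 = s + -1 := by ring
  have e4 : s + -1 + 1 = s + 0 := by ring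
  have e5 : s + 0 + 1 = s + 1 := by ring
  rw [e3, e4, e5, e1, e2]
  ring

lemma contDiff_lineBump : ContDiff ℝ ∞ lineBump := by
  have := Real.smoothTransition.contDiff (n := ⊤)
  exact (this.comp (contDiff_id.add contDiff_const)).sub this

lemma contDiff_coordQ (τ : ℍ) : ContDiff ℝ ∞ (coordQ τ) := by
  have h2 : ContDiff ℝ ∞ Complex.im := Complex.imCLM.contDiff
  unfold coordQ; fun_prop

lemma contDiff_coordP (τ : ℍ) : ContDiff ℝ ∞ (coordP τ) := by
  have h1 : ContDiff ℝ ∞ Complex.re := Complex.reCLM.contDiff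
  have := contDiff_coordQ τ
  unfold coordP; fun_prop

lemma contDiff_latticeBump (τ : ℍ) : ContDiff ℝ ∞ (latticeBump τ) :=
  (contDiff_lineBump.comp (contDiff_coordP τ)).mul (contDiff_lineBump.comp (contDiff_coordQ τ))

lemma tsupport_latticeBump (τ : ℍ) :
    tsupport (latticeBump τ) ⊆ {x | |coordP τ x| ≤ 1 ∧ |coordQ τ x| ≤ 1} := by
  refine closure_minimal (fun x hx => ?_) ?_
  · constructor
    · by_contra h
      exact hx (by rw [latticeBump, lineBump_eq_zero (not_le.1 h), zero_mul])
    · by_contra h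
      exact hx (by rw [latticeBump, lineBump_eq_zero (s := coordQ τ x) (not_le.1 h), mul_zero])
  · exact (isClosed_le (continuous_coordP τ).abs continuous_const).inter
      (isClosed_le (continuous_coordQ τ).abs continuous_const)

lemma hasCompactSupport_latticeBump (τ : ℍ) : HasCompactSupport (latticeBump τ) := by
  have h : IsCompact ((fun z : ℝ × ℝ => pt τ z.1 z.2) '' (Set.Icc (-1) 1 ×ˢ Set.Icc (-1) 1)) := by
    refine (isCompact_Icc.prod isCompact_Icc).image ?_
    unfold pt
    fun_prop
  refine h.of_isClosed_subset (isClosed_tsupport _) fun x hx => ?_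
  obtain ⟨h1, h2⟩ := tsupport_latticeBump τ hx
  exact ⟨(coordP τ x, coordQ τ x), ⟨abs_le.1 h1, abs_le.1 h2⟩, pt_coord τ x⟩

lemma latticePt_injective (τ : ℍ) : Function.Injective fun pq : ℤ × ℤ => latticePt τ pq.1 pq.2 := by
  rintro ⟨p, q⟩ ⟨p', q'⟩ h
  have h1 : pt τ p q = pt τ p' q' := congrArg Subtype.val h
  have h2 := congrArg (coordP τ) h1
  have h3 := congrArg (coordQ τ) h1
  rw [coordP_pt, coordP_pt] at h2
  rw [coordQ_pt, coordQ_pt] at h3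
  exact Prod.ext (by exact_mod_cast h2) (by exact_mod_cast h3)

open Classical in
/-- The lattice translations that are relevant near the cell. -/
def nearLattice (τ : ℍ) : Finset (lattice τ) :=
  (Finset.Icc (-2) 1 ×ˢ Finset.Icc (-2) 1).image fun pq => latticePt τ pq.1 pq.2

/-- The bound `pt_mem_of_bounds` with M = 1 gives the indices -2, …, 1, the range over which
`sum_lineBump` telescopes. -/
lemma mem_nearLattice {x : ℂ} (hx : x ∈ cell τ) {t : lattice τ}
    (h : x + (t : ℂ) ∈ tsupport (latticeBump τ)) : t ∈ nearLattice τ := by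
  obtain ⟨_, p, q, rfl⟩ := t
  obtain ⟨h1, h2⟩ := tsupport_latticeBump τ h
  obtain ⟨hp, hq⟩ := pt_mem_of_bounds hx (p := p) (q := q) (M := 1) h1 h2
  simp only [Int.ceil_one, Int.reduceNeg, Int.reduceSub] at hp hq
  exact Finset.mem_image.2 ⟨(p, q), Finset.mem_product.2 ⟨hp, hq⟩, rfl⟩

lemma sum_latticeBump {x : ℂ} (h1 : coordP τ x ∈ Set.Icc (-1 : ℝ) 2)
    (h2 : coordQ τ x ∈ Set.Icc (-1 : ℝ) 2) :
    ∑ t ∈ nearLattice τ, latticeBump τ (x + (t : ℂ)) = 1 := by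
  rw [nearLattice, Finset.sum_image (latticePt_injective τ).injOn, Finset.sum_product]
  have : ∀ p q : ℤ, latticeBump τ (x + (latticePt τ p q : ℂ)) =
      lineBump (coordP τ x + p) * lineBump (coordQ τ x + q) := fun p q => by
    rw [latticeBump, (coord_add_lattice τ x p q).1, (coord_add_lattice τ x p q).2]
  simp only [this, ← Finset.mul_sum, sum_lineBump h2.1 h2.2, mul_one]
  exact sum_lineBump h1.1 h1.2

lemma sum_fderiv_latticeBump {x : ℂ} (hx : x ∈ cell τ) (v : ℂ) :
    ∑ t ∈ nearLattice τ, fderiv ℝ (latticeBump τ) (x + (t : ℂ)) v = 0 := by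
  have hd := (contDiff_latticeBump τ).differentiable (by simp)
  have h1 : HasFDerivAt (fun y => ∑ t ∈ nearLattice τ, latticeBump τ (y + (t : ℂ)))
      (∑ t ∈ nearLattice τ, fderiv ℝ (latticeBump τ) (x + (t : ℂ))) x := by
    refine HasFDerivAt.fun_sum fun t _ => ?_
    exact (hasFDerivAt_comp_add_right (t : ℂ)).2 (hd (x + t)).hasFDerivAt
  have h2 : (fun y => ∑ t ∈ nearLattice τ, latticeBump τ (y + (t : ℂ))) =ᶠ[nhds x]
      fun _ => (1 : ℝ) := by
    obtain ⟨hP, hQ⟩ := (mem_cell_iff τ x).1 hx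
    have o1 : coordP τ ⁻¹' Set.Ioo (-1) 2 ∈ nhds x :=
      (continuous_coordP τ).continuousAt.preimage_mem_nhds
        (Ioo_mem_nhds (by linarith [hP.1]) (by linarith [hP.2]))
    have o2 : coordQ τ ⁻¹' Set.Ioo (-1) 2 ∈ nhds x :=
      (continuous_coordQ τ).continuousAt.preimage_mem_nhds
        (Ioo_mem_nhds (by linarith [hQ.1]) (by linarith [hQ.2]))
    filter_upwards [o1, o2] with y hy1 hy2
    exact sum_latticeBump ⟨hy1.1.le, hy1.2.le⟩ ⟨hy2.1.le, hy2.2.le⟩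
  have h3 := h1.unique ((hasFDerivAt_const (1 : ℝ) x).congr_of_eventuallyEq h2)
  have h4 := congrArg (fun L : ℂ →L[ℝ] ℝ => L v) h3
  simpa using h4

/-- Unfolding: the plane is tiled by translates of the cell, w is the same on each, and only the
translates in `nearLattice` meet the support of η. -/
lemma integral_mul_periodic {η : ℂ → ℝ} (hη : Continuous η)
    (hs : tsupport η ⊆ tsupport (latticeBump τ)) {w : ℂ → ℂ} (hw : LocallyIntegrable w)
    (hper : ∀ t : lattice τ, ∀ᵐ x, w (x + (t : ℂ)) = w x) :
    ∫ x, (η x : ℂ) * w x = ∫ x in cell τ, ((∑ t ∈ nearLattice τ, η (x + (t : ℂ)) : ℝ) : ℂ) * w x := by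
  have hc : HasCompactSupport η := (hasCompactSupport_latticeBump τ).of_isClosed_subset
    (isClosed_tsupport _) hs
  have k1 : Continuous fun x => (η x : ℂ) := Complex.continuous_ofReal.comp hη
  have k2 : HasCompactSupport fun x => (η x : ℂ) := hc.comp_left (g := ((↑) : ℝ → ℂ)) rfl
  have hi := integrable_mul_of_hasCompactSupport hw k1 k2
  have e : ∀ t : lattice τ, ∀ᵐ x, ((η ((t +ᵥ x : ℂ)) : ℝ) : ℂ) * w (t +ᵥ x) =
      (η (x + (t : ℂ)) : ℂ) * w x := fun t => by
    filter_upwards [hper t] with x hx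
    rw [← hx, add_comm x]
    rfl
  rw [(isAddFundamentalDomain_cell τ).integral_eq_tsum'' _ hi, tsum_eq_sum (s := nearLattice τ)]
  · rw [← integral_finsetSum]
    · refine integral_congr_ae (ae_restrict_of_ae ?_)
      filter_upwards [ae_all_iff.2 e] with x hx
      simp only [hx]
      push_cast
      rw [Finset.sum_mul]
    · intro t _
      have := (measurePreserving_add_left (volume : Measure ℂ) (t : ℂ)).integrable_comp_of_integrable hi
      exact this.integrableOn
  · intro t ht
    refine (setIntegral_congr_fun (measurableSet_cell τ) fun x hx => ?_).trans (integral_zero _ _)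
    have h0 : η (t +ᵥ x) = 0 := by
      apply image_eq_zero_of_notMem_tsupport
      intro h
      refine ht (mem_nearLattice hx (hs ?_))
      rwa [add_comm]
    simp [h0]

/-- This writes an integral over the cell as an integral over the plane against a compactly
supported function, the form in which weak derivatives can be tested. -/
lemma integral_latticeBump_mul {w : ℂ → ℂ} (hw : LocallyIntegrable w)
    (hper : ∀ t : lattice τ, ∀ᵐ x, w (x + (t : ℂ)) = w x) :
    ∫ x, (latticeBump τ x : ℂ) * w x = ∫ x in cell τ, w x := by
  rw [integral_mul_periodic (contDiff_latticeBump τ).continuous le_rfl hw hper]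
  refine setIntegral_congr_fun (measurableSet_cell τ) fun x hx => ?_
  obtain ⟨hP, hQ⟩ := (mem_cell_iff τ x).1 hx
  rw [sum_latticeBump ⟨by linarith [hP.1], by linarith [hP.2]⟩
    ⟨by linarith [hQ.1], by linarith [hQ.2]⟩]
  simp

/-- The translates of the bump sum to a constant, so those of its derivative sum to zero. This
replaces the cancellation of boundary terms on opposite sides of the cell. -/
lemma integral_fderiv_latticeBump_mul {w : ℂ → ℂ} (hw : LocallyIntegrable w)
    (hper : ∀ t : lattice τ, ∀ᵐ x, w (x + (t : ℂ)) = w x) (v : ℂ) :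
    ∫ x, (fderiv ℝ (latticeBump τ) x v : ℂ) * w x = 0 := by
  rw [integral_mul_periodic (continuous_fderiv_apply_const (contDiff_latticeBump τ) v)
    (tsupport_fderiv_apply_subset ℝ v) hw hper]
  refine (setIntegral_congr_fun (measurableSet_cell τ) fun x hx => ?_).trans (integral_zero _ _)
  rw [sum_fderiv_latticeBump hx]
  simp

end PartitionOfUnity

section Smooth

variable {τ : ℍ} {n : ℕ}

/-! ### Covariant derivatives of gauge-periodic functions -/

lemma contDiff_gaugeFactor (γ : GaugePhase τ n) (t : lattice τ) :
    ContDiff ℝ ∞ (gaugeFactor γ t) := by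
  have h1 : ContDiff ℝ ∞ Complex.re := Complex.reCLM.contDiff
  have h2 : ContDiff ℝ ∞ Complex.im := Complex.imCLM.contDiff
  have h3 : ContDiff ℝ ∞ ((↑) : ℝ → ℂ) := Complex.ofRealCLM.contDiff
  refine Complex.contDiff_exp.comp (contDiff_const.mul (h3.comp ?_))
  unfold dot
  fun_prop

/-- The dot product with a fixed vector, as a linear form. -/
def dotCLM (v : ℂ) : ℂ →L[ℝ] ℝ := v.re • Complex.reCLM + v.im • Complex.imCLM

lemma dotCLM_apply (v x : ℂ) : dotCLM v x = dot x v := by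
  simp [dotCLM, dot, mul_comm]

lemma fderiv_gaugeFactor (γ : GaugePhase τ n) (t : lattice τ) (x v : ℂ) :
    fderiv ℝ (gaugeFactor γ t) x v =
      Complex.I * ((n : ℝ) / 2 * dot v (perp t) : ℝ) * gaugeFactor γ t x := by
  have h1 : HasFDerivAt (fun x => (n : ℝ) / 2 * dot x (perp t) + γ.c t)
      (((n : ℝ) / 2) • dotCLM (perp t)) x := by
    have := (((dotCLM (perp t)).hasFDerivAt (x := x)).const_mul ((n : ℝ) / 2)).add_const (γ.c t)
    refine this.congr_of_eventuallyEq (.of_forall fun y => ?_)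
    simp only [dotCLM_apply]
  have h2 := ((Complex.ofRealCLM.hasFDerivAt).comp x h1).const_mul Complex.I
  have h3 : HasFDerivAt (gaugeFactor γ t) _ x := h2.cexp
  rw [h3.fderiv]
  simp only [_root_.smul_apply, ContinuousLinearMap.comp_apply, dotCLM_apply,
    smul_eq_mul, Complex.ofRealCLM_apply, Function.comp_apply]
  rw [gaugeFactor]
  ring

/-- The increment of the potential under a translation is the logarithmic derivative of the gauge
factor divided by i (`fderiv_gaugeFactor`). This match is why covariant derivatives preserve
gauge-periodicity. -/
lemma potential_add (n : ℕ) (j : Fin 2) (x t : ℂ) :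
    potential n j (x + t) = potential n j x + (n : ℝ) / 2 * dot (basisVec j) (perp t) := by
  simp [potential, dot, perp]; ring

/-- The weak derivative of f(x + t) is computed by translation and, after inserting the gauge
condition, by the Leibniz rule; uniqueness of weak derivatives equates the two. -/
lemma IsGaugePeriodic.hasWeakCovDeriv {γ : GaugePhase τ n} {j : Fin 2} {f d : ℂ → ℂ}
    (hf : IsGaugePeriodic γ f) (h : HasWeakCovDeriv n j f d) : IsGaugePeriodic γ d := by
  intro t
  have h1 := HasWeakPartial.comp_add h (t : ℂ)
  have h2 := HasWeakPartial.mul h (contDiff_gaugeFactor γ t)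
  have h3 := (h1.congr (hf t) .rfl).unique h2
  filter_upwards [h3, hf t] with x hx hx'
  rw [hx', fderiv_gaugeFactor, potential_add] at hx
  push_cast at hx
  linear_combination hx

/-- Smooth gauge-periodic functions. -/
def smoothGauge (γ : GaugePhase τ n) : Submodule ℂ (ℂ → ℂ) where
  carrier := {f | ContDiff ℝ ∞ f ∧ ∀ (t : lattice τ) x, f (x + (t : ℂ)) = gaugeFactor γ t x * f x}
  zero_mem' := ⟨contDiff_const, fun t x => by simp⟩
  add_mem' := fun {f g} hf hg => ⟨hf.1.add hg.1, fun t x => by simp [hf.2, hg.2, mul_add]⟩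
  smul_mem' := fun c f hf => ⟨contDiff_const.smul hf.1, fun t x => by simp [hf.2]; ring⟩

lemma continuous_memL2Loc {f : ℂ → ℂ} (hf : Continuous f) : MemL2Loc f := by
  intro K hK
  have : IsFiniteMeasure ((volume : Measure ℂ).restrict K) := ⟨by simpa using hK.measure_lt_top⟩
  obtain ⟨C, hC⟩ := hK.exists_bound_of_continuousOn hf.continuousOn
  refine MemLp.of_bound hf.aestronglyMeasurable C ?_
  filter_upwards [ae_restrict_mem hK.measurableSet] with x hx using hC x hx

lemma smoothGauge_memLp {γ : GaugePhase τ n} (f : smoothGauge γ) :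
    MemLp (AEEqFun.mk f.1 f.2.1.continuous.aestronglyMeasurable : ℂ →ₘ[(volume : Measure ℂ)] ℂ) 2
      (volume.restrict (cell τ)) := by
  obtain ⟨K, hK, hcK⟩ := exists_compact_cell τ
  exact (memLp_congr_ae (ae_restrict_of_ae (AEEqFun.coeFn_mk _ _))).2
    ((continuous_memL2Loc f.2.1.continuous K hK).mono_measure (Measure.restrict_mono_set _ hcK))

/-- The inclusion of the smooth gauge-periodic functions into the Hilbert space. -/
def smoothToL2 (γ : GaugePhase τ n) : smoothGauge γ →ₗ[ℂ] GaugeL2 γ where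
  toFun f := ⟨AEEqFun.mk f.1 f.2.1.continuous.aestronglyMeasurable,
    IsGaugePeriodic.congr (fun t => .of_forall fun x => f.2.2 t x) (AEEqFun.coeFn_mk _ _).symm,
    smoothGauge_memLp f⟩
  map_add' _ _ := rfl
  map_smul' _ _ := rfl

lemma coeFn_smoothToL2 {γ : GaugePhase τ n} (f : smoothGauge γ) :
    (smoothToL2 γ f).1 =ᵐ[volume] f.1 := AEEqFun.coeFn_mk _ _

/-- The covariant derivative of a smooth function. -/
def covDeriv (n : ℕ) (j : Fin 2) (f : ℂ → ℂ) (x : ℂ) : ℂ :=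
  fderiv ℝ f x (basisVec j) - Complex.I * (potential n j x : ℂ) * f x

lemma contDiff_covDeriv (n : ℕ) (j : Fin 2) {f : ℂ → ℂ} (hf : ContDiff ℝ ∞ f) :
    ContDiff ℝ ∞ (covDeriv n j f) :=
  (contDiff_fderiv_apply_const hf _).sub ((contDiff_potential_mul_I n j).mul hf)

lemma hasWeakCovDeriv_covDeriv (n : ℕ) (j : Fin 2) {f : ℂ → ℂ} (hf : ContDiff ℝ ∞ f) :
    HasWeakCovDeriv n j f (covDeriv n j f) :=
  (HasWeakPartial.of_contDiff j hf).congr .rfl (.of_forall fun x => by simp [covDeriv])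

lemma covDeriv_add_lattice {γ : GaugePhase τ n} (j : Fin 2) {f : ℂ → ℂ} (hf : ContDiff ℝ ∞ f)
    (hp : ∀ (t : lattice τ) x, f (x + (t : ℂ)) = gaugeFactor γ t x * f x) (t : lattice τ) (x : ℂ) :
    covDeriv n j f (x + (t : ℂ)) = gaugeFactor γ t x * covDeriv n j f x := by
  have h1 : fderiv ℝ f (x + (t : ℂ)) = fderiv ℝ (fun x => gaugeFactor γ t x * f x) x := by
    rw [← fderiv_comp_add_right]
    congr 1
    funext y
    exact hp t y
  rw [covDeriv, h1, fderiv_fun_mul ((contDiff_gaugeFactor γ t).differentiable (by simp) x)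
    (hf.differentiable (by simp) x), hp, potential_add, covDeriv]
  simp only [_root_.add_apply, _root_.smul_apply, smul_eq_mul,
    fderiv_gaugeFactor]
  push_cast
  ring

/-- The covariant derivatives on smooth gauge-periodic functions. -/
def smoothCov (γ : GaugePhase τ n) (j : Fin 2) : smoothGauge γ →ₗ[ℂ] smoothGauge γ where
  toFun f := ⟨covDeriv n j f.1, contDiff_covDeriv n j f.2.1, covDeriv_add_lattice j f.2.1 f.2.2⟩
  map_add' f g := by
    refine Subtype.ext (funext fun x => ?_)
    change covDeriv n j (f.1 + g.1) x = covDeriv n j f.1 x + covDeriv n j g.1 x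
    rw [covDeriv, fderiv_add (f.2.1.differentiable (by simp) x) (g.2.1.differentiable (by simp) x)]
    simp [covDeriv]
    ring
  map_smul' c f := by
    refine Subtype.ext (funext fun x => ?_)
    change covDeriv n j (c • f.1) x = c * covDeriv n j f.1 x
    rw [covDeriv, fderiv_const_smul (f.2.1.differentiable (by simp) x)]
    simp [covDeriv]
    ring

lemma smoothCov_coe {γ : GaugePhase τ n} (j : Fin 2) (f : smoothGauge γ) :
    (smoothCov γ j f).1 = covDeriv n j f.1 := rfl

/-- Integration by parts over the cell. -/
lemma inner_smooth_of_hasWeakCovDeriv {γ : GaugePhase τ n} {j : Fin 2} (Φ : smoothGauge γ)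
    {u g : GaugeL2 γ} (h : HasWeakCovDeriv n j u.1 g.1) :
    inner ℂ (smoothToL2 γ Φ) g = -inner ℂ (smoothToL2 γ (smoothCov γ j Φ)) u := by
  have hcont : ∀ Ψ : smoothGauge γ, Continuous fun x => conj (Ψ.1 x) := fun Ψ =>
    Complex.continuous_conj.comp Ψ.2.1.continuous
  have hL : ∀ (Ψ : smoothGauge γ) (w : GaugeL2 γ),
      LocallyIntegrable fun x => conj (Ψ.1 x) * w.1 x := fun Ψ w =>
    locallyIntegrable_mul (memL2Loc_coe w).locallyIntegrable (hcont Ψ)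
  have hper : ∀ (Ψ : smoothGauge γ) (w : GaugeL2 γ) (t : lattice τ),
      ∀ᵐ x, conj (Ψ.1 (x + (t : ℂ))) * w.1 (x + (t : ℂ)) = conj (Ψ.1 x) * w.1 x := by
    intro Ψ w t
    filter_upwards [w.2.1 t] with x hx
    rw [hx, Ψ.2.2]
    have h1 : conj (gaugeFactor γ t x) * gaugeFactor γ t x = 1 := by
      rw [mul_comm, Complex.mul_conj, Complex.normSq_eq_norm_sq, norm_gaugeFactor]
      simp
    rw [map_mul]
    linear_combination (conj (Ψ.1 x) * w.1 x) * h1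
  have hin : ∀ (Ψ : smoothGauge γ) (w : GaugeL2 γ), inner ℂ (smoothToL2 γ Ψ) w =
      ∫ x, (latticeBump τ x : ℂ) * (conj (Ψ.1 x) * w.1 x) := by
    intro Ψ w
    rw [integral_latticeBump_mul (hL Ψ w) (hper Ψ w), inner_eq_integral]
    refine integral_congr_ae (ae_restrict_of_ae ?_)
    filter_upwards [coeFn_smoothToL2 Ψ] with x hx
    rw [hx]
  have hχ : ContDiff ℝ ∞ fun x => (latticeBump τ x : ℂ) :=
    Complex.ofRealCLM.contDiff.comp (contDiff_latticeBump τ)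
  have hχs : HasCompactSupport fun x => (latticeBump τ x : ℂ) :=
    (hasCompactSupport_latticeBump τ).comp_left (g := ((↑) : ℝ → ℂ)) rfl
  have hconj : ContDiff ℝ ∞ fun x => conj (Φ.1 x) := Complex.conjCLE.contDiff.comp Φ.2.1
  -- The test function is the partition bump times the conjugate of Φ. The derivative of Φ gives the
  -- wanted term, and that of the bump vanishes by `integral_fderiv_latticeBump_mul`.
  have key := HasWeakPartial.integral_mul h (hχ.mul hconj) hχs.mul_right
  have hder : ∀ x, fderiv ℝ (fun x => (latticeBump τ x : ℂ) * conj (Φ.1 x)) x (basisVec j) =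
      (fderiv ℝ (latticeBump τ) x (basisVec j) : ℂ) * conj (Φ.1 x) +
        latticeBump τ x * conj (fderiv ℝ Φ.1 x (basisVec j)) := by
    intro x
    have d1 : HasFDerivAt (fun x => (latticeBump τ x : ℂ)) _ x :=
      (Complex.ofRealCLM.hasFDerivAt).comp x
        ((contDiff_latticeBump τ).differentiable (by simp) x).hasFDerivAt
    have d2 : HasFDerivAt (fun x => conj (Φ.1 x)) _ x :=
      (Complex.conjCLE.hasFDerivAt).comp x (Φ.2.1.differentiable (by simp) x).hasFDerivAt
    have d3 : HasFDerivAt (fun x => (latticeBump τ x : ℂ) * conj (Φ.1 x)) _ x := d1.mul d2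
    rw [d3.fderiv]
    simp
    ring
  have i1 : Integrable fun x => (fderiv ℝ (latticeBump τ) x (basisVec j) : ℂ) *
      (conj (Φ.1 x) * u.1 x) :=
    integrable_mul_of_hasCompactSupport (hL Φ u)
      (Complex.continuous_ofReal.comp (continuous_fderiv_apply_const (contDiff_latticeBump τ) _))
      (((hasCompactSupport_latticeBump τ).fderiv_apply ℝ _).comp_left (g := ((↑) : ℝ → ℂ)) rfl)
  have i2 := integrable_mul_of_hasCompactSupport (hL (smoothCov γ j Φ) u) hχ.continuous hχs
  have i3 := integrable_mul_of_hasCompactSupport (hL Φ g) hχ.continuous hχs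
  have i4 := integrable_mul_of_hasCompactSupport
    (locallyIntegrable_mul (hL Φ u) (contDiff_potential_mul_I n j).continuous) hχ.continuous hχs
  have e1 : ∫ x, fderiv ℝ (fun x => (latticeBump τ x : ℂ) * conj (Φ.1 x)) x (basisVec j) * u.1 x =
      ∫ x, ((fderiv ℝ (latticeBump τ) x (basisVec j) : ℂ) * (conj (Φ.1 x) * u.1 x) +
        ((latticeBump τ x : ℂ) * (conj ((smoothCov γ j Φ).1 x) * u.1 x) -
          (latticeBump τ x : ℂ) * (Complex.I * (potential n j x : ℂ) *
            (conj (Φ.1 x) * u.1 x)))) := by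
    refine integral_congr_ae (.of_forall fun x => ?_)
    beta_reduce
    rw [hder, smoothCov_coe, covDeriv]
    simp only [map_sub, map_mul, Complex.conj_I, Complex.conj_ofReal]
    ring
  have e2 : ∫ x, (latticeBump τ x : ℂ) * conj (Φ.1 x) *
      (g.1 x + Complex.I * (potential n j x : ℂ) * u.1 x) =
      ∫ x, ((latticeBump τ x : ℂ) * (conj (Φ.1 x) * g.1 x) +
        (latticeBump τ x : ℂ) * (Complex.I * (potential n j x : ℂ) * (conj (Φ.1 x) * u.1 x))) := by
    refine integral_congr_ae (.of_forall fun x => ?_)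
    beta_reduce
    ring
  have i5 : Integrable fun x => (latticeBump τ x : ℂ) * (conj ((smoothCov γ j Φ).1 x) * u.1 x) -
      (latticeBump τ x : ℂ) * (Complex.I * (potential n j x : ℂ) * (conj (Φ.1 x) * u.1 x)) :=
    i2.sub i4
  rw [e1, e2, integral_add i1 i5, integral_sub i2 i4, integral_add i3 i4,
    integral_fderiv_latticeBump_mul (hL Φ u) (hper Φ u), ← hin, ← hin] at key
  linear_combination key

lemma hasWeakCovDeriv_smooth {γ : GaugePhase τ n} (j : Fin 2) (f : smoothGauge γ) :
    HasWeakCovDeriv n j (smoothToL2 γ f).1 (smoothToL2 γ (smoothCov γ j f)).1 :=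
  (hasWeakCovDeriv_covDeriv n j f.2.1).congr (coeFn_smoothToL2 f).symm
    (coeFn_smoothToL2 (smoothCov γ j f)).symm

lemma fderiv_potential (j k : Fin 2) (x : ℂ) :
    fderiv ℝ (fun x => Complex.I * (potential n j x : ℂ)) x (basisVec k) =
      Complex.I * ((n : ℝ) / 2 * dot (perp (basisVec k)) (basisVec j) : ℝ) := by
  have h1 : HasFDerivAt (potential n j) (((n : ℝ) / 2) • -dotCLM (perp (basisVec j))) x := by
    have := ((-dotCLM (perp (basisVec j))).hasFDerivAt (x := x)).const_mul ((n : ℝ) / 2)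
    refine this.congr_of_eventuallyEq (.of_forall fun y => ?_)
    simp only [_root_.neg_apply, dotCLM_apply, potential, dot, perp]
    ring
  have h2 : HasFDerivAt (fun x => Complex.I * (potential n j x : ℂ)) _ x :=
    ((Complex.ofRealCLM.hasFDerivAt).comp x h1).const_mul Complex.I
  rw [h2.fderiv]
  simp [dotCLM_apply, dot, perp]
  ring

/-- Pure second derivatives commute, so the commutator comes from differentiating the potential
only: it is i times the curl of Jx scaled by n/2, which is i times n. -/
lemma covariantPair_smooth (γ : GaugePhase τ n) :
    CovariantPair (smoothToL2 γ) (smoothCov γ) (n : ℝ) where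
  skew k x y := inner_smooth_of_hasWeakCovDeriv x (hasWeakCovDeriv_smooth k y)
  comm f := by
    refine Subtype.ext (funext fun x => ?_)
    change covDeriv n 1 (covDeriv n 0 f.1) x =
      covDeriv n 0 (covDeriv n 1 f.1) x + (Complex.I * (n : ℝ)) * f.1 x
    have hd : ∀ j k, fderiv ℝ (covDeriv n j f.1) x (basisVec k) =
        fderiv ℝ (fderiv ℝ f.1) x (basisVec k) (basisVec j) -
        (Complex.I * ((n : ℝ) / 2 * dot (perp (basisVec k)) (basisVec j) : ℝ) * f.1 x +
          Complex.I * (potential n j x : ℂ) * fderiv ℝ f.1 x (basisVec k)) := by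
      intro j k
      have d0 : DifferentiableAt ℝ (fderiv ℝ f.1) x :=
        (f.2.1.fderiv_right (m := ∞) (by simp)).differentiable (by simp) x
      have d1 : HasFDerivAt (fun y => fderiv ℝ f.1 y (basisVec j)) _ x :=
        d0.hasFDerivAt.clm_apply (hasFDerivAt_const (basisVec j) x)
      have d2 : HasFDerivAt (fun y => Complex.I * (potential n j y : ℂ) * f.1 y) _ x :=
        ((contDiff_potential_mul_I n j).differentiable (by simp) x).hasFDerivAt.mul
          (f.2.1.differentiable (by simp) x).hasFDerivAt
      have d3 : HasFDerivAt (covDeriv n j f.1) _ x := d1.sub d2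
      rw [d3.fderiv]
      simp [fderiv_potential]
      ring
    have hsym : fderiv ℝ (fderiv ℝ f.1) x (basisVec 1) (basisVec 0) =
        fderiv ℝ (fderiv ℝ f.1) x (basisVec 0) (basisVec 1) :=
      (f.2.1.contDiffAt.isSymmSndFDerivAt
        (by simpa using WithTop.coe_le_coe.2 (le_top : (2 : ℕ∞) ≤ ⊤))) _ _
    rw [covDeriv, hd, hsym, covDeriv, covDeriv, hd, covDeriv]
    simp [basisVec, dot, perp]
    ring

/-! ### The graph of the magnetic Laplacian -/

lemma exists_cov_of_weakPartial {γ : GaugePhase τ n} {j : Fin 2} {u : GaugeL2 γ} {g : ℂ → ℂ}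
    (hg : MemL2Loc g) (h : HasWeakPartial j u.1 g) :
    ∃ d : GaugeL2 γ, HasWeakCovDeriv n j u.1 d.1 := by
  have h1 : HasWeakCovDeriv n j u.1 fun x => g x - Complex.I * (potential n j x : ℂ) * u.1 x :=
    HasWeakPartial.congr h .rfl (.of_forall fun x => by simp)
  have h2 : MemL2Loc fun x => g x - Complex.I * (potential n j x : ℂ) * u.1 x := by
    refine (hg.add (((memL2Loc_coe u).mul (contDiff_potential_mul_I n j).continuous).smul
      (-1))).congr (.of_forall fun x => ?_)
    simp [sub_eq_add_neg]
  obtain ⟨d, hd⟩ := exists_gaugeL2 (u.2.1.hasWeakCovDeriv h1) h2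
  exact ⟨d, h1.congr .rfl hd.symm⟩

/-- Local derivatives of a gauge-periodic function, once made covariant, are again gauge-periodic
and in L²_loc, hence elements of the Hilbert space. -/
lemma exists_cov_cov_of_memH2Loc {γ : GaugePhase τ n} {u : GaugeL2 γ} (h : MemH2Loc u.1) :
    ∃ d e : Fin 2 → GaugeL2 γ, (∀ j, HasWeakCovDeriv n j u.1 (d j).1) ∧
      ∀ j, HasWeakCovDeriv n j (d j).1 (e j).1 := by
  obtain ⟨-, g, k, hg, hk⟩ := h
  choose d hd using fun j => exists_cov_of_weakPartial (γ := γ) (hg j).1 (hg j).2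
  have hpart : ∀ j, ∃ e : GaugeL2 γ, HasWeakCovDeriv n j (d j).1 e.1 := by
    intro j
    -- This identifies `d j` almost everywhere with `g j` minus i times the potential times u, whose
    -- weak derivative is known from the second derivatives and the Leibniz rule.
    have e1 := (hg j).2.unique (hd j)
    have ha := contDiff_potential_mul_I n j
    have w := (hk j j).2.add ((HasWeakPartial.mul (hg j).2 ha).smul (-1))
    have m := (hk j j).1.add ((((memL2Loc_coe u).mul (continuous_fderiv_apply_const ha
      (basisVec j))).add ((hg j).1.mul ha.continuous)).smul (-1))
    refine exists_cov_of_weakPartial m (w.congr ?_ .rfl)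
    filter_upwards [e1] with x hx
    simp [hx]
  choose e he using hpart
  exact ⟨d, e, hd, he⟩

lemma coeFn_neg_sum {γ : GaugePhase τ n} (e : Fin 2 → GaugeL2 γ) :
    (-∑ j, e j : GaugeL2 γ).1 =ᵐ[volume] -∑ j, ((e j).1 : ℂ → ℂ) := by
  have h1 := AEEqFun.coeFn_neg (∑ j, e j : GaugeL2 γ).1
  have h2 := AEEqFun.coeFn_add (e 0).1 (e 1).1
  have h3 : (∑ j, e j : GaugeL2 γ).1 = (e 0).1 + (e 1).1 := by
    rw [Fin.sum_univ_two]; rfl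
  rw [h3] at h1
  have h4 : (-∑ j, e j : GaugeL2 γ).1 = -((e 0).1 + (e 1).1) := by rw [← h3]; rfl
  rw [h4]
  filter_upwards [h1, h2] with x hx hx2
  rw [hx, Pi.neg_apply, hx2]
  simp [Fin.sum_univ_two]

lemma mem_magneticGraph_of_cov {γ : GaugePhase τ n} {u : GaugeL2 γ} (h : MemH2Loc u.1)
    {d e : Fin 2 → GaugeL2 γ} (hd : ∀ j, HasWeakCovDeriv n j u.1 (d j).1)
    (he : ∀ j, HasWeakCovDeriv n j (d j).1 (e j).1) : (u, -∑ j, e j) ∈ magneticGraph γ :=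
  ⟨h, fun j => (d j).1, fun j => (e j).1, hd, he, coeFn_neg_sum e⟩

/-- No integrability of the image has to be required: on H²_loc the Laplacian of a gauge-periodic
function lies in the Hilbert space by `exists_cov_cov_of_memH2Loc`. -/
lemma mem_domain_iff_memH2Loc {γ : GaugePhase τ n} (u : GaugeL2 γ) :
    u ∈ (magneticLaplacian γ).domain ↔ MemH2Loc u.1 := by
  rw [LinearPMap.mem_domain_iff]
  constructor
  · rintro ⟨f, hf⟩
    rw [magneticLaplacian_graph] at hf
    exact hf.1
  · intro h
    obtain ⟨d, e, hd, he⟩ := exists_cov_cov_of_memH2Loc h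
    exact ⟨_, by rw [magneticLaplacian_graph]; exact mem_magneticGraph_of_cov h hd he⟩

/-- Two integrations by parts, after single-valuedness of the graph has replaced f by the second
derivatives that lie in the Hilbert space. -/
lemma inner_smooth_of_mem_graph {γ : GaugePhase τ n} (Φ : smoothGauge γ) {u f : GaugeL2 γ}
    (h : (u, f) ∈ magneticGraph γ) : inner ℂ (smoothToL2 γ Φ) f =
      inner ℂ (smoothToL2 γ (negLaplacian (smoothCov γ) Φ)) u := by
  obtain ⟨d, e, hd, he⟩ := exists_cov_cov_of_memH2Loc h.1
  have h1 := mem_magneticGraph_of_cov h.1 hd he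
  rw [← magneticLaplacian_graph] at h h1
  rw [LinearPMap.mem_graph_snd_inj _ h h1 rfl]
  simp only [negLaplacian_apply, Fin.sum_univ_two, inner_neg_right, inner_add_right, map_neg,
    map_add, inner_neg_left, inner_add_left, inner_smooth_of_hasWeakCovDeriv _ (he _),
    inner_smooth_of_hasWeakCovDeriv _ (hd _), neg_neg]

/-- The potential is smooth, hence bounded on compact sets, so covariant and ordinary derivatives of
order at most two differ by terms in L²_loc. All mixed derivatives are needed, not only those in the
Laplacian. -/
lemma memH2Loc_of_cov {γ : GaugePhase τ n} {u : GaugeL2 γ} {d : Fin 2 → GaugeL2 γ}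
    {e : Fin 2 → Fin 2 → GaugeL2 γ} (hd : ∀ j, HasWeakCovDeriv n j u.1 (d j).1)
    (he : ∀ j k, HasWeakCovDeriv n k (d j).1 (e j k).1) : MemH2Loc u.1 := by
  have ha := fun j => contDiff_potential_mul_I n j
  have hA : ∀ (w y : GaugeL2 γ) j,
      MemL2Loc fun x => w.1 x + Complex.I * (potential n j x : ℂ) * y.1 x := fun w y j =>
    (memL2Loc_coe w).add ((memL2Loc_coe y).mul (ha j).continuous)
  have hw := fun j k => HasWeakPartial.add (he j k) (HasWeakPartial.mul (hd k) (ha j))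
  refine ⟨memL2Loc_coe u, _, _, fun j => ⟨hA _ _ j, hd j⟩, fun j k => ⟨?_, hw j k⟩⟩
  exact (hA _ _ k).add (((memL2Loc_coe u).mul (continuous_fderiv_apply_const (ha j) _)).add
    ((hA _ _ k).mul (ha j).continuous))

/-- The graph contains the closure of the operator on smooth functions. -/
lemma mem_magneticGraph_of_closure {γ : GaugePhase τ n} {u f : GaugeL2 γ}
    (h : (u, f) ∈ closure (Set.range fun x : smoothGauge γ =>
      (smoothToL2 γ x, smoothToL2 γ (negLaplacian (smoothCov γ) x)))) :
    (u, f) ∈ magneticGraph γ := by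
  obtain ⟨x, d, e, hx, hd, he, rfl⟩ :=
    exists_tendsto_of_closure (covariantPair_smooth γ) n.cast_nonneg h
  have hd' : ∀ j, HasWeakCovDeriv n j u.1 (d j).1 := fun j =>
    hasWeakCovDeriv_of_tendsto hx (hd j) fun N => hasWeakCovDeriv_smooth j _
  have he' : ∀ j k, HasWeakCovDeriv n k (d j).1 (e j k).1 := fun j k =>
    hasWeakCovDeriv_of_tendsto (hd j) (he j k) fun N => hasWeakCovDeriv_smooth k _
  exact mem_magneticGraph_of_cov (memH2Loc_of_cov hd' he') hd' fun j => he' j j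

/-- A Hilbert basis of smooth eigenfunctions diagonalizes the magnetic Laplacian. -/
lemma mem_graph_iff_of_basis {γ : GaugePhase τ n} {ι : Type*} (b : HilbertBasis ι ℂ (GaugeL2 γ))
    (e : ι → smoothGauge γ) (hb : ∀ i, b i = smoothToL2 γ (e i)) (l : ι → ℝ)
    (hl : ∀ i, negLaplacian (smoothCov γ) (e i) = (l i : ℂ) • e i) (u f : GaugeL2 γ) :
    (u, f) ∈ (magneticLaplacian γ).graph ↔
      ∀ i, inner ℂ (b i) f = (l i : ℂ) * inner ℂ (b i) u := by
  rw [magneticLaplacian_graph]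
  constructor
  · intro h i
    rw [hb, inner_smooth_of_mem_graph _ h, hl, map_smul, inner_smul_left, Complex.conj_ofReal]
  · intro h
    refine mem_magneticGraph_of_closure ?_
    have h1 := b.hasSum_repr u
    have h2 := b.hasSum_repr f
    -- Partial sums of the expansion of u are smooth, and by the coordinate condition their
    -- Laplacians are the partial sums of the expansion of f.
    refine mem_closure_of_tendsto (h1.prodMk h2) (.of_forall fun F => ?_)
    refine ⟨∑ i ∈ F, b.repr u i • e i, ?_⟩
    simp only [map_sum, map_smul, hl, ← hb, b.repr_apply_apply, h, smul_smul, mul_comm]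
    exact Prod.ext (by simp [Prod.fst_sum]) (by simp [Prod.snd_sum])

end Smooth

section Modes

variable {τ : ℍ} {n : ℕ}

/-! ### Gauge-periodic sums of Gaussian modes -/

/-- By the cocycle relation `gaugeFactor_add`, the vectors t for which the law holds form a
subgroup, and it contains both generators. -/
lemma gauge_of_basis {γ : GaugePhase τ n} {f : ℂ → ℂ}
    (h1 : ∀ x, f (x + (latticePt τ 1 0 : ℂ)) = gaugeFactor γ (latticePt τ 1 0) x * f x)
    (h2 : ∀ x, f (x + (latticePt τ 0 1 : ℂ)) = gaugeFactor γ (latticePt τ 0 1) x * f x)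
    (t : lattice τ) (x : ℂ) : f (x + (t : ℂ)) = gaugeFactor γ t x * f x := by
  let G : AddSubgroup (lattice τ) :=
    { carrier := {t | ∀ x, f (x + (t : ℂ)) = gaugeFactor γ t x * f x}
      zero_mem' := fun x => by simp [gaugeFactor_zero]
      add_mem' := fun {s t} hs ht x => by
        have : x + ((s + t : lattice τ) : ℂ) = x + s + t := by push_cast; ring
        rw [this, ht, hs, gaugeFactor_add]
        ring
      neg_mem' := fun {t} ht x => by
        have h := ht (x + ((-t : lattice τ) : ℂ))
        have e : x + ((-t : lattice τ) : ℂ) + (t : ℂ) = x := by push_cast; ring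
        have g := gaugeFactor_add γ (-t) t x
        rw [neg_add_cancel, gaugeFactor_zero] at g
        rw [e] at h
        rw [h]
        linear_combination (f (x + ((-t : lattice τ) : ℂ))) * g }
  have h1' : latticePt τ 1 0 ∈ G := h1
  have h2' : latticePt τ 0 1 ∈ G := h2
  suffices t ∈ G from this x
  obtain ⟨_, p, q, rfl⟩ := t
  have : (⟨pt τ p q, p, q, rfl⟩ : lattice τ) = p • latticePt τ 1 0 + q • latticePt τ 0 1 := by
    apply Subtype.ext
    push_cast
    simp [latticePt, pt]
    ring
  rw [this]
  exact G.add_mem (G.zsmul_mem h1' p) (G.zsmul_mem h2' q)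

/-- The momenta of the modes. -/
def kappa (γ : GaugePhase τ n) (m : ℤ) : ℝ :=
  (2 * Real.pi * m + γ.c (latticePt τ 1 0)) / scale τ

/-- The constant phases of the modes. -/
def modePhase (γ : GaugePhase τ n) (m : ℤ) : ℝ :=
  Real.pi * τ.re * m ^ 2 / n +
    (γ.c (latticePt τ 1 0) * τ.re - γ.c (latticePt τ 0 1)) * m / n

/-- The center-shifted second coordinate. -/
def modeY (γ : GaugePhase τ n) (m : ℤ) (x : ℂ) : ℝ := x.im + kappa γ m / n

/-- A plane wave in the first variable times a polynomial times a Gaussian in the second one. -/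
def mode (γ : GaugePhase τ n) (P : Polynomial ℂ) (m : ℤ) (x : ℂ) : ℂ :=
  Complex.exp (Complex.I * ((n : ℝ) / 2 * x.re * x.im + kappa γ m * x.re + modePhase γ m : ℝ) -
    ((n : ℝ) / 2 * modeY γ m x ^ 2 : ℝ)) * P.eval (modeY γ m x : ℂ)

/-- The gauge-periodic sum of modes. -/
def modeSum (γ : GaugePhase τ n) (s : ZMod n → ℂ) (P : Polynomial ℂ) (x : ℂ) : ℂ :=
  ∑' m : ℤ, s m * mode γ P m x

lemma norm_mode (γ : GaugePhase τ n) (P : Polynomial ℂ) (m : ℤ) (x : ℂ) :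
    ‖mode γ P m x‖ = Real.exp (-((n : ℝ) / 2 * modeY γ m x ^ 2)) * ‖P.eval (modeY γ m x : ℂ)‖ := by
  rw [mode, norm_mul, Complex.norm_exp]
  congr 2
  simp [-Complex.ofReal_add, -Complex.ofReal_mul, -Complex.ofReal_div, -Complex.ofReal_pow]

/-- For a monomial, |y|^k ≤ k! e^{|y|}, and the Gaussian absorbs any linear exponent by completing
the square: |y| - y²/2 ≤ (c + 1)²/2 - c|y|, where n ≥ 1 is used. -/
lemma exists_gaussian_bound (hn : 0 < n) (P : Polynomial ℂ) (c : ℝ) : ∃ C : ℝ, 0 ≤ C ∧ ∀ y : ℝ,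
    Real.exp (-((n : ℝ) / 2 * y ^ 2)) * ‖P.eval (y : ℂ)‖ ≤ C * Real.exp (-(c * |y|)) := by
  have hn1 : (1 : ℝ) ≤ n := by exact_mod_cast hn
  induction P using Polynomial.induction_on' with
  | add P Q hP hQ =>
    obtain ⟨C, hC, h⟩ := hP
    obtain ⟨C', hC', h'⟩ := hQ
    refine ⟨C + C', by positivity, fun y => ?_⟩
    rw [Polynomial.eval_add, add_mul]
    refine le_trans ?_ (add_le_add (h y) (h' y))
    rw [← mul_add]
    gcongr
    exact norm_add_le _ _
  | monomial k a =>
    refine ⟨‖a‖ * k.factorial * Real.exp ((c + 1) ^ 2 / 2), by positivity, fun y => ?_⟩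
    have h1 : |y| ^ k ≤ k.factorial * Real.exp |y| := by
      have := Real.pow_div_factorial_le_exp |y| (abs_nonneg y) k
      rwa [div_le_iff₀ (by positivity), mul_comm] at this
    have h2 : -((n : ℝ) / 2 * y ^ 2) + |y| ≤ (c + 1) ^ 2 / 2 + -(c * |y|) := by
      have h3 : |y| ^ 2 ≤ n * |y| ^ 2 := le_mul_of_one_le_left (by positivity) hn1
      rw [← sq_abs y]
      nlinarith [sq_nonneg (|y| - (c + 1))]
    have h4 : Real.exp (-((n : ℝ) / 2 * y ^ 2)) * Real.exp |y| ≤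
        Real.exp ((c + 1) ^ 2 / 2) * Real.exp (-(c * |y|)) := by
      rw [← Real.exp_add, ← Real.exp_add]
      exact Real.exp_le_exp.2 h2
    rw [Polynomial.eval_monomial, norm_mul, norm_pow, Complex.norm_real, Real.norm_eq_abs]
    calc Real.exp (-((n : ℝ) / 2 * y ^ 2)) * (‖a‖ * |y| ^ k)
        ≤ Real.exp (-((n : ℝ) / 2 * y ^ 2)) * (‖a‖ * (k.factorial * Real.exp |y|)) := by gcongr
      _ = ‖a‖ * k.factorial * (Real.exp (-((n : ℝ) / 2 * y ^ 2)) * Real.exp |y|) := by ring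
      _ ≤ ‖a‖ * k.factorial * (Real.exp ((c + 1) ^ 2 / 2) * Real.exp (-(c * |y|))) := by gcongr
      _ = _ := by ring

lemma summable_exp_neg_abs {β : ℝ} (hβ : 0 < β) : Summable fun m : ℤ => Real.exp (-(β * |(m : ℝ)|)) := by
  have h : Summable fun k : ℕ => Real.exp (-(β * k)) := by
    have := Real.summable_exp_nat_mul_iff.2 (neg_lt_zero.2 hβ)
    refine this.congr fun k => ?_
    ring_nf
  refine Summable.of_nat_of_neg (h.congr fun k => ?_) (h.congr fun k => ?_)
  · simp
  · simp

/-- The Gaussian centres move away linearly in m, so for bounded x the decay in `modeY` becomes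
exponential decay in |m|. Uniformity in x is needed for termwise differentiation. -/
lemma exists_mode_bound (γ : GaugePhase τ n) (hn : 0 < n) (P : Polynomial ℂ) (R : ℝ) :
    ∃ b : ℤ → ℝ, Summable b ∧ ∀ m x, ‖x‖ ≤ R → ‖mode γ P m x‖ ≤ b m := by
  obtain ⟨C, hC, h⟩ := exists_gaussian_bound hn P 1
  have hr := scale_pos τ
  have hn0 : (0 : ℝ) < n := by exact_mod_cast hn
  set r := scale τ
  set c₁ := γ.c (latticePt τ 1 0)
  refine ⟨fun m => C * Real.exp (R + |c₁| / (r * n)) *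
    Real.exp (-(2 * Real.pi / (r * n) * |(m : ℝ)|)),
    (summable_exp_neg_abs (by positivity)).mul_left _, fun m x hx => ?_⟩
  rw [norm_mode]
  refine (h _).trans ?_
  beta_reduce
  rw [mul_assoc, ← Real.exp_add]
  refine mul_le_mul_of_nonneg_left (Real.exp_le_exp.2 ?_) hC
  have h1 : |x.im| ≤ R := (Complex.abs_im_le_norm x).trans hx
  have h2 : 2 * Real.pi / (r * n) * |(m : ℝ)| ≤ |kappa γ m / n| + |c₁| / (r * n) := by
    have e1 : 2 * Real.pi / (r * n) * |(m : ℝ)| = |2 * Real.pi * m / (r * n)| := by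
      rw [abs_div, abs_mul, abs_of_pos (show 0 < r * n by positivity),
        abs_of_pos Real.two_pi_pos]
      ring
    have e2 : |c₁| / (r * n) = |-(c₁ / (r * n))| := by
      rw [abs_neg, abs_div, abs_of_pos (show 0 < r * n by positivity)]
    rw [e1, e2]
    refine le_trans (le_of_eq ?_) (abs_add_le _ _)
    congr 1
    rw [show kappa γ m = (2 * Real.pi * m + c₁) / r from rfl]
    field_simp
    ring
  have h3 : |kappa γ m / n| ≤ |modeY γ m x| + |x.im| := by
    have : kappa γ m / n = modeY γ m x - x.im := by rw [modeY]; ring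
    rw [this]
    exact abs_sub _ _
  linarith

lemma mode_add (γ : GaugePhase τ n) (P Q : Polynomial ℂ) (m : ℤ) (x : ℂ) :
    mode γ (P + Q) m x = mode γ P m x + mode γ Q m x := by
  simp [mode, mul_add]

lemma mode_C_mul (γ : GaugePhase τ n) (a : ℂ) (P : Polynomial ℂ) (m : ℤ) (x : ℂ) :
    mode γ (Polynomial.C a * P) m x = a * mode γ P m x := by
  simp [mode]; ring

/-- The action of the two covariant derivatives on polynomials. -/
def polyCov (n : ℕ) : Fin 2 → Polynomial ℂ → Polynomial ℂ :=
  ![fun P => Polynomial.C (Complex.I * n) * (Polynomial.X * P),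
    fun P => Polynomial.derivative P - Polynomial.C (n : ℂ) * (Polynomial.X * P)]

/-- The derivative of a sum of modes, in terms of sums of modes. -/
def modeFDeriv (n : ℕ) (F : Polynomial ℂ → ℂ → ℂ) (P : Polynomial ℂ) (x : ℂ) : ℂ →L[ℝ] ℂ :=
  Complex.reCLM.smulRight (F (polyCov n 0 P) x + Complex.I * (potential n 0 x : ℂ) * F P x) +
    Complex.imCLM.smulRight (F (polyCov n 1 P) x + Complex.I * (potential n 1 x : ℂ) * F P x)

lemma hasFDerivAt_mode (γ : GaugePhase τ n) (hn : 0 < n) (P : Polynomial ℂ) (m : ℤ) (x : ℂ) :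
    HasFDerivAt (mode γ P m) (modeFDeriv n (fun P => mode γ P m) P x) x := by
  have hn0 : (n : ℂ) ≠ 0 := by exact_mod_cast hn.ne'
  have hre : HasFDerivAt (fun x : ℂ => x.re) Complex.reCLM x := Complex.reCLM.hasFDerivAt
  have him : HasFDerivAt (fun x : ℂ => x.im) Complex.imCLM x := Complex.imCLM.hasFDerivAt
  have hy : HasFDerivAt (modeY γ m) Complex.imCLM x := him.add_const _
  have hy' : HasFDerivAt (fun x => (modeY γ m x : ℂ)) _ x :=
    (Complex.ofRealCLM.hasFDerivAt).comp x hy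
  have h1 : HasFDerivAt (fun x : ℂ => (n : ℝ) / 2 * x.re * x.im + kappa γ m * x.re + modePhase γ m)
      _ x := (((hre.const_mul ((n : ℝ) / 2)).mul him).add (hre.const_mul (kappa γ m))).add_const
        (modePhase γ m)
  have h2 : HasFDerivAt (fun x : ℂ => (n : ℝ) / 2 * modeY γ m x ^ 2) _ x :=
    (hy.pow 2).const_mul ((n : ℝ) / 2)
  have h3 : HasFDerivAt (fun x : ℂ => Complex.I *
      ((n : ℝ) / 2 * x.re * x.im + kappa γ m * x.re + modePhase γ m : ℝ) -
      ((n : ℝ) / 2 * modeY γ m x ^ 2 : ℝ)) _ x :=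
    (((Complex.ofRealCLM.hasFDerivAt).comp x h1).const_mul Complex.I).sub
      ((Complex.ofRealCLM.hasFDerivAt).comp x h2)
  have hP := (P.hasDerivAt (modeY γ m x : ℂ)).complexToReal_fderiv
  have h4 : HasFDerivAt (fun x => P.eval (modeY γ m x : ℂ)) _ x :=
    HasFDerivAt.comp (g := fun z : ℂ => P.eval z) x hP hy'
  have h5 : HasFDerivAt (mode γ P m) _ x := h3.cexp.mul h4
  refine h5.congr_fderiv (ContinuousLinearMap.ext fun v => ?_)
  -- Expressing the momentum through `modeY` turns the covariant derivative in x₁ into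
  -- multiplication by i·n·y, so both covariant derivatives act on the polynomial as in `polyCov`.
  have hk : (kappa γ m : ℂ) = n * (modeY γ m x - x.im) := by
    rw [modeY]
    push_cast
    field_simp
    ring
  simp [modeFDeriv, mode, polyCov, potential, basisVec, dot, perp, hk]
  ring

lemma exists_weight_bound [NeZero n] (s : ZMod n → ℂ) : ∃ B : ℝ, 0 ≤ B ∧ ∀ z, ‖s z‖ ≤ B := by
  refine ⟨∑ z, ‖s z‖, Finset.sum_nonneg fun _ _ => norm_nonneg _, fun z => ?_⟩
  exact Finset.single_le_sum (f := fun z => ‖s z‖) (fun _ _ => norm_nonneg _) (Finset.mem_univ z)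

lemma modeFDeriv_apply (F : Polynomial ℂ → ℂ → ℂ) (P : Polynomial ℂ) (x v : ℂ) :
    modeFDeriv n F P x v =
      v.re * (F (polyCov n 0 P) x + Complex.I * (potential n 0 x : ℂ) * F P x) +
      v.im * (F (polyCov n 1 P) x + Complex.I * (potential n 1 x : ℂ) * F P x) := by
  simp [modeFDeriv]
  ring

lemma abs_potential_le (j : Fin 2) (x : ℂ) : |potential n j x| ≤ n * ‖x‖ := by
  have h1 := Complex.abs_re_le_norm x
  have h2 := Complex.abs_im_le_norm x
  have hn : (0 : ℝ) ≤ n := n.cast_nonneg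
  have h0 := norm_nonneg x
  fin_cases j
  · simp only [potential, dot, perp, basisVec]
    simp only [Fin.zero_eta, Matrix.cons_val_zero, Complex.one_re, Complex.one_im, mul_one, mul_zero,
      add_zero]
    rw [abs_mul, abs_neg, abs_of_nonneg (by positivity)]
    nlinarith
  · simp only [potential, dot, perp, basisVec]
    simp only [Fin.mk_one, Matrix.cons_val_one, Matrix.cons_val_zero, Complex.I_re, Complex.I_im,
      mul_one, mul_zero, zero_add]
    rw [abs_mul, abs_of_nonneg (show (0 : ℝ) ≤ n / 2 by positivity)]
    nlinarith

lemma latticePt_one_zero (τ : ℍ) : (latticePt τ 1 0 : ℂ) = scale τ := by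
  simp [latticePt, pt]

lemma latticePt_zero_one (τ : ℍ) : (latticePt τ 0 1 : ℂ) = scale τ * τ := by
  simp [latticePt, pt]

lemma scale_mul_scale (τ : ℍ) : scale τ * scale τ * τ.im = 2 * Real.pi := by
  rw [← scale_sq τ]; ring

/-- The momentum times r is 2πm plus the phase of the first basis vector, and 2πm disappears in the
exponential. -/
lemma mode_add_one_zero (γ : GaugePhase τ n) (P : Polynomial ℂ) (m : ℤ) (x : ℂ) :
    mode γ P m (x + (latticePt τ 1 0 : ℂ)) = gaugeFactor γ (latticePt τ 1 0) x * mode γ P m x := by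
  have hr := (scale_pos τ).ne'
  have hy : modeY γ m (x + (latticePt τ 1 0 : ℂ)) = modeY γ m x := by
    simp [modeY, latticePt_one_zero]
  rw [mode, mode, gaugeFactor, hy, ← mul_assoc, ← Complex.exp_add]
  congr 1
  rw [Complex.exp_eq_exp_iff_exists_int]
  refine ⟨m, ?_⟩
  have : (n : ℝ) / 2 * (x + (latticePt τ 1 0 : ℂ)).re * (x + (latticePt τ 1 0 : ℂ)).im +
      kappa γ m * (x + (latticePt τ 1 0 : ℂ)).re + modePhase γ m =
      ((n : ℝ) / 2 * dot x (perp (latticePt τ 1 0 : ℂ)) + γ.c (latticePt τ 1 0)) +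
      ((n : ℝ) / 2 * x.re * x.im + kappa γ m * x.re + modePhase γ m) + 2 * Real.pi * m := by
    simp only [latticePt_one_zero, dot, perp, kappa, Complex.add_re, Complex.add_im,
      Complex.ofReal_re, Complex.ofReal_im]
    field_simp
    ring
  rw [this]
  push_cast
  ring

variable [NeZero n]

lemma exists_modeSum_bound (γ : GaugePhase τ n) (s : ZMod n → ℂ) (P : Polynomial ℂ) (R : ℝ) :
    ∃ b : ℤ → ℝ, Summable b ∧ ∀ (m : ℤ) x, ‖x‖ ≤ R → ‖s m * mode γ P m x‖ ≤ b m := by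
  obtain ⟨b, hb, h⟩ := exists_mode_bound γ (NeZero.pos n) P R
  obtain ⟨B, hB, h'⟩ := exists_weight_bound s
  refine ⟨fun m => B * b m, hb.mul_left B, fun m x hx => ?_⟩
  rw [norm_mul]
  exact mul_le_mul (h' _) (h m x hx) (norm_nonneg _) hB

lemma summable_mode (γ : GaugePhase τ n) (s : ZMod n → ℂ) (P : Polynomial ℂ) (x : ℂ) :
    Summable fun m : ℤ => s m * mode γ P m x := by
  obtain ⟨b, hb, h⟩ := exists_modeSum_bound γ s P ‖x‖
  exact .of_norm_bounded hb fun m => h m x le_rfl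

lemma hasFDerivAt_modeSum (γ : GaugePhase τ n) (s : ZMod n → ℂ) (P : Polynomial ℂ) (x : ℂ) :
    HasFDerivAt (modeSum γ s P) (modeFDeriv n (modeSum γ s) P x) x := by
  set R := ‖x‖ + 1
  obtain ⟨b, hb, h⟩ := exists_modeSum_bound γ s P R
  obtain ⟨b0, hb0, h0⟩ := exists_modeSum_bound γ s (polyCov n 0 P) R
  obtain ⟨b1, hb1, h1⟩ := exists_modeSum_bound γ s (polyCov n 1 P) R
  have hR : 0 ≤ R := by positivity
  have hxR : x ∈ Metric.ball (0 : ℂ) R := by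
    rw [mem_ball_zero_iff]
    exact lt_add_one _
  have hsum : Summable fun m => (b0 m + n * R * b m) + (b1 m + n * R * b m) :=
    (hb0.add (hb.mul_left _)).add (hb1.add (hb.mul_left _))
  have hbound : ∀ (m : ℤ) y, y ∈ Metric.ball (0 : ℂ) R →
      ‖s m • modeFDeriv n (fun P => mode γ P m) P y‖ ≤
        (b0 m + n * R * b m) + (b1 m + n * R * b m) := by
    intro m y hy
    have hy' : ‖y‖ ≤ R := (mem_ball_zero_iff.1 hy).le
    have n1 := h m y hy'
    have n2 := h0 m y hy'
    have n3 := h1 m y hy'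
    have q0 : 0 ≤ b m := (norm_nonneg _).trans n1
    have q1 : 0 ≤ b0 m := (norm_nonneg _).trans n2
    have q2 : 0 ≤ b1 m := (norm_nonneg _).trans n3
    refine ContinuousLinearMap.opNorm_le_bound _ (by positivity) fun v => ?_
    have p : ∀ j, |potential n j y| ≤ n * R := fun j =>
      (abs_potential_le j y).trans (by gcongr)
    have e : (s m • modeFDeriv n (fun P => mode γ P m) P y) v =
        v.re * (s m * mode γ (polyCov n 0 P) m y +
          Complex.I * (potential n 0 y : ℂ) * (s m * mode γ P m y)) +
        v.im * (s m * mode γ (polyCov n 1 P) m y +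
          Complex.I * (potential n 1 y : ℂ) * (s m * mode γ P m y)) := by
      rw [_root_.smul_apply, modeFDeriv_apply, smul_eq_mul]
      ring
    have t : ∀ (j : Fin 2) (w z : ℂ), ‖w + Complex.I * (potential n j y : ℂ) * z‖ ≤
        ‖w‖ + n * R * ‖z‖ := fun j w z => by
      refine (norm_add_le _ _).trans ?_
      rw [norm_mul, norm_mul, Complex.norm_I, one_mul, Complex.norm_real, Real.norm_eq_abs]
      gcongr
      exact p j
    rw [e]
    refine (norm_add_le _ _).trans ?_
    rw [norm_mul, norm_mul, Complex.norm_real, Complex.norm_real, Real.norm_eq_abs,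
      Real.norm_eq_abs, add_mul]
    refine add_le_add ?_ ?_
    · rw [mul_comm]
      refine mul_le_mul ((t _ _ _).trans ?_) (Complex.abs_re_le_norm v) (abs_nonneg _)
        (by positivity)
      gcongr
    · rw [mul_comm]
      refine mul_le_mul ((t _ _ _).trans ?_) (Complex.abs_im_le_norm v) (abs_nonneg _)
        (by positivity)
      gcongr
  have key := hasFDerivAt_tsum_of_isPreconnected (𝕜 := ℝ) hsum Metric.isOpen_ball
    (convex_ball (0 : ℂ) R).isPreconnected
    (f := fun m : ℤ => fun y => s m * mode γ P m y)
    (fun m y _ => (hasFDerivAt_mode γ (NeZero.pos n) P m y).const_mul (s m)) hbound hxR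
    (summable_mode γ s P x) hxR
  refine key.congr_fderiv (ContinuousLinearMap.ext fun v => ?_)
  have hs : Summable fun m : ℤ => s m • modeFDeriv n (fun P => mode γ P m) P x :=
    .of_norm_bounded hsum fun m => hbound m x hxR
  have hs' : HasSum (fun m : ℤ => (s m • modeFDeriv n (fun P => mode γ P m) P x) v)
      ((∑' m : ℤ, s m • modeFDeriv n (fun P => mode γ P m) P x) v) :=
    hs.hasSum.mapL (ContinuousLinearMap.apply ℝ ℂ v)
  refine hs'.unique ?_
  rw [modeFDeriv_apply]
  have g := fun Q => (summable_mode γ s Q x).hasSum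
  refine ((((g (polyCov n 0 P)).add ((g P).mul_left (Complex.I * (potential n 0 x : ℂ)))).mul_left
    (v.re : ℂ)).add (((g (polyCov n 1 P)).add ((g P).mul_left
      (Complex.I * (potential n 1 x : ℂ)))).mul_left (v.im : ℂ))).congr_fun fun m => ?_
  rw [_root_.smul_apply, modeFDeriv_apply, smul_eq_mul]
  ring

/-- The derivative of a sum of modes is built from sums of modes and the smooth potential, so
regularity is gained by induction over all polynomials at once. -/
lemma contDiff_modeSum (γ : GaugePhase τ n) (s : ZMod n → ℂ) (P : Polynomial ℂ) :
    ContDiff ℝ ∞ (modeSum γ s P) := by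
  rw [contDiff_infty]
  intro N
  induction N generalizing P with
  | zero =>
    rw [Nat.cast_zero, contDiff_zero]
    exact continuous_iff_continuousAt.2 fun x => (hasFDerivAt_modeSum γ s P x).continuousAt
  | succ N ih =>
    have ha := fun j => (contDiff_potential_mul_I n j).of_le (m := N) (by exact_mod_cast le_top)
    rw [Nat.cast_succ, contDiff_succ_iff_hasFDerivAt]
    refine ⟨_, ?_, hasFDerivAt_modeSum γ s P⟩
    exact (contDiff_const.smulRight ((ih _).add ((ha 0).mul (ih P)))).add
      (contDiff_const.smulRight ((ih _).add ((ha 1).mul (ih P))))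

lemma covDeriv_modeSum (γ : GaugePhase τ n) (s : ZMod n → ℂ) (P : Polynomial ℂ) (j : Fin 2) :
    covDeriv n j (modeSum γ s P) = modeSum γ s (polyCov n j P) := by
  funext x
  rw [covDeriv, (hasFDerivAt_modeSum γ s P x).fderiv, modeFDeriv_apply]
  fin_cases j <;> simp [basisVec]

/-- Translation by rτ raises x₂ by r Im τ = 2π/r, the distance between the Gaussian centres of m and
m + n; here the area 2π of the cell enters. The remaining phases match because `modePhase`,
quadratic in m, solves the corresponding recursion. -/
lemma mode_add_zero_one (γ : GaugePhase τ n) (P : Polynomial ℂ) (m : ℤ) (x : ℂ) :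
    mode γ P m (x + (latticePt τ 0 1 : ℂ)) =
      gaugeFactor γ (latticePt τ 0 1) x * mode γ P (m + n) x := by
  have hr := (scale_pos τ).ne'
  have hn : (n : ℝ) ≠ 0 := Nat.cast_ne_zero.2 (NeZero.ne n)
  have h2 := scale_mul_scale τ
  have hk : kappa γ (m + n) = kappa γ m + n * (scale τ * τ.im) := by
    rw [kappa, kappa]
    field_simp
    push_cast
    linear_combination (-n : ℝ) * h2
  have hy : modeY γ m (x + (latticePt τ 0 1 : ℂ)) = modeY γ (m + n) x := by
    rw [modeY, modeY, hk, latticePt_zero_one]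
    simp
    field_simp
    ring
  rw [mode, mode, gaugeFactor, hy, ← mul_assoc, ← Complex.exp_add]
  congr 2
  have hκ : kappa γ m * scale τ = 2 * Real.pi * m + γ.c (latticePt τ 1 0) := by
    rw [kappa]; field_simp
  have hα : modePhase γ (m + n) = modePhase γ m + Real.pi * τ.re * (2 * m + n) +
      (γ.c (latticePt τ 1 0) * τ.re - γ.c (latticePt τ 0 1)) := by
    rw [modePhase, modePhase]
    push_cast
    field_simp
    ring
  have : (n : ℝ) / 2 * (x + (latticePt τ 0 1 : ℂ)).re * (x + (latticePt τ 0 1 : ℂ)).im +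
      kappa γ m * (x + (latticePt τ 0 1 : ℂ)).re + modePhase γ m =
      ((n : ℝ) / 2 * dot x (perp (latticePt τ 0 1 : ℂ)) + γ.c (latticePt τ 0 1)) +
      ((n : ℝ) / 2 * x.re * x.im + kappa γ (m + n) * x.re + modePhase γ (m + n)) := by
    rw [hk, hα]
    simp only [latticePt_zero_one, dot, perp, Complex.add_re, Complex.add_im, Complex.mul_re,
      Complex.mul_im, Complex.ofReal_re, Complex.ofReal_im, UpperHalfPlane.coe_re,
      UpperHalfPlane.coe_im]
    linear_combination (τ.re) * hκ + (n : ℝ) / 2 * τ.re * h2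
  rw [this]
  push_cast
  ring

/-- For the second generator the sum is reindexed by m ↦ m + n, which leaves weights on ℤ/n
unchanged. -/
lemma modeSum_add_lattice (γ : GaugePhase τ n) (s : ZMod n → ℂ) (P : Polynomial ℂ) (t : lattice τ)
    (x : ℂ) : modeSum γ s P (x + (t : ℂ)) = gaugeFactor γ t x * modeSum γ s P x := by
  refine gauge_of_basis (fun x => ?_) (fun x => ?_) t x
  · simp only [modeSum, mode_add_one_zero, ← tsum_mul_left]
    exact tsum_congr fun m => by ring
  · simp only [modeSum, mode_add_zero_one, ← tsum_mul_left]
    rw [← (Equiv.addRight (n : ℤ)).tsum_eq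
      fun m => gaugeFactor γ (latticePt τ 0 1) x * (s m * mode γ P m x)]
    refine tsum_congr fun m => ?_
    simp
    ring

/-- The sum of modes as a smooth gauge-periodic function. -/
def smoothMode (γ : GaugePhase τ n) (s : ZMod n → ℂ) (P : Polynomial ℂ) : smoothGauge γ :=
  ⟨modeSum γ s P, contDiff_modeSum γ s P, modeSum_add_lattice γ s P⟩

lemma smoothCov_smoothMode (γ : GaugePhase τ n) (s : ZMod n → ℂ) (P : Polynomial ℂ) (j : Fin 2) :
    smoothCov γ j (smoothMode γ s P) = smoothMode γ s (polyCov n j P) :=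
  Subtype.ext (covDeriv_modeSum γ s P j)

lemma smoothMode_add (γ : GaugePhase τ n) (s : ZMod n → ℂ) (P Q : Polynomial ℂ) :
    smoothMode γ s (P + Q) = smoothMode γ s P + smoothMode γ s Q := by
  refine Subtype.ext (funext fun x => ?_)
  change modeSum γ s (P + Q) x = modeSum γ s P x + modeSum γ s Q x
  simp only [modeSum]
  rw [← (summable_mode γ s P x).tsum_add (summable_mode γ s Q x)]
  exact tsum_congr fun m => by rw [mode_add]; ring

lemma smoothMode_C_mul (γ : GaugePhase τ n) (s : ZMod n → ℂ) (a : ℂ) (P : Polynomial ℂ) :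
    smoothMode γ s (Polynomial.C a * P) = a • smoothMode γ s P := by
  refine Subtype.ext (funext fun x => ?_)
  change modeSum γ s (Polynomial.C a * P) x = a * modeSum γ s P x
  simp only [modeSum, ← tsum_mul_left]
  exact tsum_congr fun m => by rw [mode_C_mul]; ring

/-- On polynomials `lowering` is i times differentiation: the terms inX and i(-nX) cancel. -/
lemma lowering_smoothMode_one (γ : GaugePhase τ n) (s : ZMod n → ℂ) :
    lowering (smoothCov γ) (smoothMode γ s 1) = 0 := by
  rw [lowering_apply, smoothCov_smoothMode, smoothCov_smoothMode, ← smoothMode_C_mul,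
    ← smoothMode_add]
  have : polyCov n 0 1 + Polynomial.C Complex.I * polyCov n 1 1 = Polynomial.C 0 * 1 := by
    simp [polyCov]
    ring
  rw [this, smoothMode_C_mul, zero_smul]

end Modes

section FourierUniqueness

/-! ### Uniqueness of Fourier transforms, Fourier series and moments -/

open scoped FourierTransform in
-- Every test function is the Fourier transform of a Schwartz function. The multiplication formula
-- moves the transform to w, so w integrates to zero against all test functions.
lemma ae_eq_zero_of_fourier_eq_zero {w : ℝ → ℂ} (hw : Integrable w) (h : ∀ ξ, 𝓕 w ξ = 0) :
    w =ᵐ[volume] 0 := by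
  refine ae_eq_zero_of_integral_contDiff_smul_eq_zero hw.locallyIntegrable fun φ h1 h2 => ?_
  have h1' : ContDiff ℝ ∞ fun x => (φ x : ℂ) := Complex.ofRealCLM.contDiff.comp h1
  have h2' : HasCompactSupport fun x => (φ x : ℂ) := h2.comp_left (g := ((↑) : ℝ → ℂ)) rfl
  let ψ : SchwartzMap ℝ ℂ := h2'.toSchwartzMap h1'
  let χ : SchwartzMap ℝ ℂ := 𝓕⁻ ψ
  have e1 : 𝓕 (χ : ℝ → ℂ) = fun x => (φ x : ℂ) := by
    rw [← SchwartzMap.fourier_coe]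
    simp only [χ, FourierTransform.fourier_fourierInv_eq]
    rfl
  have key := VectorFourier.integral_fourierIntegral_smul_eq_flip (L := innerₗ ℝ)
    (μ := (volume : Measure ℝ)) (ν := (volume : Measure ℝ)) Real.continuous_fourierChar
    continuous_inner χ.integrable hw
  have e2 : ∀ x, VectorFourier.fourierIntegral Real.fourierChar volume (innerₗ ℝ) (χ : ℝ → ℂ) x =
      (φ x : ℂ) := fun x => congrFun e1 x
  have e3 : ∀ x, VectorFourier.fourierIntegral Real.fourierChar volume (innerₗ ℝ).flip w x = 0 := by
    intro x
    rw [flip_innerₗ]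
    exact h x
  simp only [e2, e3, smul_zero, integral_zero] at key
  simpa [Complex.real_smul] using key

/-- Parseval: the integral of |f|² is the sum of the squared coefficients. -/
lemma ae_eq_zero_of_fourierCoeff_eq_zero {f : ℝ → ℂ}
    (hf : MemLp f 2 (volume.restrict (Set.Ioc (0 : ℝ) 1)))
    (h : ∀ m : ℤ, ∫ p in Set.Ioc (0 : ℝ) 1,
      Complex.exp (-(2 * Real.pi * Complex.I * m * p)) * f p = 0) :
    f =ᵐ[volume.restrict (Set.Ioc (0 : ℝ) 1)] 0 := by
  have h1 := hasSum_sq_fourierCoeffOn zero_lt_one hf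
  have h2 : ∀ m, fourierCoeffOn zero_lt_one f m = 0 := by
    intro m
    rw [fourierCoeffOn_eq_integral, intervalIntegral.integral_of_le zero_le_one]
    simp only [sub_zero, fourier_coe_apply, smul_eq_mul]
    rw [← h m]
    simp only [div_one, one_smul, Int.cast_neg]
    congr 1
    ext p
    congr 2
    push_cast
    ring
  simp only [h2, norm_zero, ne_eq, OfNat.ofNat_ne_zero, not_false_eq_true, zero_pow, sub_zero,
    inv_one, one_smul] at h1
  have h3 := hasSum_zero.unique h1
  rw [intervalIntegral.integral_of_le zero_le_one] at h3
  have h4 := (integral_eq_zero_iff_of_nonneg (fun p => by positivity)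
    ((memLp_two_iff_integrable_sq_norm hf.1).1 hf)).1 h3.symm
  filter_upwards [h4] with p hp
  simpa using hp

/-- The Fourier kernel is expanded in powers of q and integrated term by term. The absolute series
sums to e^{c|q|} |w|, which is integrable by assumption, so the Fourier transform of w vanishes. -/
lemma ae_eq_zero_of_moments_eq_zero {w : ℝ → ℂ}
    (hw : ∀ c : ℝ, Integrable fun q => (Real.exp (c * |q|) : ℂ) * w q)
    (h : ∀ k : ℕ, ∫ q : ℝ, ((q : ℂ) ^ k) * w q = 0) : w =ᵐ[volume] 0 := by
  have hw0 : Integrable w := by simpa using hw 0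
  refine ae_eq_zero_of_fourier_eq_zero hw0 fun ξ => ?_
  rw [Real.fourier_eq']
  set c : ℝ := 2 * Real.pi * |ξ|
  have key := hasSum_integral_of_dominated_convergence (μ := (volume : Measure ℝ))
    (F := fun (k : ℕ) q => ((-(2 * Real.pi * ξ) * Complex.I * q) ^ k / k.factorial) * w q)
    (f := fun q => Complex.exp (-(2 * Real.pi * ξ) * Complex.I * q) * w q)
    (fun k q => (c * |q|) ^ k / k.factorial * ‖w q‖)
    (fun k => by
      refine AEStronglyMeasurable.mul (Continuous.aestronglyMeasurable ?_) hw0.1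
      fun_prop)
    (fun k => .of_forall fun q => by
      rw [norm_mul, norm_div, norm_pow]
      have : ‖(-(2 * Real.pi * ξ) * Complex.I * q : ℂ)‖ = c * |q| := by
        simp [c, abs_of_pos Real.pi_pos]
      rw [this]
      simp)
    (.of_forall fun q => (Real.summable_pow_div_factorial _).mul_right _)
    (by
      have h1 := (hw c).norm
      refine h1.congr (.of_forall fun q => ?_)
      have h2 := (NormedSpace.expSeries_div_hasSum_exp (c * |q|)).mul_right ‖w q‖
      rw [← Real.exp_eq_exp_ℝ] at h2
      simp only [h2.tsum_eq]
      rw [norm_mul, Complex.norm_real, Real.norm_of_nonneg (Real.exp_nonneg _)])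
    (.of_forall fun q => by
      have h2 := (NormedSpace.expSeries_div_hasSum_exp
        (-(2 * Real.pi * ξ) * Complex.I * q : ℂ)).mul_right (w q)
      rwa [← Complex.exp_eq_exp_ℂ] at h2)
  have hz : ∀ k : ℕ, ∫ q : ℝ, ((-(2 * Real.pi * ξ) * Complex.I * q : ℂ) ^ k / k.factorial) * w q = 0 := by
    intro k
    have : ∀ q : ℝ, ((-(2 * Real.pi * ξ) * Complex.I * q : ℂ) ^ k / k.factorial) * w q =
        ((-(2 * Real.pi * ξ) * Complex.I) ^ k / k.factorial) * ((q : ℂ) ^ k * w q) := fun q => by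
      rw [mul_pow]; ring
    simp only [this]
    rw [integral_const_mul, h k, mul_zero]
  simp only [hz] at key
  rw [hasSum_zero.unique key]
  refine integral_congr_ae (.of_forall fun q => ?_)
  simp only [smul_eq_mul, RCLike.inner_apply, conj_trivial]
  congr 2
  push_cast
  ring

lemma ae_eq_zero_of_fourierCoeff_Ico_eq_zero {f : ℝ → ℂ}
    (hf : MemLp f 2 (volume.restrict (Set.Ico (0 : ℝ) 1)))
    (h : ∀ m : ℤ, ∫ p in Set.Ico (0 : ℝ) 1,
      Complex.exp (-(2 * Real.pi * Complex.I * m * p)) * f p = 0) :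
    f =ᵐ[volume.restrict (Set.Ico (0 : ℝ) 1)] 0 := by
  rw [restrict_Ico_eq_restrict_Ioc] at hf h ⊢
  exact ae_eq_zero_of_fourierCoeff_eq_zero hf h

end FourierUniqueness

section Strip

/-! ### Lattice coordinates and integration over strips -/

/-- The coordinates `(q, p) ↦ √(2π / Im τ) (p + q τ)`. -/
def ptEquiv (τ : ℍ) : (ℝ × ℝ) ≃L[ℝ] ℂ :=
  LinearEquiv.toContinuousLinearEquiv
    { toFun := fun z => pt τ z.2 z.1
      map_add' := fun z w => pt_add τ _ _ _ _
      map_smul' := fun c z => by simp [pt]; ring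
      invFun := fun x => (coordQ τ x, coordP τ x)
      left_inv := fun z => Prod.ext (coordQ_pt τ _ _) (coordP_pt τ _ _)
      right_inv := fun x => pt_coord τ x }

lemma ptEquiv_apply (τ : ℍ) (z : ℝ × ℝ) : ptEquiv τ z = pt τ z.2 z.1 := rfl

/-- Uniqueness of Haar measure. The constant is left unspecified, since only integrability, null
sets and vanishing of integrals are transported. -/
lemma exists_map_volume {E F : Type*} [NormedAddCommGroup E] [NormedSpace ℝ E] [MeasureSpace E]
    [BorelSpace E] [NormedAddCommGroup F] [NormedSpace ℝ F]
    [MeasureSpace F] [BorelSpace F] [FiniteDimensional ℝ F]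
    [(volume : Measure E).IsAddHaarMeasure] [(volume : Measure F).IsAddHaarMeasure]
    (L : E ≃L[ℝ] F) :
    ∃ c : ENNReal, c ≠ ⊤ ∧ (volume : Measure E).map L = c • (volume : Measure F) := by
  have : ((volume : Measure E).map L).IsAddHaarMeasure := L.isAddHaarMeasure_map _
  exact ⟨_, ENNReal.coe_ne_top, Measure.isAddLeftInvariant_eq_smul _ _⟩

lemma quasiMeasurePreserving_clequiv {E F : Type*} [NormedAddCommGroup E] [NormedSpace ℝ E]
    [MeasureSpace E] [BorelSpace E] [NormedAddCommGroup F] [NormedSpace ℝ F] [MeasureSpace F]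
    [BorelSpace F] [FiniteDimensional ℝ F] [(volume : Measure E).IsAddHaarMeasure]
    [(volume : Measure F).IsAddHaarMeasure] (L : E ≃L[ℝ] F) :
    Measure.QuasiMeasurePreserving L volume volume := by
  obtain ⟨c, -, h⟩ := exists_map_volume L
  exact ⟨L.continuous.measurable, h ▸ Measure.smul_absolutelyContinuous⟩

/-- The infinite strip. -/
def strip : Set (ℝ × ℝ) := Set.univ ×ˢ Set.Ico 0 1

/-- The unit squares of the strip. -/
def stripSquare (k : ℤ) : Set (ℝ × ℝ) := Set.Ico (k : ℝ) (k + 1) ×ˢ Set.Ico 0 1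

lemma iUnion_stripSquare : ⋃ k, stripSquare k = strip := by
  ext ⟨q, p⟩
  simp only [stripSquare, strip, Set.mem_iUnion, Set.mem_prod, Set.mem_univ, true_and]
  exact ⟨fun ⟨_, _, h⟩ => h, fun h => ⟨⌊q⌋, ⟨Int.floor_le q, Int.lt_floor_add_one q⟩, h⟩⟩

lemma measurableSet_stripSquare (k : ℤ) : MeasurableSet (stripSquare k) :=
  measurableSet_Ico.prod measurableSet_Ico

lemma pairwise_disjoint_stripSquare : Pairwise (Function.onFun Disjoint stripSquare) := by
  intro k l hkl
  rw [Function.onFun, Set.disjoint_left]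
  rintro ⟨q, p⟩ ⟨⟨h1, h2⟩, -⟩ ⟨⟨h3, h4⟩, -⟩
  apply hkl
  have e1 := Int.floor_eq_iff.2 ⟨h1, h2⟩
  have e2 := Int.floor_eq_iff.2 ⟨h3, h4⟩
  exact e1.symm.trans e2

lemma preimage_add_stripSquare (k : ℤ) :
    (fun z : ℝ × ℝ => z + ((k : ℝ), 0)) ⁻¹' stripSquare k = stripSquare 0 := by
  ext ⟨q, p⟩
  simp only [stripSquare, Set.mem_preimage, Prod.mk_add_mk, add_zero, Set.mem_prod, Set.mem_Ico,
    Int.cast_zero, zero_add, le_add_iff_nonneg_right, add_comm q, add_lt_add_iff_left]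

lemma setIntegral_stripSquare {E : Type*} [NormedAddCommGroup E] [NormedSpace ℝ E]
    (F : ℝ × ℝ → E) (k : ℤ) :
    ∫ z in stripSquare k, F z = ∫ z in stripSquare 0, F (z + ((k : ℝ), 0)) := by
  rw [← preimage_add_stripSquare k]
  exact ((measurePreserving_add_right (volume : Measure (ℝ × ℝ)) ((k : ℝ), (0 : ℝ))
    ).setIntegral_preimage_emb (Homeomorph.addRight ((k : ℝ), (0 : ℝ))).measurableEmbedding _ _).symm

lemma setLIntegral_stripSquare (F : ℝ × ℝ → ENNReal) (k : ℤ) :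
    ∫⁻ z in stripSquare k, F z = ∫⁻ z in stripSquare 0, F (z + ((k : ℝ), 0)) := by
  rw [← preimage_add_stripSquare k]
  exact ((measurePreserving_add_right (volume : Measure (ℝ × ℝ)) ((k : ℝ), (0 : ℝ))
    ).setLIntegral_comp_preimage_emb
      (Homeomorph.addRight ((k : ℝ), (0 : ℝ))).measurableEmbedding _ _).symm

lemma integrableOn_stripSquare_add {F : ℝ × ℝ → ℂ} (hF : IntegrableOn F strip) (k : ℤ) :
    IntegrableOn (fun z => F (z + ((k : ℝ), 0))) (stripSquare 0) := by
  rw [← preimage_add_stripSquare k]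
  refine ((measurePreserving_add_right (volume : Measure (ℝ × ℝ)) ((k : ℝ), (0 : ℝ))
    ).integrableOn_comp_preimage
      (Homeomorph.addRight ((k : ℝ), (0 : ℝ))).measurableEmbedding).2 (hF.mono_set ?_)
  rw [← iUnion_stripSquare]
  exact Set.subset_iUnion _ k

/-- Unfolding of an integral over the strip. -/
lemma integral_strip_eq {F : ℝ × ℝ → ℂ} (hF : IntegrableOn F strip) :
    ∫ z in strip, F z = ∫ z in stripSquare 0, ∑' k : ℤ, F (z + ((k : ℝ), 0)) := by
  have h1 := hasSum_integral_iUnion measurableSet_stripSquare pairwise_disjoint_stripSquare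
    (f := F) (by rwa [iUnion_stripSquare])
  have h2 := hasSum_integral_iUnion measurableSet_stripSquare pairwise_disjoint_stripSquare
    (f := fun z => ‖F z‖) (by rw [iUnion_stripSquare]; exact hF.norm)
  rw [iUnion_stripSquare] at h1 h2
  rw [funext fun k => setIntegral_stripSquare F k] at h1
  rw [funext fun k => setIntegral_stripSquare (fun z => ‖F z‖) k] at h2
  exact h1.unique (hasSum_integral_of_summable_integral_norm
    (fun k => integrableOn_stripSquare_add hF k) h2.summable)

lemma integrableOn_strip_mul {v G : ℝ × ℝ → ℂ} (hv : IntegrableOn v (stripSquare 0))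
    (hm : AEStronglyMeasurable v volume)
    (hp : ∀ k : ℤ, ∀ᵐ z, ‖v (z + ((k : ℝ), 0))‖ₑ = ‖v z‖ₑ) (hG : Continuous G) {C : ℝ} (hC : 0 ≤ C)
    (hb : ∀ z, ‖G z‖ ≤ C * Real.exp (-|z.1|)) : IntegrableOn (fun z => G z * v z) strip := by
  refine ⟨(hG.aestronglyMeasurable.mul hm).restrict, ?_⟩
  rw [hasFiniteIntegral_iff_enorm, ← iUnion_stripSquare,
    lintegral_iUnion measurableSet_stripSquare pairwise_disjoint_stripSquare]
  -- On the base square q lies in [0, 1), so |k| ≤ |q + k| + 1; the factor e absorbs this 1.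
  have hle : ∀ k : ℤ, ∫⁻ z in stripSquare k, ‖G z * v z‖ₑ ≤
      ENNReal.ofReal (C * Real.exp 1 * Real.exp (-(1 * |(k : ℝ)|))) *
        ∫⁻ z in stripSquare 0, ‖v z‖ₑ := by
    intro k
    rw [setLIntegral_stripSquare, ← lintegral_const_mul' _ _ ENNReal.ofReal_ne_top]
    refine lintegral_mono_ae ?_
    filter_upwards [ae_restrict_of_ae (hp k), ae_restrict_mem (measurableSet_stripSquare 0)]
      with z hz hz0
    rw [enorm_mul, hz]
    gcongr
    rw [← ofReal_norm]
    refine ENNReal.ofReal_le_ofReal ((hb _).trans ?_)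
    rw [mul_assoc, ← Real.exp_add]
    gcongr
    obtain ⟨⟨h1, h2⟩, -⟩ := hz0
    simp only [Int.cast_zero, zero_add] at h1 h2
    have h3 : |(k : ℝ)| ≤ |z.1 + k| + |z.1| := by
      have : (k : ℝ) = (z.1 + k) - z.1 := by ring
      conv_lhs => rw [this]
      exact abs_sub _ _
    rw [abs_of_nonneg h1] at h3
    simp only [Prod.fst_add]
    linarith
  refine (ENNReal.tsum_le_tsum hle).trans_lt ?_
  rw [ENNReal.tsum_mul_right]
  refine ENNReal.mul_lt_top ?_ hv.2
  exact ((summable_exp_neg_abs one_pos).mul_left _).tsum_ofReal_lt_top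

end Strip

section Completeness

variable {τ : ℍ} {n : ℕ} [NeZero n]

/-! ### Completeness of the modes -/

/-- The integers k for which the law holds form a subgroup of ℤ, which contains 1 by
`mode_add_zero_one`. -/
lemma mode_add_zero_int (γ : GaugePhase τ n) (P : Polynomial ℂ) (k m : ℤ) (x : ℂ) :
    mode γ P m (x + (latticePt τ 0 k : ℂ)) =
      gaugeFactor γ (latticePt τ 0 k) x * mode γ P (m + k * n) x := by
  have hadd : ∀ k l : ℤ, latticePt τ 0 (k + l) = latticePt τ 0 k + latticePt τ 0 l := by
    intro k l
    apply Subtype.ext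
    simp [latticePt, pt]
    ring
  have h0 : latticePt τ 0 0 = 0 := Subtype.ext (by simp [latticePt, pt])
  let G : AddSubgroup ℤ :=
    { carrier := {k | ∀ m x, mode γ P m (x + (latticePt τ 0 k : ℂ)) =
        gaugeFactor γ (latticePt τ 0 k) x * mode γ P (m + k * n) x}
      zero_mem' := fun m x => by simp [h0, gaugeFactor_zero]
      add_mem' := fun {k l} hk hl m x => by
        have : x + ((latticePt τ 0 (k + l) : lattice τ) : ℂ) =
            x + latticePt τ 0 k + latticePt τ 0 l := by rw [hadd]; push_cast; ring
        rw [this, hl, hk, hadd, gaugeFactor_add, add_mul, ← add_assoc, add_right_comm]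
        ring
      neg_mem' := fun {k} hk m x => by
        have h := hk (m + -k * n) (x + (latticePt τ 0 (-k) : ℂ))
        have e : x + (latticePt τ 0 (-k) : ℂ) + (latticePt τ 0 k : ℂ) = x := by
          have := congrArg (Subtype.val) (hadd (-k) k)
          rw [neg_add_cancel, h0] at this
          push_cast at this
          rw [add_assoc, ← this]
          simp
        have g := gaugeFactor_add γ (latticePt τ 0 (-k)) (latticePt τ 0 k) x
        rw [← hadd, neg_add_cancel, h0, gaugeFactor_zero] at g
        have e2 : m + -k * n + k * n = m := by ring
        rw [e, e2] at h
        rw [h]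
        linear_combination (mode γ P m (x + (latticePt τ 0 (-k) : ℂ))) * g }
  have h1 : (1 : ℤ) ∈ G := fun m x => by simpa using mode_add_zero_one γ P m x
  have hk : k ∈ G := by simpa using G.zsmul_mem h1 k
  exact hk m x

lemma exists_gaussian_bound_affine (P : Polynomial ℂ) {a : ℝ} (ha : a ≠ 0) (b : ℝ) {c : ℝ}
    (hc : 0 ≤ c) : ∃ C : ℝ, 0 ≤ C ∧ ∀ q : ℝ,
      Real.exp (-((n : ℝ) / 2 * (a * q + b) ^ 2)) * ‖P.eval ((a * q + b : ℝ) : ℂ)‖ ≤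
        C * Real.exp (-(c * |q|)) := by
  obtain ⟨C, hC, h⟩ := exists_gaussian_bound (NeZero.pos n) P (c / |a|)
  have ha' : 0 < |a| := abs_pos.2 ha
  refine ⟨C * Real.exp (c / |a| * |b|), by positivity, fun q => (h _).trans ?_⟩
  rw [mul_assoc, ← Real.exp_add]
  refine mul_le_mul_of_nonneg_left (Real.exp_le_exp.2 ?_) hC
  have h1 : |a| * |q| ≤ |a * q + b| + |b| := by
    rw [← abs_mul]
    have : a * q = (a * q + b) - b := by ring
    conv_lhs => rw [this]
    exact abs_sub _ _
  have h2 : c * |q| = c / |a| * (|a| * |q|) := by field_simp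
  rw [h2]
  have h3 := mul_le_mul_of_nonneg_left h1 (show 0 ≤ c / |a| by positivity)
  linarith

lemma modeSum_single (γ : GaugePhase τ n) (P : Polynomial ℂ) (m : ℤ) (x : ℂ) :
    modeSum γ (Pi.single (m : ZMod n) 1) P x = ∑' k : ℤ, mode γ P (m + k * n) x := by
  have hinj : Function.Injective fun k : ℤ => m + k * n := by
    intro k l h
    have hn : (n : ℤ) ≠ 0 := by exact_mod_cast NeZero.ne n
    exact mul_right_cancel₀ hn (add_left_cancel h)
  rw [modeSum, ← hinj.tsum_eq]
  · refine tsum_congr fun k => ?_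
    simp
  · intro l hl
    by_contra hc
    apply hl
    have : (l : ZMod n) ≠ m := by
      intro h
      rw [ZMod.intCast_eq_intCast_iff_dvd_sub] at h
      obtain ⟨k, hk⟩ := h
      exact hc ⟨-k, by simp only; linear_combination hk⟩
    simp [Pi.single_eq_of_ne this]

end Completeness

/-! ### Totality of the modes, in lattice coordinates -/

section Completeness

variable {τ : ℍ} {n : ℕ}

lemma preimage_ptEquiv_cell (τ : ℍ) : ptEquiv τ ⁻¹' cell τ = stripSquare 0 := by
  ext ⟨q, p⟩
  rw [Set.mem_preimage, ptEquiv_apply, mem_cell_iff, coordP_pt, coordQ_pt]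
  simp [stripSquare, and_comm]

lemma map_restrict_ptEquiv (τ : ℍ) : ∃ c : ENNReal, c ≠ ⊤ ∧
    (volume.restrict (stripSquare 0)).map (ptEquiv τ) = c • volume.restrict (cell τ) := by
  obtain ⟨c, hc, h⟩ := exists_map_volume (ptEquiv τ)
  refine ⟨c, hc, ?_⟩
  rw [← preimage_ptEquiv_cell τ, ← Measure.restrict_map (ptEquiv τ).continuous.measurable
    (measurableSet_cell τ), h, Measure.restrict_smul]

lemma memLp_comp_ptEquiv {f : ℂ → ℂ} (hf : MemLp f 2 (volume.restrict (cell τ))) :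
    MemLp (fun z => f (ptEquiv τ z)) 2 (volume.restrict (stripSquare 0)) := by
  obtain ⟨c, hc, h⟩ := map_restrict_ptEquiv τ
  have h1 := hf.smul_measure hc
  rw [← h] at h1
  exact (((ptEquiv τ).toHomeomorph.measurableEmbedding).memLp_map_measure_iff).1 h1

lemma setIntegral_comp_ptEquiv_eq_zero {f : ℂ → ℂ} (hf : ∫ x in cell τ, f x = 0) :
    ∫ z in stripSquare 0, f (ptEquiv τ z) = 0 := by
  obtain ⟨c, hc, h⟩ := map_restrict_ptEquiv τ
  have h1 := ((ptEquiv τ).toHomeomorph.measurableEmbedding).integral_map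
    (μ := volume.restrict (stripSquare 0)) f
  refine h1.symm.trans ?_
  change ∫ x, f x ∂(Measure.map (ptEquiv τ) _) = 0
  rw [h, integral_smul_measure, hf, smul_zero]

lemma ptEquiv_add (τ : ℍ) (z : ℝ × ℝ) (k : ℤ) :
    ptEquiv τ (z + ((k : ℝ), 0)) = ptEquiv τ z + (latticePt τ 0 k : ℂ) := by
  rw [map_add]
  simp [ptEquiv_apply, latticePt]

lemma modeY_ptEquiv (γ : GaugePhase τ n) (m : ℤ) (z : ℝ × ℝ) :
    modeY γ m (ptEquiv τ z) = scale τ * τ.im * z.1 + kappa γ m / n := by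
  rw [modeY, ptEquiv_apply, pt_im]
  ring

/-- The unimodular factor common to all modes. -/
def modeTwist (γ : GaugePhase τ n) (p q : ℝ) : ℂ :=
  Complex.exp (Complex.I * ((n : ℝ) / 2 * (pt τ p q).re * (pt τ p q).im +
    γ.c (latticePt τ 1 0) * p : ℝ))

lemma norm_modeTwist (γ : GaugePhase τ n) (p q : ℝ) : ‖modeTwist γ p q‖ = 1 := by
  rw [modeTwist, mul_comm, Complex.norm_exp_ofReal_mul_I]

lemma continuous_modeTwist (γ : GaugePhase τ n) (q : ℝ) : Continuous fun p => modeTwist γ p q := by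
  simp only [modeTwist, pt_re, pt_im]
  fun_prop

/-- On a line q = const a mode is a Fourier character in p times a factor common to all m, so
pairing with modes computes Fourier coefficients. -/
lemma exists_mode_one_eq (γ : GaugePhase τ n) (m : ℤ) (q : ℝ) : ∃ K : ℂ, K ≠ 0 ∧ ∀ p,
    mode γ 1 m (pt τ p q) =
      K * (Complex.exp (2 * Real.pi * Complex.I * m * p) * modeTwist γ p q) := by
  have hr := (scale_pos τ).ne'
  refine ⟨Complex.exp (Complex.I * (kappa γ m * scale τ * (q * τ.re) + modePhase γ m : ℝ) -
    ((n : ℝ) / 2 * modeY γ m (pt τ 0 q) ^ 2 : ℝ)), Complex.exp_ne_zero _, fun p => ?_⟩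
  have hy : modeY γ m (pt τ p q) = modeY γ m (pt τ 0 q) := by simp only [modeY, pt_im]
  rw [mode, modeTwist, hy, Polynomial.eval_one, mul_one, ← Complex.exp_add, ← Complex.exp_add]
  congr 1
  have hκ : kappa γ m * scale τ = 2 * Real.pi * m + γ.c (latticePt τ 1 0) := by
    rw [kappa]; field_simp
  have : (n : ℝ) / 2 * (pt τ p q).re * (pt τ p q).im + kappa γ m * (pt τ p q).re + modePhase γ m =
      (kappa γ m * scale τ * (q * τ.re) + modePhase γ m) + 2 * Real.pi * m * p +
      ((n : ℝ) / 2 * (pt τ p q).re * (pt τ p q).im + γ.c (latticePt τ 1 0) * p) := by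
    have : kappa γ m * (pt τ p q).re = kappa γ m * scale τ * p + kappa γ m * scale τ * (q * τ.re) := by
      rw [pt_re]; ring
    rw [this, hκ]
    ring
  rw [this]
  push_cast
  ring

lemma ae_add_comp_ptEquiv {γ : GaugePhase τ n} (u : GaugeL2 γ) (k : ℤ) :
    ∀ᵐ z, u.1 (ptEquiv τ (z + ((k : ℝ), 0))) =
      gaugeFactor γ (latticePt τ 0 k) (ptEquiv τ z) * u.1 (ptEquiv τ z) := by
  filter_upwards [(quasiMeasurePreserving_clequiv (ptEquiv τ)).ae (u.2.1 (latticePt τ 0 k))]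
    with z hz
  rw [ptEquiv_add, hz]

variable [NeZero n]

lemma continuous_mode (γ : GaugePhase τ n) (P : Polynomial ℂ) (m : ℤ) : Continuous (mode γ P m) :=
  continuous_iff_continuousAt.2 fun x => (hasFDerivAt_mode γ (NeZero.pos n) P m x).continuousAt

/-- The weight e^{c|q|} provides the exponential moments required by
`ae_eq_zero_of_moments_eq_zero`; the Gaussian dominates it. -/
lemma integrableOn_strip_mode {γ : GaugePhase τ n} (u : GaugeL2 γ) (P : Polynomial ℂ) (m : ℤ)
    (c : ℝ) : IntegrableOn (fun z => (Real.exp (c * |z.1|) : ℂ) * conj (mode γ P m (ptEquiv τ z)) *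
      u.1 (ptEquiv τ z)) strip := by
  have ha : scale τ * τ.im ≠ 0 := (mul_pos (scale_pos τ) τ.im_pos).ne'
  obtain ⟨C, hC, h⟩ := exists_gaussian_bound_affine (n := n) P ha (kappa γ m / n)
    (show 0 ≤ |c| + 1 by positivity)
  have hfin : IsFiniteMeasure ((volume : Measure (ℝ × ℝ)).restrict (stripSquare 0)) := by
    constructor
    rw [Measure.restrict_apply_univ, stripSquare, Measure.volume_eq_prod, Measure.prod_prod]
    simp
  refine integrableOn_strip_mul (v := fun z => u.1 (ptEquiv τ z))
    ((memLp_comp_ptEquiv u.2.2).integrable (by norm_num)) ?_ (fun k => ?_) ?_ hC fun z => ?_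
  · exact u.1.aestronglyMeasurable.comp_quasiMeasurePreserving
      (quasiMeasurePreserving_clequiv (ptEquiv τ))
  · filter_upwards [ae_add_comp_ptEquiv u k] with z hz
    rw [hz, enorm_mul, ← ofReal_norm (gaugeFactor _ _ _), norm_gaugeFactor, ENNReal.ofReal_one,
      one_mul]
  · have := (continuous_mode γ P m).comp (ptEquiv τ).continuous
    exact (by fun_prop : Continuous fun z : ℝ × ℝ => (Real.exp (c * |z.1|) : ℂ)).mul
      (Complex.continuous_conj.comp this)
  · rw [norm_mul, RCLike.norm_conj, norm_mode, modeY_ptEquiv, Complex.norm_real, Real.norm_eq_abs,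
      Real.abs_exp]
    refine (mul_le_mul_of_nonneg_left (h z.1) (Real.exp_nonneg _)).trans ?_
    rw [mul_left_comm, ← Real.exp_add]
    gcongr
    have := mul_le_mul_of_nonneg_right (le_abs_self c) (abs_nonneg z.1)
    linarith

/-- The weight concentrated at one residue class gives the sum over m + kn. Translation by k steps
of rτ carries these terms to one mode on successive squares of the strip, the gauge factors of u and
of the mode cancelling because they are unimodular. -/
lemma integral_strip_mode_eq_zero {γ : GaugePhase τ n} {u : GaugeL2 γ}
    (hu : ∀ s P, inner ℂ (smoothToL2 γ (smoothMode γ s P)) u = 0) (P : Polynomial ℂ) (m : ℤ) :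
    ∫ z in strip, conj (mode γ P m (ptEquiv τ z)) * u.1 (ptEquiv τ z) = 0 := by
  have hi := integrableOn_strip_mode u P m 0
  simp only [zero_mul, Real.exp_zero, Complex.ofReal_one, one_mul] at hi
  rw [integral_strip_eq hi]
  have h := hu (Pi.single (m : ZMod n) 1) P
  rw [inner_eq_integral] at h
  have h' : ∫ x in cell τ, conj (modeSum γ (Pi.single (m : ZMod n) 1) P x) * u.1 x = 0 := by
    rw [← h]
    refine integral_congr_ae ?_
    filter_upwards [ae_restrict_of_ae
      (coeFn_smoothToL2 (smoothMode γ (Pi.single (m : ZMod n) 1) P))] with x hx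
    rw [hx]
    rfl
  rw [← setIntegral_comp_ptEquiv_eq_zero h']
  refine integral_congr_ae ?_
  filter_upwards [ae_restrict_of_ae (ae_all_iff.2 fun k => ae_add_comp_ptEquiv u k)] with z hz
  rw [modeSum_single, Complex.conj_tsum, ← tsum_mul_right]
  refine tsum_congr fun k => ?_
  rw [hz k, ptEquiv_add, mode_add_zero_int, map_mul]
  have h1 : conj (gaugeFactor γ (latticePt τ 0 k) (ptEquiv τ z)) *
      gaugeFactor γ (latticePt τ 0 k) (ptEquiv τ z) = 1 := by
    rw [← Complex.normSq_eq_conj_mul_self, Complex.normSq_eq_norm_sq, norm_gaugeFactor]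
    simp
  linear_combination (conj (mode γ P (m + k * n) (ptEquiv τ z)) * u.1 (ptEquiv τ z)) * h1

lemma restrict_strip : (volume : Measure (ℝ × ℝ)).restrict strip =
    (volume : Measure ℝ).prod (volume.restrict (Set.Ico 0 1)) := by
  rw [strip, Measure.volume_eq_prod, ← Measure.prod_restrict, Measure.restrict_univ]

/-- The components of a gauge-periodic function along the modes vanish. -/
lemma ae_integral_mode_eq_zero {γ : GaugePhase τ n} {u : GaugeL2 γ}
    (hu : ∀ s P, inner ℂ (smoothToL2 γ (smoothMode γ s P)) u = 0) (m : ℤ) :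
    ∀ᵐ q : ℝ, ∫ p in Set.Ico (0 : ℝ) 1, conj (mode γ 1 m (pt τ p q)) * u.1 (pt τ p q) = 0 := by
  have ha : scale τ * τ.im ≠ 0 := (mul_pos (scale_pos τ) τ.im_pos).ne'
  refine ae_eq_zero_of_moments_eq_zero (fun c => ?_) fun k => ?_
  · have h := integrableOn_strip_mode u 1 m c
    rw [IntegrableOn, restrict_strip] at h
    refine h.integral_prod_left.congr (.of_forall fun q => ?_)
    simp only [mul_assoc, integral_const_mul]
    rfl
  -- Inverting the affine relation between `modeY` and q gives a polynomial whose value on the mode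
  -- is q^k.
  · set P : Polynomial ℂ := (Polynomial.C ((scale τ * τ.im : ℝ) : ℂ)⁻¹ *
      (Polynomial.X - Polynomial.C ((kappa γ m / n : ℝ) : ℂ))) ^ k
    have hP : ∀ z : ℝ × ℝ, conj (mode γ P m (ptEquiv τ z)) =
        (z.1 : ℂ) ^ k * conj (mode γ 1 m (ptEquiv τ z)) := by
      intro z
      have : P.eval (modeY γ m (ptEquiv τ z) : ℂ) = (z.1 : ℂ) ^ k := by
        rw [modeY_ptEquiv]
        simp only [P, Polynomial.eval_pow, Polynomial.eval_mul, Polynomial.eval_C,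
          Polynomial.eval_sub, Polynomial.eval_X]
        congr 1
        have : ((scale τ * τ.im : ℝ) : ℂ) ≠ 0 := Complex.ofReal_ne_zero.2 ha
        rw [← Complex.ofReal_sub, add_sub_cancel_right, Complex.ofReal_mul (scale τ * τ.im),
          inv_mul_cancel_left₀ this]
      rw [mode, mode, this, map_mul, map_mul, map_pow, Complex.conj_ofReal]
      simp
      ring
    have h := integrableOn_strip_mode u P m 0
    have h0 := integral_strip_mode_eq_zero hu P m
    simp only [zero_mul, Real.exp_zero, Complex.ofReal_one, one_mul] at h
    rw [IntegrableOn, restrict_strip] at h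
    rw [restrict_strip, integral_prod _ h] at h0
    rw [← h0]
    congr 1
    funext q
    rw [← integral_const_mul]
    congr 1
    funext p
    rw [hP]
    simp only [ptEquiv_apply, mul_assoc]

lemma restrict_stripSquare_zero : (volume : Measure (ℝ × ℝ)).restrict (stripSquare 0) =
    (volume.restrict (Set.Ico (0 : ℝ) 1)).prod (volume.restrict (Set.Ico 0 1)) := by
  rw [stripSquare, Measure.volume_eq_prod, ← Measure.prod_restrict]
  simp

/-- The sums of modes are total. -/
lemma eq_zero_of_inner_smoothMode {γ : GaugePhase τ n} {u : GaugeL2 γ}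
    (hu : ∀ s P, inner ℂ (smoothToL2 γ (smoothMode γ s P)) u = 0) : u = 0 := by
  have hL := memLp_comp_ptEquiv u.2.2
  have hm := hL.1
  have hsq := hL.integrable_norm_pow (by norm_num)
  rw [restrict_stripSquare_zero] at hm hsq
  have h1 : ∀ᵐ q ∂(volume.restrict (Set.Ico (0 : ℝ) 1)),
      (fun p => u.1 (pt τ p q)) =ᵐ[volume.restrict (Set.Ico (0 : ℝ) 1)] 0 := by
    filter_upwards [hm.prodMk_left, hsq.prod_right_ae,
      ae_restrict_of_ae (ae_all_iff.2 fun m => ae_integral_mode_eq_zero hu m)] with q hq1 hq2 hq3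
    have hL2 : MemLp (fun p => u.1 (pt τ p q)) 2 (volume.restrict (Set.Ico (0 : ℝ) 1)) :=
      (memLp_two_iff_integrable_sq_norm hq1).2 hq2
    -- Removing the factor common to all modes leaves the pure Fourier characters; it is unimodular,
    -- so square integrability persists.
    have hf : MemLp (fun p => conj (modeTwist γ p q) * u.1 (pt τ p q)) 2
        (volume.restrict (Set.Ico (0 : ℝ) 1)) := by
      refine hL2.congr_norm ((Complex.continuous_conj.comp
        (continuous_modeTwist γ q)).aestronglyMeasurable.mul hL2.1) (.of_forall fun p => ?_)
      rw [norm_mul, RCLike.norm_conj, norm_modeTwist, one_mul]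
    have h0 := ae_eq_zero_of_fourierCoeff_Ico_eq_zero hf fun m => by
      obtain ⟨K, hK, h⟩ := exists_mode_one_eq γ m q
      have h' := hq3 m
      have hK' : conj K ≠ 0 := (map_ne_zero _).2 hK
      refine (mul_eq_zero.1 (?_ : conj K * _ = 0)).resolve_left hK'
      rw [← h', ← integral_const_mul]
      congr 1
      funext p
      rw [h, map_mul, map_mul, ← Complex.exp_conj]
      simp only [map_mul, Complex.conj_ofReal, Complex.conj_I, map_ofNat, map_intCast]
      ring_nf
    filter_upwards [h0] with p hp
    refine (mul_eq_zero.1 hp).resolve_left ?_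
    rw [← norm_eq_zero, RCLike.norm_conj, norm_modeTwist]
    exact one_ne_zero
  have h2 : ∫⁻ z in stripSquare 0, ‖u.1 (ptEquiv τ z)‖ₑ = 0 := by
    rw [restrict_stripSquare_zero, lintegral_prod _ hm.enorm]
    rw [lintegral_congr_ae (g := fun _ => 0), lintegral_zero]
    filter_upwards [h1] with q hq
    rw [lintegral_congr_ae (g := fun _ => 0), lintegral_zero]
    filter_upwards [hq] with p hp
    simpa [ptEquiv_apply] using hp
  rw [lintegral_eq_zero_iff' hL.1.enorm] at h2
  have h3 := (ae_restrict_iff' (measurableSet_stripSquare 0)).1 h2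
  have h4 := (quasiMeasurePreserving_clequiv (ptEquiv τ).symm).ae h3
  have h5 : u.1 =ᵐ[volume.restrict (cell τ)] 0 := by
    refine (ae_restrict_iff' (measurableSet_cell τ)).2 ?_
    filter_upwards [h4] with x hx hxc
    have := hx (by rw [← preimage_ptEquiv_cell τ]; simpa using hxc)
    simpa using this
  exact Subtype.ext (AEEqFun.ext ((eq_zero_of_cell u.2.1 h5).trans AEEqFun.coeFn_zero.symm))

end Completeness

section Ground

/-! ### The ground states and the eigenbasis -/

/-- Uniqueness of the coefficients of an absolutely convergent Fourier series. -/
lemma eq_zero_of_hasSum_fourier {c : ℤ → ℂ}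
    (h : ∀ p : ℝ, HasSum (fun m : ℤ => c m * Complex.exp (2 * Real.pi * Complex.I * m * p)) 0) :
    c = 0 := by
  have hc : Summable c := by simpa using (h 0).summable
  have hs : Summable fun m : ℤ => c m • (fourier m : C(UnitAddCircle, ℂ)) := by
    refine .of_norm (hc.norm.congr fun m => ?_)
    rw [norm_smul, fourier_norm, mul_one]
  obtain ⟨g, hg⟩ := hs
  have hg0 : g = 0 := by
    ext x
    induction x using QuotientAddGroup.induction_on with
    | H p =>
      refine (ContinuousMap.hasSum_apply hg (p : UnitAddCircle)).unique ((h p).congr_fun fun m => ?_)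
      change c m * fourier m (p : UnitAddCircle) = _
      rw [fourier_coe_apply]
      simp
  subst hg0
  have h2 := hg.mapL (ContinuousMap.toLp (E := ℂ) 2 (AddCircle.haarAddCircle (T := 1)) ℂ)
  funext l
  -- Pairing with the l-th element of the orthonormal Fourier system isolates the l-th coefficient.
  have h3 := h2.mapL (innerSL ℂ (fourierLp (T := 1) 2 l))
  rw [map_zero, map_zero] at h3
  refine HasSum.unique ((hasSum_ite_eq l (c l)).congr_fun fun m => ?_) h3
  rw [map_smul, map_smul, innerSL_apply_apply, orthonormal_iff_ite.1 orthonormal_fourier]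
  by_cases hlm : l = m
  · subst hlm; simp
  · simp [hlm, Ne.symm hlm]

variable {τ : ℍ} {n : ℕ}

lemma smoothToL2_eq_zero_iff {γ : GaugePhase τ n} {f : smoothGauge γ} :
    smoothToL2 γ f = 0 ↔ f = 0 := by
  refine ⟨fun h => ?_, fun h => by rw [h, map_zero]⟩
  have h1 : f.1 =ᵐ[volume] 0 := by
    refine (coeFn_smoothToL2 f).symm.trans ?_
    rw [h]
    exact AEEqFun.coeFn_zero
  exact Subtype.ext ((Continuous.ae_eq_iff_eq volume f.2.1.continuous continuous_const).1 h1)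

variable [NeZero n]

/-- The linear map from weights to ground states. -/
def groundMap (γ : GaugePhase τ n) : (ZMod n → ℂ) →ₗ[ℂ] smoothGauge γ where
  toFun s := smoothMode γ s 1
  map_add' s t := by
    refine Subtype.ext (funext fun x => ?_)
    change modeSum γ (s + t) 1 x = modeSum γ s 1 x + modeSum γ t 1 x
    simp only [modeSum]
    rw [← (summable_mode γ s 1 x).tsum_add (summable_mode γ t 1 x)]
    exact tsum_congr fun m => by rw [Pi.add_apply]; ring
  map_smul' a s := by
    refine Subtype.ext (funext fun x => ?_)
    change modeSum γ (a • s) 1 x = a * modeSum γ s 1 x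
    simp only [modeSum, ← tsum_mul_left]
    exact tsum_congr fun m => by rw [Pi.smul_apply, smul_eq_mul]; ring

/-- On the line q = 0 a ground state is, up to a nonvanishing factor, a Fourier series with
coefficients s m times nonzero constants. -/
lemma groundMap_injective (γ : GaugePhase τ n) : Function.Injective (groundMap γ) := by
  rw [injective_iff_map_eq_zero]
  intro s hs
  choose K hK h using fun m => exists_mode_one_eq γ m 0
  have h0 : (fun m : ℤ => s m * K m) = 0 := by
    refine eq_zero_of_hasSum_fourier fun p => ?_
    have h1 : modeSum γ s 1 (pt τ p 0) = 0 := congrFun (congrArg Subtype.val hs) _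
    have h2 := (summable_mode γ s 1 (pt τ p 0)).hasSum
    rw [← modeSum, h1] at h2
    have h3 := h2.mul_left (modeTwist γ p 0)⁻¹
    have ht : modeTwist γ p 0 ≠ 0 := Complex.exp_ne_zero _
    rw [mul_zero] at h3
    refine h3.congr_fun fun m => ?_
    rw [h]
    field_simp
  funext z
  have := congrFun h0 (z.val : ℤ)
  simp only [Pi.zero_apply, mul_eq_zero, hK, or_false] at this
  simpa using this

/-- The space of ground states. -/
def groundSpace (γ : GaugePhase τ n) : Submodule ℂ (smoothGauge γ) := LinearMap.range (groundMap γ)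

lemma finrank_groundSpace (γ : GaugePhase τ n) : Module.finrank ℂ (groundSpace γ) = n := by
  rw [groundSpace, LinearMap.finrank_range_of_inj (groundMap_injective γ),
    Module.finrank_fintype_fun_eq_card, ZMod.card]

instance finiteDimensional_groundSpace (γ : GaugePhase τ n) :
    FiniteDimensional ℂ (groundSpace γ) :=
  inferInstanceAs (FiniteDimensional ℂ (LinearMap.range (groundMap γ)))

lemma lowering_of_mem_groundSpace {γ : GaugePhase τ n} {v : smoothGauge γ}
    (hv : v ∈ groundSpace γ) : lowering (smoothCov γ) v = 0 := by
  obtain ⟨s, rfl⟩ := hv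
  exact lowering_smoothMode_one γ s

/-- The span of all states created from the ground states. -/
def ladderSpan (γ : GaugePhase τ n) : Submodule ℂ (smoothGauge γ) :=
  Submodule.span ℂ {x | ∃ k, ∃ v ∈ groundSpace γ, x = (raising (smoothCov γ) ^ k) v}

lemma raising_mem_ladderSpan {γ : GaugePhase τ n} {x : smoothGauge γ} (hx : x ∈ ladderSpan γ) :
    raising (smoothCov γ) x ∈ ladderSpan γ := by
  have : ladderSpan γ ≤ (ladderSpan γ).comap (raising (smoothCov γ)) := by
    refine Submodule.span_le.2 ?_
    rintro _ ⟨k, v, hv, rfl⟩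
    refine Submodule.subset_span ⟨k + 1, v, hv, ?_⟩
    rw [pow_succ']
    rfl
  exact this hx

lemma lowering_mem_ladderSpan {γ : GaugePhase τ n} {x : smoothGauge γ} (hx : x ∈ ladderSpan γ) :
    lowering (smoothCov γ) x ∈ ladderSpan γ := by
  have : ladderSpan γ ≤ (ladderSpan γ).comap (lowering (smoothCov γ)) := by
    refine Submodule.span_le.2 ?_
    rintro _ ⟨k, v, hv, rfl⟩
    cases k with
    | zero =>
      change lowering (smoothCov γ) v ∈ ladderSpan γ
      rw [lowering_of_mem_groundSpace hv]
      exact Submodule.zero_mem _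
    | succ k =>
      change lowering (smoothCov γ) _ ∈ ladderSpan γ
      rw [lowering_raising_pow (covariantPair_smooth γ) (lowering_of_mem_groundSpace hv)]
      exact Submodule.smul_mem _ _ (Submodule.subset_span ⟨k, v, hv, rfl⟩)
  exact this hx

/-- Multiplication by X is the first covariant derivative divided by i·n, and this derivative is
half the difference of `lowering` and `raising`, both of which preserve the span. -/
lemma smoothMode_X_mul_mem_ladderSpan {γ : GaugePhase τ n} {s : ZMod n → ℂ} {P : Polynomial ℂ}
    (h : smoothMode γ s P ∈ ladderSpan γ) : smoothMode γ s (Polynomial.X * P) ∈ ladderSpan γ := by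
  have h1 : smoothCov γ 0 (smoothMode γ s P) ∈ ladderSpan γ := by
    rw [zero_eq_half_ladder]
    exact Submodule.smul_mem _ _
      (Submodule.sub_mem _ (lowering_mem_ladderSpan h) (raising_mem_ladderSpan h))
  rw [smoothCov_smoothMode] at h1
  change smoothMode γ s (Polynomial.C (Complex.I * n) * (Polynomial.X * P)) ∈ _ at h1
  rw [smoothMode_C_mul] at h1
  exact (Submodule.smul_mem_iff _ (mul_ne_zero Complex.I_ne_zero
    (Nat.cast_ne_zero.2 (NeZero.ne n)))).1 h1

lemma smoothMode_mem_ladderSpan (γ : GaugePhase τ n) (s : ZMod n → ℂ) (P : Polynomial ℂ) :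
    smoothMode γ s P ∈ ladderSpan γ := by
  induction P using Polynomial.induction_on' with
  | add P Q hP hQ =>
    rw [smoothMode_add]
    exact Submodule.add_mem _ hP hQ
  | monomial k a =>
    rw [← Polynomial.C_mul_X_pow_eq_monomial, smoothMode_C_mul]
    refine Submodule.smul_mem _ _ ?_
    induction k with
    | zero => exact Submodule.subset_span ⟨0, _, ⟨s, rfl⟩, by rw [pow_zero]; rfl⟩
    | succ k ih =>
      rw [pow_succ']
      exact smoothMode_X_mul_mem_ladderSpan ih

lemma exists_eigenbasis (γ : GaugePhase τ n) :
    ∃ (b : HilbertBasis (ℕ × Fin n) ℂ (GaugeL2 γ)) (e : ℕ × Fin n → smoothGauge γ),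
      (∀ i, b i = smoothToL2 γ (e i)) ∧
      (∀ i, negLaplacian (smoothCov γ) (e i) = (((2 * i.1 + 1) * n : ℝ) : ℂ) • e i) ∧
      ∀ l, e (0, l) ∈ groundSpace γ := by
  have htot : ∀ u : GaugeL2 γ, (∀ k, ∀ v ∈ groundSpace γ,
      inner ℂ (smoothToL2 γ ((raising (smoothCov γ) ^ k) v)) u = 0) → u = 0 := by
    refine fun u hu => eq_zero_of_inner_smoothMode fun s P => ?_
    have h := smoothMode_mem_ladderSpan γ s P
    generalize smoothMode γ s P = x at h
    induction h using Submodule.span_induction with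
    | mem x hx =>
      obtain ⟨k, v, hv, rfl⟩ := hx
      exact hu k v hv
    | zero => rw [map_zero, inner_zero_left]
    | add x y _ _ hx hy => rw [map_add, inner_add_left, hx, hy, add_zero]
    | smul a x _ hx => rw [map_smul, inner_smul_left, hx, mul_zero]
  obtain ⟨b, e, hb, he, h0⟩ := exists_ladder_basis (covariantPair_smooth γ)
    (Nat.cast_pos.2 (NeZero.pos n)) (V := groundSpace γ)
    (fun v hv => lowering_of_mem_groundSpace hv) (fun v _ h => smoothToL2_eq_zero_iff.1 h)
    (finrank_groundSpace γ) htot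
  exact ⟨b, e, hb, fun i => by rw [he i]; push_cast; rfl, h0⟩

end Ground

/-! ### Eigenspaces and spectral gaps for the odd multiples of a positive number -/

section Spectrum

/-- The distance of a point from an unbounded arithmetic progression that avoids it. -/
lemma exists_gap {ν : ℝ} (hν : 0 < ν) {z : ℂ} (hz : ∀ m : ℕ, (((2 * m + 1) * ν : ℝ) : ℂ) ≠ z) :
    ∃ δ > 0, ∀ m : ℕ, δ ≤ ‖(((2 * m + 1) * ν : ℝ) : ℂ) - z‖ := by
  have h1 : ∀ N : ℕ, ∃ δ > 0, ∀ m < N, δ ≤ ‖(((2 * m + 1) * ν : ℝ) : ℂ) - z‖ := by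
    intro N
    induction N with
    | zero => exact ⟨1, one_pos, fun m hm => absurd hm (Nat.not_lt_zero m)⟩
    | succ N ih =>
      obtain ⟨δ, hδ, h⟩ := ih
      refine ⟨min δ ‖(((2 * N + 1) * ν : ℝ) : ℂ) - z‖,
        lt_min hδ (norm_pos_iff.2 (sub_ne_zero.2 (hz N))), fun m hm => ?_⟩
      rcases Nat.lt_succ_iff_lt_or_eq.1 hm with hm | rfl
      · exact (min_le_left _ _).trans (h m hm)
      · exact min_le_right _ _
  -- From this N on, the points of the progression exceed ‖z‖ by at least 1, so only finitely many
  -- distances remain to be compared.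
  obtain ⟨N, hN⟩ := exists_nat_ge ((1 + ‖z‖) / ν)
  obtain ⟨δ, hδ, h⟩ := h1 N
  refine ⟨min δ 1, lt_min hδ one_pos, fun m => ?_⟩
  rcases lt_or_ge m N with hm | hm
  · exact (min_le_left _ _).trans (h m hm)
  · refine (min_le_right _ _).trans (le_trans ?_ (norm_sub_norm_le _ _))
    rw [Complex.norm_real, Real.norm_of_nonneg (by positivity)]
    rw [div_le_iff₀ hν] at hN
    have : (N : ℝ) ≤ m := by exact_mod_cast hm
    have : (N : ℝ) * ν ≤ (2 * m + 1) * ν := by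
      gcongr
      linarith [(m.cast_nonneg : (0 : ℝ) ≤ m)]
    linarith

variable {H : Type*} [NormedAddCommGroup H] [InnerProductSpace ℂ H] {d : ℕ} {ν : ℝ}
  {b : HilbertBasis (ℕ × Fin d) ℂ H} {T : H →ₗ.[ℂ] H}

lemma eigenspace_of_diagonal (hν : 0 < ν)
    (hT : ∀ u f, (u, f) ∈ T.graph ↔
      ∀ i, inner ℂ (b i) f = (((2 * i.1 + 1) * ν : ℝ) : ℂ) * inner ℂ (b i) u) (m : ℕ) :
    eigenspace T (((2 * m + 1) * ν : ℝ) : ℂ) =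
      Submodule.span ℂ (Set.range fun l : Fin d => b (m, l)) := by
  classical
  have hne : ∀ k : ℕ, (((2 * k + 1) * ν : ℝ) : ℂ) ≠ (((2 * m + 1) * ν : ℝ) : ℂ) ↔ k ≠ m := by
    intro k
    rw [Ne, Complex.ofReal_inj, mul_left_inj' hν.ne']
    simp
  have hmem := fun u => mem_eigenspace_iff_of_diagonal (l := fun i : ℕ × Fin d => (2 * i.1 + 1) * ν) hT
    (((2 * m + 1) * ν : ℝ) : ℂ) u
  simp only [hne] at hmem
  refine le_antisymm (fun u hu => ?_) (Submodule.span_le.2 ?_)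
  · have hu' := (hmem u).1 hu
    have : u = ∑ l, inner ℂ (b (m, l)) u • b (m, l) := by
      refine hilbertBasis_ext b fun i => ?_
      obtain ⟨k, l⟩ := i
      simp only [inner_sum, inner_smul_right, orthonormal_iff_ite.1 b.orthonormal, Prod.mk.injEq]
      by_cases hk : k = m
      · subst hk; simp
      · simp [hk, hu' (k, l) hk]
    rw [this]
    exact Submodule.sum_mem _ fun l _ =>
      Submodule.smul_mem _ _ (Submodule.subset_span ⟨l, rfl⟩)
  · rintro _ ⟨l, rfl⟩
    refine (hmem _).2 fun i hi => ?_
    rw [orthonormal_iff_ite.1 b.orthonormal, if_neg]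
    rintro rfl
    exact hi rfl

lemma finrank_eigenspace_of_diagonal (hν : 0 < ν)
    (hT : ∀ u f, (u, f) ∈ T.graph ↔
      ∀ i, inner ℂ (b i) f = (((2 * i.1 + 1) * ν : ℝ) : ℂ) * inner ℂ (b i) u) (m : ℕ) :
    Module.finrank ℂ (eigenspace T (((2 * m + 1) * ν : ℝ) : ℂ)) = d := by
  rw [eigenspace_of_diagonal hν hT, finrank_span_eq_card, Fintype.card_fin]
  exact b.orthonormal.linearIndependent.comp _ (Prod.mk_right_injective m)

end Spectrum

section Theta

variable {τ : ℍ} {n : ℕ}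

/-! ### Theta functions -/

/-- The Gaussian coefficients `e^{iπτm²/n}`. -/
def thetaGauss (τ : ℍ) (n : ℕ) (m : ℤ) : ℂ :=
  Complex.exp (Real.pi * Complex.I * m ^ 2 * (τ / n))

lemma thetaGauss_ne_zero (τ : ℍ) (n : ℕ) (m : ℤ) : thetaGauss τ n m ≠ 0 := Complex.exp_ne_zero _

/-- Restricted to real arguments, the difference of the expansions is a Fourier series with sum
zero. -/
lemma IsThetaExpansion.unique {c c' : ℤ → ℂ} {θ : ℂ → ℂ} (h : IsThetaExpansion τ n c θ)
    (h' : IsThetaExpansion τ n c' θ) : c = c' := by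
  rw [← sub_eq_zero]
  refine eq_zero_of_hasSum_fourier fun p => ?_
  have := (h.2 p).sub (h'.2 p)
  rw [sub_self] at this
  exact this.congr_fun fun m => by rw [Pi.sub_apply, sub_mul]

/-- The first `n` coefficients of a theta function. -/
def thetaCoeff (τ : ℍ) (n : ℕ) : thetaSpace τ n →ₗ[ℂ] (Fin n → ℂ) where
  toFun θ j := Classical.choose θ.2 ((j : ℕ) : ℤ)
  map_add' θ θ' := by
    have h1 := Classical.choose_spec θ.2
    have h2 := Classical.choose_spec θ'.2
    have h := (Classical.choose_spec (θ + θ').2).unique (c' := Classical.choose θ.2 +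
      Classical.choose θ'.2) ⟨fun m => ?_, fun z => ?_⟩
    · funext j
      exact congrFun h _
    · simp only [Pi.add_apply, h1.1, h2.1]; ring
    · simpa [add_mul] using (h1.2 z).add (h2.2 z)
  map_smul' a θ := by
    have h1 := Classical.choose_spec θ.2
    have h := (Classical.choose_spec (a • θ).2).unique (c' := a • Classical.choose θ.2)
      ⟨fun m => ?_, fun z => ?_⟩
    · funext j
      exact congrFun h _
    · simp only [Pi.smul_apply, smul_eq_mul, h1.1]; ring
    · simpa [mul_assoc] using (h1.2 z).mul_left a

lemma thetaCoeff_apply {θ : thetaSpace τ n} {c : ℤ → ℂ} (h : IsThetaExpansion τ n c θ)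
    (j : Fin n) : thetaCoeff τ n θ j = c ((j : ℕ) : ℤ) :=
  congrFun ((Classical.choose_spec θ.2).unique h) _

variable [NeZero n]

/-- From (m + n)²/n = m²/n + 2m + n: the Gaussian coefficients solve the theta recursion, so every
other solution is a multiple of them by an n-periodic sequence. -/
lemma thetaGauss_add (m : ℤ) : thetaGauss τ n (m + n) =
    Complex.exp (Complex.I * Real.pi * n * τ) * Complex.exp (2 * Complex.I * m * Real.pi * τ) *
      thetaGauss τ n m := by
  have hn : (n : ℂ) ≠ 0 := Nat.cast_ne_zero.2 (NeZero.ne n)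
  rw [thetaGauss, thetaGauss, ← Complex.exp_add, ← Complex.exp_add]
  congr 1
  push_cast
  field_simp
  ring

/-- Coefficients of theta functions are periodic up to the Gaussian factor. -/
lemma exists_weight {c : ℤ → ℂ} (h : ∀ m : ℤ, c (m + n) =
    Complex.exp (Complex.I * Real.pi * n * τ) * Complex.exp (2 * Complex.I * m * Real.pi * τ) * c m) :
    ∃ s : ZMod n → ℂ, ∀ m : ℤ, c m = s m * thetaGauss τ n m := by
  have hper : Function.Periodic (fun m => c m / thetaGauss τ n m) (n : ℤ) := by
    intro m
    simp only
    rw [h, thetaGauss_add]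
    have h1 := thetaGauss_ne_zero τ n m
    have h2 := Complex.exp_ne_zero (Complex.I * Real.pi * n * τ)
    have h3 := Complex.exp_ne_zero (2 * Complex.I * m * Real.pi * τ)
    field_simp
  refine ⟨fun z => c (z.val : ℤ) / thetaGauss τ n (z.val : ℤ), fun m => ?_⟩
  have h1 : ((m : ZMod n).val : ℤ) = m - (m / n) * n := by
    rw [ZMod.val_intCast, Int.emod_def]
    ring
  have h2 := hper.sub_int_mul_eq (m / n) (x := m)
  have h3 := thetaGauss_ne_zero τ n m
  simp only at h2 ⊢
  rw [h1]
  rw [eq_comm, ← eq_div_iff h3]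
  simpa using h2

/-- The theta function with given weights. -/
def thetaSum (τ : ℍ) (s : ZMod n → ℂ) (z : ℂ) : ℂ :=
  ∑' m : ℤ, s m * thetaGauss τ n m * Complex.exp (2 * Real.pi * Complex.I * m * z)

/-- Up to bounded weights the terms are those of the Jacobi theta function with parameter τ/n, which
gives convergence for every initial choice of coefficients. -/
lemma hasSum_theta (s : ZMod n → ℂ) (z : ℂ) :
    HasSum (fun m : ℤ => s m * thetaGauss τ n m * Complex.exp (2 * Real.pi * Complex.I * m * z))
      (thetaSum τ s z) := by
  refine Summable.hasSum ?_
  obtain ⟨B, hB, h⟩ := exists_weight_bound s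
  have him : 0 < ((τ : ℂ) / n).im := by
    rw [Complex.div_natCast_im]
    exact div_pos τ.im_pos (Nat.cast_pos.2 (NeZero.pos n))
  have hs := ((summable_jacobiTheta₂_term_iff z ((τ : ℂ) / n)).2 him).norm.mul_left B
  refine .of_norm_bounded hs fun m => ?_
  rw [mul_assoc, norm_mul]
  refine mul_le_mul (h _) (le_of_eq ?_) (norm_nonneg _) hB
  rw [jacobiTheta₂_term, thetaGauss, ← Complex.exp_add, add_comm]

lemma isThetaExpansion_thetaSum (s : ZMod n → ℂ) :
    IsThetaExpansion τ n (fun m => s m * thetaGauss τ n m) (thetaSum τ s) := by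
  refine ⟨fun m => ?_, fun z => hasSum_theta s z⟩
  beta_reduce
  rw [thetaGauss_add]
  simp
  ring

lemma mem_thetaSpace_iff {θ : ℂ → ℂ} :
    θ ∈ thetaSpace τ n ↔ ∃ s : ZMod n → ℂ, θ = thetaSum τ s := by
  constructor
  · rintro ⟨c, h⟩
    obtain ⟨s, hs⟩ := exists_weight h.1
    refine ⟨s, funext fun z => (h.2 z).unique ((hasSum_theta s z).congr_fun fun m => ?_)⟩
    rw [hs]
  · rintro ⟨s, rfl⟩
    exact ⟨_, isThetaExpansion_thetaSum s⟩

lemma thetaCoeff_bijective (τ : ℍ) (n : ℕ) [NeZero n] : Function.Bijective (thetaCoeff τ n) := by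
  constructor
  · rw [injective_iff_map_eq_zero]
    rintro ⟨θ, hθ⟩ h
    obtain ⟨s, rfl⟩ := mem_thetaSpace_iff.1 hθ
    have hs : s = 0 := by
      funext z
      have h1 := congrFun h ⟨z.val, ZMod.val_lt z⟩
      rw [thetaCoeff_apply (isThetaExpansion_thetaSum s)] at h1
      simpa [thetaGauss_ne_zero] using h1
    refine Subtype.ext (funext fun z => ?_)
    simp [thetaSum, hs]
  · intro a
    let s : ZMod n → ℂ := fun z => a ⟨z.val, ZMod.val_lt z⟩ / thetaGauss τ n (z.val : ℤ)
    refine ⟨⟨thetaSum τ s, _, isThetaExpansion_thetaSum s⟩, funext fun j => ?_⟩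
    rw [thetaCoeff_apply (isThetaExpansion_thetaSum s)]
    simp only [Int.cast_natCast, s, ZMod.val_natCast_of_lt j.2]
    exact div_mul_cancel₀ _ (thetaGauss_ne_zero _ _ _)

/-- For trivial phases on the basis vectors, the ground states are theta functions. -/
lemma modeSum_one_eq_theta {γ : GaugePhase τ n} (h1 : γ.c (latticePt τ 1 0) = 0)
    (h2 : γ.c (latticePt τ 0 1) = 0) (s : ZMod n → ℂ) (x : ℂ) :
    modeSum γ s 1 x = thetaFactor n x * thetaSum τ s (x / (scale τ : ℂ)) := by
  have hn : (n : ℂ) ≠ 0 := Nat.cast_ne_zero.2 (NeZero.ne n)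
  have hr : (scale τ : ℂ) ≠ 0 := Complex.ofReal_ne_zero.2 (scale_pos τ).ne'
  have hsc : (scale τ : ℂ) * scale τ * τ.im = 2 * Real.pi := by exact_mod_cast scale_mul_scale τ
  rw [modeSum, thetaSum, ← tsum_mul_left]
  refine tsum_congr fun m => ?_
  have hI : Complex.I ^ 2 = -1 := Complex.I_sq
  have : mode γ 1 m x = thetaFactor n x * (thetaGauss τ n m *
      Complex.exp (2 * Real.pi * Complex.I * m * (x / scale τ))) := by
    rw [mode, thetaFactor, thetaGauss, Polynomial.eval_one, mul_one, ← Complex.exp_add,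
      ← Complex.exp_add]
    congr 1
    have hx : x = x.re + x.im * Complex.I := (Complex.re_add_im x).symm
    have hτ : (τ : ℂ) = τ.re + τ.im * Complex.I := (Complex.re_add_im (τ : ℂ)).symm
    have hκ : (kappa γ m : ℂ) = 2 * Real.pi * m / scale τ := by simp [kappa, h1]
    -- By r² Im τ = 2π, the constant part of the Gaussian in x₂ is e^{-π Im τ m²/n}, the modulus of
    -- `thetaGauss`; its phase is supplied by `modePhase`.
    have hκ2 : (kappa γ m : ℂ) ^ 2 = 2 * Real.pi * m ^ 2 * τ.im := by
      rw [hκ, div_pow, div_eq_iff (pow_ne_zero 2 hr)]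
      linear_combination (-2 * Real.pi * m ^ 2 : ℂ) * hsc
    have hwave : 2 * Real.pi * Complex.I * m * (x / scale τ) =
        Complex.I * kappa γ m * (x.re + x.im * Complex.I) := by
      rw [Complex.re_add_im, hκ]
      ring
    rw [hwave, hτ]
    simp only [modePhase, modeY, h1, h2]
    push_cast
    field_simp
    linear_combination (-1 : ℂ) * hκ2 +
      (n * (x.im : ℂ) ^ 2 * n + 2 * n * kappa γ m * x.im + 2 * Real.pi * m ^ 2 * τ.im) * (-hI)
  rw [this]
  ring

end Theta

section Final

variable {τ : ℍ} {n : ℕ} [NeZero n]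

/-! ### The spectral theorem for the magnetic Laplacian -/

lemma exists_diagonalization (γ : GaugePhase τ n) :
    ∃ b : HilbertBasis (ℕ × Fin n) ℂ (GaugeL2 γ),
      (∀ u f, (u, f) ∈ (magneticLaplacian γ).graph ↔
        ∀ i, inner ℂ (b i) f = (((2 * i.1 + 1) * n : ℝ) : ℂ) * inner ℂ (b i) u) ∧
      ∀ l, b (0, l) ∈ (groundSpace γ).map (smoothToL2 γ) := by
  obtain ⟨b, e, hb, he, h0⟩ := exists_eigenbasis γ
  exact ⟨b, mem_graph_iff_of_basis b e hb (fun i => (2 * i.1 + 1) * n) he,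
    fun l => hb (0, l) ▸ Submodule.mem_map_of_mem (h0 l)⟩

lemma isSelfAdjoint_magneticLaplacian (γ : GaugePhase τ n) :
    IsSelfAdjoint (magneticLaplacian γ) := by
  obtain ⟨b, hT, -⟩ := exists_diagonalization γ
  exact isSelfAdjoint_of_diagonal (l := fun i : ℕ × Fin n => (2 * i.1 + 1) * n) hT

lemma unboundedSpectrum_magneticLaplacian (γ : GaugePhase τ n) :
    unboundedSpectrum (magneticLaplacian γ) =
      Set.range fun m : ℕ => (2 * (m : ℂ) + 1) * (n : ℂ) := by
  obtain ⟨b, hT, -⟩ := exists_diagonalization γ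
  have hr : Set.range (fun i : ℕ × Fin n => (((2 * i.1 + 1) * n : ℝ) : ℂ)) =
      Set.range fun m : ℕ => (2 * (m : ℂ) + 1) * (n : ℂ) := by
    ext z
    constructor
    · rintro ⟨i, rfl⟩
      exact ⟨i.1, by push_cast; rfl⟩
    · rintro ⟨m, rfl⟩
      exact ⟨(m, 0), by push_cast; rfl⟩
  rw [← hr]
  refine unboundedSpectrum_of_diagonal (l := fun i : ℕ × Fin n => (2 * i.1 + 1) * n) hT
    fun z hz => ?_
  obtain ⟨δ, hδ, h⟩ := exists_gap (ν := n) (Nat.cast_pos.2 (NeZero.pos n)) (z := z)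
    fun m hm => hz ⟨(m, 0), hm⟩
  exact ⟨δ, hδ, fun i => h i.1⟩

lemma finrank_eigenspace_magneticLaplacian (γ : GaugePhase τ n) (m : ℕ) :
    Module.finrank ℂ (eigenspace (magneticLaplacian γ) ((2 * (m : ℂ) + 1) * (n : ℂ))) = n := by
  obtain ⟨b, hT, -⟩ := exists_diagonalization γ
  have hz : (2 * (m : ℂ) + 1) * (n : ℂ) = (((2 * m + 1) * n : ℝ) : ℂ) := by push_cast; rfl
  rw [hz]
  exact finrank_eigenspace_of_diagonal (Nat.cast_pos.2 (NeZero.pos n)) hT m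

/-- The level-zero basis vectors come from vacuum functions and span the eigenspace; both spaces
have dimension n. So every lowest eigenfunction is smooth and explicit, without a regularity
argument. -/
lemma eigenspace_eq_groundSpace (γ : GaugePhase τ n) :
    eigenspace (magneticLaplacian γ) (n : ℂ) = (groundSpace γ).map (smoothToL2 γ) := by
  obtain ⟨b, hT, h0⟩ := exists_diagonalization γ
  have h := eigenspace_of_diagonal (Nat.cast_pos.2 (NeZero.pos n)) hT 0
  have hf := finrank_eigenspace_magneticLaplacian γ 0
  have hz : (2 * ((0 : ℕ) : ℂ) + 1) * (n : ℂ) = n := by simp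
  rw [hz] at hf
  simp only [Nat.cast_zero, mul_zero, zero_add, one_mul, Complex.ofReal_natCast] at h
  refine Submodule.eq_of_le_of_finrank_eq ?_ ?_
  · rw [h, Submodule.span_le]
    rintro _ ⟨l, rfl⟩
    exact h0 l
  · have hinj : Function.Injective (smoothToL2 γ) :=
      (injective_iff_map_eq_zero _).2 fun f hf => smoothToL2_eq_zero_iff.1 hf
    rw [hf, ← (Submodule.equivMapOfInjective _ hinj _).finrank_eq, finrank_groundSpace]

lemma ground_state_iff_theta {γ : GaugePhase τ n} (h1 : γ.c (latticePt τ 1 0) = 0)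
    (h2 : γ.c (latticePt τ 0 1) = 0) (ψ : ℂ → ℂ) :
    (∃ u ∈ eigenspace (magneticLaplacian γ) (n : ℂ), ψ =ᵐ[volume] u.1) ↔
      ∃ θ ∈ thetaSpace τ n, ψ =ᵐ[volume] fun x => thetaFactor n x * θ (x / (scale τ : ℂ)) := by
  have key : ∀ s, (smoothToL2 γ (groundMap γ s)).1 =ᵐ[volume]
      fun x => thetaFactor n x * thetaSum τ s (x / (scale τ : ℂ)) := fun s =>
    (coeFn_smoothToL2 (groundMap γ s)).trans (.of_forall fun x => modeSum_one_eq_theta h1 h2 s x)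
  rw [eigenspace_eq_groundSpace]
  constructor
  · rintro ⟨_, ⟨_, ⟨s, rfl⟩, rfl⟩, h⟩
    exact ⟨thetaSum τ s, mem_thetaSpace_iff.2 ⟨s, rfl⟩, h.trans (key s)⟩
  · rintro ⟨θ, hθ, h⟩
    obtain ⟨s, rfl⟩ := mem_thetaSpace_iff.1 hθ
    exact ⟨_, ⟨_, ⟨s, rfl⟩, rfl⟩, h.trans (key s).symm⟩

end Final

end Landau

end

theorem mainTheorem9 (τ : ℍ) (n : ℕ) (hn : 0 < n) (γ : Landau.GaugePhase τ n) :
    -- `-Δ_{aⁿ}` is self-adjoint, and its domain is the gauge-periodic Sobolev space of order two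
    IsSelfAdjoint (Landau.magneticLaplacian γ) ∧
    (∀ u : Landau.GaugeL2 γ, u ∈ (Landau.magneticLaplacian γ).domain ↔ Landau.MemH2Loc u.1) ∧
    -- the spectrum and the multiplicities
    Landau.unboundedSpectrum (Landau.magneticLaplacian γ) =
      Set.range (fun m : ℕ => (2 * (m : ℂ) + 1) * (n : ℂ)) ∧
    (∀ m : ℕ, Module.finrank ℂ
      (Landau.eigenspace (Landau.magneticLaplacian γ) ((2 * (m : ℂ) + 1) * (n : ℂ))) = n) ∧
    -- the lowest eigenspace, when `c_t = 0` on the two basis vectors of the lattice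
    (γ.c (Landau.latticePt τ 1 0) = 0 → γ.c (Landau.latticePt τ 0 1) = 0 →
      ∀ ψ : ℂ → ℂ,
        (∃ u ∈ Landau.eigenspace (Landau.magneticLaplacian γ) (n : ℂ), ψ =ᵐ[volume] u.1) ↔
          ∃ θ ∈ Landau.thetaSpace τ n,
            ψ =ᵐ[volume] fun x => Landau.thetaFactor n x * θ (x / (Landau.scale τ : ℂ))) ∧
    -- theta functions are determined by `c_0, …, c_{n-1}`, which are arbitrary
    (∃ e : Landau.thetaSpace τ n ≃ₗ[ℂ] (Fin n → ℂ),
      ∀ (θ : Landau.thetaSpace τ n) (c : ℤ → ℂ), Landau.IsThetaExpansion τ n c θ →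
        ∀ j : Fin n, e θ j = c ((j : ℕ) : ℤ)) ∧
    Module.finrank ℂ (Landau.thetaSpace τ n) = n := by
  have : NeZero n := ⟨hn.ne'⟩
  let e := LinearEquiv.ofBijective (Landau.thetaCoeff τ n) (Landau.thetaCoeff_bijective τ n)
  refine ⟨Landau.isSelfAdjoint_magneticLaplacian γ, Landau.mem_domain_iff_memH2Loc,
    Landau.unboundedSpectrum_magneticLaplacian γ, Landau.finrank_eigenspace_magneticLaplacian γ,
    fun h1 h2 => Landau.ground_state_iff_theta h1 h2,
    ⟨e, fun θ c h j => Landau.thetaCoeff_apply h j⟩, ?_⟩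
  rw [e.finrank_eq, Module.finrank_fin_fun]
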